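/- Let $k\ge 1$ and let $\lambda=(\lambda_1\ge\dots\ge\lambda_k\ge 0)$, $\nu=(\nu_1\ge\dots\ge\nu_k\ge 0)$ be partitions with at most $k$ parts. Let $h_m=h_m(x_1,\dots,x_k)$ be the complete homogeneous symmetric polynomials ($h_m=0$ for $m<0$), and let the skew Schur polynomial be $$s_{\lambda/\nu}(x_1,\dots,x_k)=\det\bigl(h_{\lambda_i-\nu_j-i+j}(x_1,\dots,x_k)\bigr)_{i,j};$$ for $\nu=\varnothing$ this is the ordinary Schur polynomial $s_\lambda$ (in $x_1,\dots,x_k$, also when $\lambda$ is written with only $p\le k$ parts and the determinant is $p\times p$). A subtraction-free arithmetic circuit takes as inputs the variables and arbitrary positive integer scalars; its gates perform additions, multiplications and divisions (by nonzero rational functions) in $\mathbb{Q}(x_1,\dots,x_k)$; its size is the number of its gates. 1. There is one algorithm that, for all $k\ge1$ and $\nu\subset\lambda$ (i.e. $\nu_i\le\lambda_i$ for all $i$), produces from $(k,\lambda,\nu)$ a subtraction-free arithmetic circuit of size $O(n^5)$ that computes $s_{\lambda/\nu}(x_1,\dots,x_k)$, where $n=k+\lambda_1$. The bit complexity of this algorithm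 is $O(n^5\log^2 n)$. Here the bit complexity is the cost, on a random access machine with logarithmic cost (each instruction is charged the number of bits of the integers and addresses that it handles, and the schoolbook cost for a multiplication), of determining the successive arithmetic operations of the circuit, plus the schoolbook cost $w^2$ for each of these operations, with numbers of $w=\lfloor\log_2 n\rfloor+1$ bits. The constants are absolute. 2. $s_{\lambda/\nu}(x_1,\dots,x_k)\ne0$ if and only if $\nu\subset\lambda$. 3. For $n\ge k$ let $H_\nu=(h_{i-j}(x_1,\dots,x_k))$ be the matrix with rows $i=1,\dots,n$ and columns $j\in\{\nu_k+1<\nu_{k-1}+2<\dots<\nu_1+k\}$. For $I\subset\{1,2,\dots\}$ with $|I|\le k$ let $s_I$ be its flag minor with row set $I$ and the first $|I|$ columns. Let $I=\{a+1,\dots,a+p\}\subset\{1,\dots,n\}$ be an interval with $1\le p\le k$. If one of $\nu_{k-p+1},\dots,\nu_k$ exceeds $a$, then $s_I=0$. Otherwise $s_I$ is the ordinary Schur polynomial $s_\theta(x_1,\dots,x_k)$ with $\theta=(a-\nu_k,a-\nu_{k-1},\dots,a-\nu_{k-p+1})$, and it is computed by a subtraction-free circuit of size $O(n^3)$, with an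 absolute constant. 4. Let $p<q<r$ be positive integers and let $J$ be a finite set of positive integers that contains none of them, with $|J|+2\le k$. If the flag minor $e=s_{J\cup\{q\}}$ vanishes, then so does $f=s_{J\cup\{p,r\}}$. (Here $H_\nu$ may have as many rows as needed.) -/

import Mathlib

namespace SkewSchur

noncomputable section

open MvPolynomial

/-! ### Skew Schur polynomials and the Toeplitz matrix -/

/-- The complete homogeneous symmetric polynomial `h_m(x_1, …, x_k)`, with `h_m = 0` for `m < 0`. -/
def hpoly (k : ℕ) (m : ℤ) : MvPolynomial (Fin k) ℚ :=
  if 0 ≤ m then hsymm (Fin k) ℚ m.toNat else 0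

/-- The skew Schur polynomial `s_{λ/ν}(x_1, …, x_k)` of two partitions with at most `p` parts
(weakly decreasing sequences of length `p`, trailing zeros allowed), by the Jacobi-Trudi formula
`det (h_{λ_i - ν_j - i + j})`. -/
def skewSchur (k : ℕ) {p : ℕ} (lam nu : Fin p → ℕ) : MvPolynomial (Fin k) ℚ :=
  (Matrix.of fun i j : Fin p =>
    hpoly k ((lam i : ℤ) - (nu j : ℤ) - ((i : ℕ) : ℤ) + ((j : ℕ) : ℤ))).det

/-- The ordinary Schur polynomial `s_θ = s_{θ/∅}` in `x_1, …, x_k`. -/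
def schur (k : ℕ) {p : ℕ} (theta : Fin p → ℕ) : MvPolynomial (Fin k) ℚ :=
  skewSchur k theta (fun _ => 0)

/-- The columns `I(ν) = {ν_k + 1 < ν_{k-1} + 2 < ⋯ < ν_1 + k}`, listed in increasing order
(the position `c` counts from `0`, so that `c.rev` points at the part `ν_{k-c}`). -/
def column {k : ℕ} (nu : Fin k → ℕ) (c : Fin k) : ℕ :=
  nu c.rev + (c : ℕ) + 1

/-- The matrix `H_ν = (h_{i-j}(x_1, …, x_k))`, with rows `i = 1, 2, …` and columns `j ∈ I(ν)`. -/
def toeplitz {k : ℕ} (nu : Fin k → ℕ) : Matrix ℕ (Fin k) (MvPolynomial (Fin k) ℚ) :=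
  Matrix.of fun i c => hpoly k ((i : ℤ) - (column nu c : ℤ))

/-- The flag minor of `H_ν` with row set `I`: the rows in `I`, in increasing order, and the
first `|I|` columns. -/
def flagMinor {k : ℕ} (nu : Fin k → ℕ) (I : Finset ℕ) (hI : I.card ≤ k) :
    MvPolynomial (Fin k) ℚ :=
  ((toeplitz nu).submatrix (I.orderEmbOfFin rfl) (Fin.castLE hI)).det

/-! ### Subtraction-free arithmetic circuits -/

/-- The field of rational functions `ℚ(x_1, …, x_k)`. -/
abbrev RatField (k : ℕ) : Type := FractionRing (MvPolynomial (Fin k) ℚ)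

/-- The operations allowed in a subtraction-free circuit. -/
inductive Op where
  | add
  | mul
  | div

/-- What a gate can be fed with: a variable (`var i` is the one with number `i`, counting from
`0`), an integer scalar, or the result of the gate with number `j`. -/
inductive Operand where
  | var (i : ℕ)
  | scalar (c : ℕ)
  | gate (j : ℕ)

/-- An arithmetic gate. -/
structure Gate where
  op : Op
  left : Operand
  right : Operand

/-- A subtraction-free circuit: its gates, in an order of evaluation. Its size is the length of
this list, and its output is the result of the last gate. -/
abbrev Circuit : Type := List Gate

/-- `OperandValue vals a y`: the operand `a` has the value `y`, when `vals` lists the results of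
the gates that have been evaluated. Only positive scalars have a value. -/
inductive OperandValue {k : ℕ} (vals : List (RatField k)) : Operand → RatField k → Prop where
  | var (i : Fin k) :
      OperandValue vals (.var i) (algebraMap (MvPolynomial (Fin k) ℚ) (RatField k) (X i))
  | scalar (c : ℕ) (hc : 0 < c) : OperandValue vals (.scalar c) (c : RatField k)
  | gate (j : ℕ) (hj : j < vals.length) : OperandValue vals (.gate j) vals[j]

/-- The result of a gate; a division needs a nonzero denominator. -/
inductive GateValue {k : ℕ} (vals : List (RatField k)) : Gate → RatField k → Prop where
  | add {a b : Operand} {y z : RatField k} (ha : OperandValue vals a y)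
      (hb : OperandValue vals b z) : GateValue vals ⟨.add, a, b⟩ (y + z)
  | mul {a b : Operand} {y z : RatField k} (ha : OperandValue vals a y)
      (hb : OperandValue vals b z) : GateValue vals ⟨.mul, a, b⟩ (y * z)
  | div {a b : Operand} {y z : RatField k} (ha : OperandValue vals a y)
      (hb : OperandValue vals b z) (hz : z ≠ 0) : GateValue vals ⟨.div, a, b⟩ (y / z)

/-- `CircuitValues c vals`: the gates of `c` have, in order, the results `vals`. -/
inductive CircuitValues {k : ℕ} : Circuit → List (RatField k) → Prop where
  | nil : CircuitValues [] []
  | snoc {c : Circuit} {vals : List (RatField k)} {g : Gate} {y : RatField k}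
      (hc : CircuitValues c vals) (hg : GateValue vals g y) :
      CircuitValues (c ++ [g]) (vals ++ [y])

/-- The circuit `c` computes the polynomial `f` in `x_1, …, x_k`. -/
def Computes {k : ℕ} (c : Circuit) (f : MvPolynomial (Fin k) ℚ) : Prop :=
  ∃ vals : List (RatField k),
    CircuitValues c (vals ++ [algebraMap (MvPolynomial (Fin k) ℚ) (RatField k) f])

/-! ### Bit complexity

The machine is a random access machine under the logarithmic cost criterion: every number that
an instruction handles, addresses included, is charged its number of binary digits. The machine
works on the combinatorial data (the integer `k` and the two partitions) and issues, one at
a time, the arithmetic operations that are to be performed on the numbers `x_1, …, x_k`. -/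

/-- A state: the registers, the memory, and the arithmetic gates issued so far. -/
structure State where
  reg : ℕ → ℕ
  mem : ℕ → ℕ
  out : Circuit

/-- The instructions; `x`, `y`, `z` are registers. -/
inductive Instr where
  /-- `x := c` -/
  | set (x c : ℕ)
  /-- `x := y + z` -/
  | add (x y z : ℕ)
  /-- `x := max (y - z) 0` -/
  | sub (x y z : ℕ)
  /-- `x := y * z` -/
  | mul (x y z : ℕ)
  /-- `x := memory[y]` -/
  | load (x y : ℕ)
  /-- `memory[x] := y` -/
  | store (x y : ℕ)
  /-- issue a gate; the numbers in the two operands are the registers that hold the number of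
  the variable, the scalar, or the number of the gate -/
  | emit (o : Op) (a b : Operand)

/-- Replace the register in an operand by its content. -/
def Operand.read (reg : ℕ → ℕ) : Operand → Operand
  | .var x => .var (reg x)
  | .scalar x => .scalar (reg x)
  | .gate x => .gate (reg x)

/-- The number of binary digits of the number in an operand. -/
def Operand.bits : Operand → ℕ
  | .var i => i.size
  | .scalar c => c.size
  | .gate j => j.size

/-- The effect of an instruction. -/
def Instr.run (s : State) : Instr → State
  | .set x c => { s with reg := Function.update s.reg x c }
  | .add x y z => { s with reg := Function.update s.reg x (s.reg y + s.reg z) }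
  | .sub x y z => { s with reg := Function.update s.reg x (s.reg y - s.reg z) }
  | .mul x y z => { s with reg := Function.update s.reg x (s.reg y * s.reg z) }
  | .load x y => { s with reg := Function.update s.reg x (s.mem (s.reg y)) }
  | .store x y => { s with mem := Function.update s.mem (s.reg x) (s.reg y) }
  | .emit o a b => { s with out := s.out ++ [⟨o, a.read s.reg, b.read s.reg⟩] }

/-- The bit cost of an instruction (the schoolbook cost for a multiplication). -/
def Instr.cost (s : State) : Instr → ℕ
  | .set _ c => 1 + c.size
  | .add _ y z => 1 + (s.reg y).size + (s.reg z).size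
  | .sub _ y z => 1 + (s.reg y).size + (s.reg z).size
  | .mul _ y z => (1 + (s.reg y).size) * (1 + (s.reg z).size)
  | .load _ y => 1 + (s.reg y).size + (s.mem (s.reg y)).size
  | .store x y => 1 + (s.reg x).size + (s.reg y).size
  | .emit _ a b => 1 + (a.read s.reg).bits + (b.read s.reg).bits

/-- Programs; the conditions compare the contents of two registers. -/
inductive Program where
  | skip
  | instr (i : Instr)
  | seq (P Q : Program)
  | ifLt (x y : ℕ) (P Q : Program)
  | whileLt (x y : ℕ) (P : Program)

/-- The bit cost of a comparison of two registers. -/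
def State.testCost (s : State) (x y : ℕ) : ℕ := 1 + (s.reg x).size + (s.reg y).size

/-- `Exec P s s' t`: the program `P`, started in the state `s`, halts in the state `s'`, with
total bit cost `t`. -/
inductive Exec : Program → State → State → ℕ → Prop where
  | skip (s : State) : Exec .skip s s 0
  | instr (i : Instr) (s : State) : Exec (.instr i) s (i.run s) (i.cost s)
  | seq {P Q : Program} {s s' s'' : State} {t t' : ℕ} (hP : Exec P s s' t)
      (hQ : Exec Q s' s'' t') : Exec (.seq P Q) s s'' (t + t')
  | ifTrue {x y : ℕ} {P Q : Program} {s s' : State} {t : ℕ} (h : s.reg x < s.reg y)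
      (hP : Exec P s s' t) : Exec (.ifLt x y P Q) s s' (s.testCost x y + t)
  | ifFalse {x y : ℕ} {P Q : Program} {s s' : State} {t : ℕ} (h : ¬ s.reg x < s.reg y)
      (hQ : Exec Q s s' t) : Exec (.ifLt x y P Q) s s' (s.testCost x y + t)
  | whileTrue {x y : ℕ} {P : Program} {s s' s'' : State} {t t' : ℕ} (h : s.reg x < s.reg y)
      (hP : Exec P s s' t) (hW : Exec (.whileLt x y P) s' s'' t') :
      Exec (.whileLt x y P) s s'' (s.testCost x y + t + t')
  | whileFalse {x y : ℕ} {P : Program} {s : State} (h : ¬ s.reg x < s.reg y) :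
      Exec (.whileLt x y P) s s (s.testCost x y)

/-- The initial state on the input `(k, λ, ν)`: register `0` holds `k`, the memory holds
`λ_1, …, λ_k, ν_1, …, ν_k, 0, 0, …`, and no gate has been issued. -/
def inputState {k : ℕ} (lam nu : Fin k → ℕ) : State where
  reg := fun x => if x = 0 then k else 0
  mem := fun a =>
    if h : a < k then lam ⟨a, h⟩
    else if h : a - k < k then nu ⟨a - k, h⟩
    else 0
  out := []

/-- The bit complexity of a run with machine cost `t` that issued the circuit `c`, when the
arithmetic is done on numbers of `w` bits: the cost of the run, and the schoolbook cost `w ^ 2`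
for each arithmetic operation. -/
def bitComplexity (t : ℕ) (c : Circuit) (w : ℕ) : ℕ := t + c.length * w ^ 2

end

end SkewSchur

/-! All vanishing statements follow from one criterion for minors of the Toeplitz matrix
`(h_{i-j}(x_1, …, x_m))`. If the rows do not dominate the columns entrywise, a zero block kills the
minor. If they do, evaluate at `x = (1, …, 1)`: column operations remove one variable and write the
minor as the sum, over all column sets interlacing the given one, of minors with one variable less.
With no variable left the matrix is the identity. The value is thus a count of interlacing patterns;
it is never negative, and it is positive as soon as there are at least as many variables as columns
(`onesMinor_nonneg_and_pos`, `hMinor_ne_zero_iff`). The criterion for `s_{λ/ν}`, and the fact that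
`s_{J ∪ {q}} = 0` forces `s_{J ∪ {p, r}} = 0`, become comparisons of sorted sets.

The circuits rest on the three-term relation of flag minors, `s_{Jq} s_{Jpr} = s_{Jp} s_{Jqr} +
s_{Jr} s_{Jpq}` for `p < q < r` (`rowMinor_exchange`). Solved for `s_{Jpr}` it contains no
subtraction. Suppose that the flag minors of all windows of consecutive rows are known, and a row
`q` is deleted. A window of the new row list that jumps over `q` is given by this relation, in which
every other minor is an old window or a shorter new one. Deleting all unwanted rows from the largest
to the smallest leads from the interval minors to the minor with any prescribed `k` rows. There are
at most `N` deletions with at most `k N` entries each, so this costs `O(N ^ 3)` operations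
(`deletion_wp`).

Deletion is used on two matrices. In `(h_{i-j}(x_1, …, x_j))` a flag minor with `p` rows is a Schur
polynomial in `x_1, …, x_p`; none vanishes, and the interval minors are the monomials `(x_1 ⋯ x_p) ^
a`, which are cheap. So each ordinary Schur polynomial costs `O(n ^ 3)`. The interval minors of
`H_ν` are zero or ordinary Schur polynomials; all `O(n ^ 2)` of them cost `O(n ^ 5)`. One last
deletion in `H_ν` then leaves the rows `λ_k + 1 < ⋯ < λ_1 + k`, whose minor is `s_{λ/ν}`.

Minors of `H_ν` may vanish, and a circuit cannot divide by zero, nor produce zero. The machine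
therefore marks a zero function by the number `0` and issues no gate for it. Every function that has
a gate is positive at `(1, …, 1)`, so denominators with a gate are nonzero
(`CircuitValues.isPositive`); when a denominator is marked as zero, the desired minor is zero as
well (`IsExchangeable`). All numbers handled are polynomial in `n`, so each of the `O(n ^ 5)`
machine steps costs `O(log ^ 2 n)`. -/

namespace SkewSchur

open MvPolynomial

/-! ### Complete homogeneous symmetric functions of an initial segment of a sequence -/

/-- The complete homogeneous symmetric function of degree `n` of `x 0, …, x (m - 1)`. -/
def complete {R : Type*} [CommRing R] (x : ℕ → R) : ℕ → ℕ → R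
  | _, 0 => 1
  | 0, _ + 1 => 0
  | m + 1, n + 1 => complete x m (n + 1) + x m * complete x (m + 1) n

/-- The extension of `complete` by zero to negative degrees. -/
def completeZ {R : Type*} [CommRing R] (x : ℕ → R) (m : ℕ) (z : ℤ) : R :=
  if 0 ≤ z then complete x m z.toNat else 0

section Complete

variable {R S : Type*} [CommRing R] [CommRing S]

theorem complete_zero_right (x : ℕ → R) (m : ℕ) : complete x m 0 = 1 := by
  cases m <;> simp [complete]

theorem completeZ_of_neg (x : ℕ → R) (m : ℕ) {z : ℤ} (hz : z < 0) : completeZ x m z = 0 := by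
  simp [completeZ, not_le.2 hz]

theorem completeZ_zero_right (x : ℕ → R) (m : ℕ) : completeZ x m 0 = 1 := by
  simp [completeZ, complete_zero_right]

theorem completeZ_zero_left (x : ℕ → R) (z : ℤ) : completeZ x 0 z = if z = 0 then 1 else 0 := by
  rcases lt_trichotomy z 0 with h | rfl | h
  · rw [completeZ_of_neg x 0 h, if_neg h.ne]
  · simp [completeZ_zero_right]
  · obtain ⟨n, rfl⟩ : ∃ n : ℕ, z = (n : ℤ) + 1 := ⟨(z - 1).toNat, by omega⟩
    rw [if_neg h.ne', completeZ, if_pos h.le, show ((n : ℤ) + 1).toNat = n + 1 by omega, complete]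

theorem completeZ_succ (x : ℕ → R) (m : ℕ) (z : ℤ) :
    completeZ x (m + 1) z = completeZ x m z + x m * completeZ x (m + 1) (z - 1) := by
  rcases lt_trichotomy z 0 with h | rfl | h
  · simp [completeZ_of_neg x _ h, completeZ_of_neg x _ (show z - 1 < 0 by omega)]
  · rw [completeZ_zero_right, completeZ_zero_right, completeZ_of_neg x _ (by omega)]
    ring
  · obtain ⟨n, rfl⟩ : ∃ n : ℕ, z = (n : ℤ) + 1 := ⟨(z - 1).toNat, by omega⟩
    rw [completeZ, completeZ, completeZ, if_pos h.le, if_pos h.le, if_pos (by omega),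
      show ((n : ℤ) + 1).toNat = n + 1 by omega, show ((n : ℤ) + 1 - 1).toNat = n by omega, complete]

theorem map_complete (f : R →+* S) (x : ℕ → R) (m n : ℕ) :
    f (complete x m n) = complete (fun i => f (x i)) m n := by
  induction m generalizing n with
  | zero => cases n <;> simp [complete]
  | succ m ihm =>
    induction n with
    | zero => simp [complete_zero_right]
    | succ n ihn => simp [complete, ihm, ihn]

theorem map_completeZ (f : R →+* S) (x : ℕ → R) (m : ℕ) (z : ℤ) :
    f (completeZ x m z) = completeZ (fun i => f (x i)) m z := by
  unfold completeZ
  split_ifs <;> simp [map_complete]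

end Complete

/-- A monomial of degree `n + 1` either avoids the extra variable or contains it, and then one copy
can be removed. This is the recursion that defines `complete`. -/
theorem aeval_hsymm_option {σ R : Type*} [Fintype σ] [DecidableEq σ] [CommRing R] [Algebra ℚ R]
    (y : Option σ → R) (n : ℕ) :
    aeval y (hsymm (Option σ) ℚ (n + 1)) =
      aeval (fun i => y (some i)) (hsymm σ ℚ (n + 1)) +
        y none * aeval y (hsymm (Option σ) ℚ n) := by
  have key : ∀ (τ : Type _) [Fintype τ] [DecidableEq τ] (w : τ → R) (m : ℕ),
      aeval w (hsymm τ ℚ m) = ∑ s : Sym τ m, (s.1.map w).prod := by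
    intro τ _ _ w m
    rw [hsymm, map_sum]
    refine Finset.sum_congr rfl fun s _ => ?_
    rw [map_multiset_prod, Multiset.map_map]
    simp
  rw [key, key, key, ← Equiv.sum_comp (symOptionSuccEquiv (α := σ) (n := n)).symm,
    Fintype.sum_sum_type, add_comm, Finset.mul_sum]
  congr 1
  · refine Finset.sum_congr rfl fun s _ => ?_
    change (Multiset.map y (Multiset.map _ s.1)).prod = _
    rw [Multiset.map_map]
    rfl
  · refine Finset.sum_congr rfl fun s _ => ?_
    change (Multiset.map y (none ::ₘ s.1)).prod = _
    simp

theorem aeval_hsymm_fin {R : Type*} [CommRing R] [Algebra ℚ R] (x : ℕ → R) (m n : ℕ) :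
    aeval (fun i : Fin m => x i) (hsymm (Fin m) ℚ n) = complete x m n := by
  induction m generalizing n with
  | zero =>
    cases n with
    | zero => simp [complete]
    | succ n =>
      have : IsEmpty (Sym (Fin 0) (n + 1)) := inferInstance
      simp [complete, hsymm]
  | succ m ihm =>
    have key : ∀ n, aeval (fun i : Fin (m + 1) => x i) (hsymm (Fin (m + 1)) ℚ n) =
        aeval (fun o : Option (Fin m) => o.elim (x m) (fun i => x i))
          (hsymm (Option (Fin m)) ℚ n) := by
      intro n
      rw [← rename_hsymm (Fin (m + 1)) ℚ n finSuccEquivLast, aeval_rename]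
      congr 2
      funext i
      refine Fin.lastCases ?_ (fun j => ?_) i <;> simp
    induction n with
    | zero => simp [complete_zero_right]
    | succ n ihn => rw [key, aeval_hsymm_option, ← key, ihn, complete]; simp [ihm]

/-- The variables `x_1, …, x_k`, as a sequence. -/
noncomputable def xvar (k : ℕ) (l : ℕ) : MvPolynomial (Fin k) ℚ :=
  -- The default value `1` makes every term of the sequence equal to `1` at `(1, …, 1)`, so
  -- evaluation needs no bound on the number of variables.
  if h : l < k then X ⟨l, h⟩ else 1

theorem hpoly_eq (k : ℕ) (z : ℤ) : hpoly k z = completeZ (xvar k) k z := by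
  unfold hpoly completeZ
  split_ifs with h
  · rw [← aeval_hsymm_fin]
    conv_lhs => rw [← MvPolynomial.aeval_X_left_apply (hsymm (Fin k) ℚ z.toNat)]
    congr 2
    funext i
    simp [xvar]
  · rfl

/-! ### Determinants -/

section Determinants

variable {R : Type*} [CommRing R]

/-- Adding multiples of the next column to each column does not change the determinant. -/
theorem det_eq_of_col_add_next {p : ℕ} {A B : Matrix (Fin p) (Fin p) R} (c : Fin p → R)
    (hlast : ∀ i (j : Fin p), (j : ℕ) + 1 = p → A i j = B i j)
    (hnext : ∀ i (j : Fin p) (h : (j : ℕ) + 1 < p), A i j = B i j + c j * A i ⟨j + 1, h⟩) :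
    A.det = B.det := by
  cases p with
  | zero => simp
  | succ p =>
    -- Reversing the order turns the next column into the preceding one, the form of the available
    -- determinant lemma.
    rw [← Matrix.det_submatrix_equiv_self Fin.revPerm A,
      ← Matrix.det_submatrix_equiv_self Fin.revPerm B]
    refine Matrix.det_eq_of_forall_col_eq_smul_add_pred (fun j => c j.succ.rev) ?_ ?_
    · intro i
      exact hlast _ _ (by simp)
    · intro i j
      have h : ((j.succ.rev : Fin (p + 1)) : ℕ) + 1 < p + 1 := by
        simp only [Fin.val_rev, Fin.val_succ]; omega
      have h2 : (⟨(j.succ.rev : Fin (p + 1)) + 1, h⟩ : Fin (p + 1)) = (Fin.castSucc j).rev := by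
        ext; simp only [Fin.val_rev, Fin.val_succ, Fin.val_castSucc]; omega
      have := hnext i.rev j.succ.rev h
      rw [h2] at this
      exact this

/-- A square matrix with a zero block that meets the diagonal has determinant zero. -/
theorem det_eq_zero_of_block {p : ℕ} (A : Matrix (Fin p) (Fin p) R) (q : Fin p)
    (h : ∀ r c, r ≤ q → q ≤ c → A r c = 0) : A.det = 0 := by
  rw [← Matrix.det_transpose, Matrix.det_apply]
  refine Finset.sum_eq_zero fun σ _ => ?_
  -- Otherwise `σ` would inject the `q + 1` indices up to `q` into the `q` indices below `q`.
  have : ∃ r, r ≤ q ∧ q ≤ σ r := by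
    by_contra! hc
    have hle := Finset.card_le_card_of_injOn (s := Finset.Iic q) (t := Finset.Iio q) σ
      (fun r hr => by simpa using hc r (by simpa using hr)) σ.injective.injOn
    simp at hle
  obtain ⟨r, hr, hc⟩ := this
  rw [Finset.prod_eq_zero (Finset.mem_univ r) (by exact h r (σ r) hr hc), smul_zero]

/-- The determinant is multilinear in the columns. -/
theorem det_sum_columns {p : ℕ} (s : Fin p → Finset ℕ) (f : Fin p → ℕ → R) :
    (Matrix.of fun r c => ∑ d ∈ s c, f r d).det =
      ∑ D ∈ Fintype.piFinset s, (Matrix.of fun r c => f r (D c)).det := by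
  have := MultilinearMap.map_sum_finset
    (Matrix.detRowAlternating (n := Fin p) (R := R)).toMultilinearMap
    (fun (_ : Fin p) (d : ℕ) (r : Fin p) => f r d) s
  rw [← Matrix.det_transpose]
  have e : (Matrix.of fun r c => ∑ d ∈ s c, f r d).transpose =
      fun c => ∑ d ∈ s c, (fun r : Fin p => f r d) := by
    ext c r; simp [Finset.sum_apply]
  rw [e]
  refine Eq.trans this (Finset.sum_congr rfl fun D _ => ?_)
  rw [← Matrix.det_transpose]
  rfl

/-- When the last variable is `1`, the recursion says that consecutive values in `m + 1` variables
differ by a value in `m` variables; the sum telescopes. -/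
theorem completeZ_sub_telescope (x : ℕ → R) (hx : ∀ l, x l = 1) (m : ℕ) (i a b : ℕ) (hab : a ≤ b) :
    completeZ x (m + 1) ((i : ℤ) - a) =
      (∑ d ∈ Finset.Ico a b, completeZ x m ((i : ℤ) - d)) + completeZ x (m + 1) ((i : ℤ) - b) := by
  induction b, hab using Nat.le_induction with
  | base => simp
  | succ b hb ih =>
    rw [ih, Finset.sum_Ico_succ_top hb, completeZ_succ x m ((i : ℤ) - b), hx, one_mul,
      show (i : ℤ) - ((b + 1 : ℕ) : ℤ) = (i : ℤ) - b - 1 by push_cast; ring]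
    ring

end Determinants

/-! ### Positivity of the Toeplitz minors -/

/-- The minor of the Toeplitz matrix `(h_{i - j})` at `x = (1, …, 1)` with the rows `I` and the
columns `C`. -/
def onesMinor (m : ℕ) {p : ℕ} (I C : Fin p → ℕ) : ℚ :=
  (Matrix.of fun r c => completeZ (fun _ => (1 : ℚ)) m ((I r : ℤ) - (C c : ℤ))).det

/-- Without variables the Toeplitz matrix is the identity. If `I ≠ C`, some row of `I` is not in `C`
and is a zero row: an increasing map of `Fin p` into itself is the identity, so `I ⊆ C` would give
`I = C`. -/
theorem onesMinor_zero {p : ℕ} {I C : Fin p → ℕ} (hI : StrictMono I) (hC : StrictMono C) :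
    onesMinor 0 I C = if I = C then 1 else 0 := by
  unfold onesMinor
  split_ifs with h
  · subst h
    convert Matrix.det_one (n := Fin p) (R := ℚ)
    ext r c
    rw [Matrix.of_apply, completeZ_zero_left, Matrix.one_apply]
    have : ((I r : ℤ) - I c = 0) ↔ r = c := by
      rw [sub_eq_zero, Nat.cast_inj, hI.injective.eq_iff]
    simp [this]
  · have : ∃ r, ∀ c, I r ≠ C c := by
      by_contra! hc
      apply h
      choose g hg using hc
      have hgm : StrictMono g := fun a b hab => by
        rw [← hC.lt_iff_lt, ← hg, ← hg]; exact hI hab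
      have : g = id := by
        have hs := Finite.injective_iff_surjective.1 hgm.injective
        have := Subsingleton.elim (hgm.orderIsoOfSurjective g hs) (OrderIso.refl _)
        exact congrArg (fun e : Fin p ≃o Fin p => (e : Fin p → Fin p)) this
      funext r
      rw [hg r, this, id]
    obtain ⟨r, hr⟩ := this
    refine Matrix.det_eq_zero_of_row_eq_zero r fun c => ?_
    rw [Matrix.of_apply, completeZ_zero_left, if_neg]
    rw [sub_eq_zero, Nat.cast_inj]
    exact hr c

/-- Branching: one variable less, over the column sets that interlace `C`. -/
theorem onesMinor_succ (m : ℕ) {p : ℕ} (I C : Fin p → ℕ) (hC : StrictMono C) (b : ℕ)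
    (hIb : ∀ r, I r < b) (hCb : ∀ r, C r ≤ b) :
    onesMinor (m + 1) I C =
      ∑ D ∈ Fintype.piFinset fun c : Fin p =>
        Finset.Ico (C c) (if h : (c : ℕ) + 1 < p then C ⟨c + 1, h⟩ else b), onesMinor m I D := by
  unfold onesMinor
  rw [← det_sum_columns _ (fun r d => completeZ (fun _ => (1 : ℚ)) m ((I r : ℤ) - (d : ℤ)))]
  -- From each column the next one is subtracted. The last column has none; there `b`, beyond all
  -- rows, acts as a further column that is zero.
  refine det_eq_of_col_add_next (fun _ => 1) ?_ ?_
  · intro i j hj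
    rw [Matrix.of_apply, Matrix.of_apply, dif_neg (by omega),
      completeZ_sub_telescope _ (fun _ => rfl) m (I i) (C j) b (hCb j),
      completeZ_of_neg _ (m + 1) (by have := hIb i; omega), add_zero]
  · intro i j hj
    rw [Matrix.of_apply, Matrix.of_apply, Matrix.of_apply, dif_pos hj, one_mul,
      completeZ_sub_telescope _ (fun _ => rfl) m (I i) (C j) _
        (hC (Fin.lt_def.2 (Nat.lt_succ_self (j : ℕ))) : C j < C ⟨j + 1, hj⟩).le]

/-- For positivity one needs an interlacing pattern that reaches `I` in `m` steps. Each step can fix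
one more entry, starting from the largest, so the entries from position `m` on must already agree.
-/
theorem onesMinor_nonneg_and_pos (m : ℕ) {p : ℕ} (I C : Fin p → ℕ) (hI : StrictMono I)
    (hC : StrictMono C) :
    0 ≤ onesMinor m I C ∧
      ((∀ r, C r ≤ I r) → (∀ r : Fin p, m ≤ (r : ℕ) → C r = I r) → 0 < onesMinor m I C) := by
  induction m generalizing C with
  | zero =>
    rw [onesMinor_zero hI hC]
    refine ⟨by split_ifs <;> norm_num, fun _ h => ?_⟩
    rw [if_pos (funext fun r => (h r (Nat.zero_le _)).symm)]
    exact one_pos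
  | succ m ih =>
    set b := (∑ r, I r) + (∑ r, C r) + 1 with hb
    have hIb : ∀ r, I r < b := fun r => by
      have := Finset.single_le_sum (f := I) (fun _ _ => Nat.zero_le _) (Finset.mem_univ r)
      omega
    have hCb : ∀ r, C r ≤ b := fun r => by
      have := Finset.single_le_sum (f := C) (fun _ _ => Nat.zero_le _) (Finset.mem_univ r)
      omega
    rw [onesMinor_succ m I C hC b hIb hCb]
    have hmono : ∀ D ∈ Fintype.piFinset fun c : Fin p =>
        Finset.Ico (C c) (if h : (c : ℕ) + 1 < p then C ⟨c + 1, h⟩ else b), StrictMono D := by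
      intro D hD
      simp only [Fintype.mem_piFinset, Finset.mem_Ico] at hD
      intro r s hrs
      have h1 := (hD r).2
      have hr : (r : ℕ) + 1 < p := lt_of_le_of_lt (Fin.lt_def.1 hrs) s.2
      rw [dif_pos hr] at h1
      exact h1.trans_le ((hC.monotone (Fin.le_def.2 (Nat.succ_le_of_lt (Fin.lt_def.1 hrs)))).trans (hD s).1)
    refine ⟨Finset.sum_nonneg fun D hD => (ih D (hmono D hD)).1, fun hle heq => ?_⟩
    -- The largest column set that interlaces `C` and stays below `I`. Where the next entry of `C`
    -- has reached `I`, this entry reaches it now.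
    let D₀ : Fin p → ℕ := fun c =>
      if h : (c : ℕ) + 1 < p then min (I c) (C ⟨c + 1, h⟩ - 1) else I c
    have hmem : D₀ ∈ Fintype.piFinset fun c : Fin p =>
        Finset.Ico (C c) (if h : (c : ℕ) + 1 < p then C ⟨c + 1, h⟩ else b) := by
      simp only [Fintype.mem_piFinset, Finset.mem_Ico]
      intro c
      simp only [D₀]
      split_ifs with h
      · have h1 : C c < C ⟨c + 1, h⟩ := hC (Fin.lt_def.2 (Nat.lt_succ_self (c : ℕ)))
        have h2 := hle c
        omega
      · exact ⟨hle c, hIb c⟩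
    refine Finset.sum_pos' (fun D hD => (ih D (hmono D hD)).1) ⟨D₀, hmem, ?_⟩
    refine (ih D₀ (hmono D₀ hmem)).2 (fun c => ?_) (fun c hc => ?_)
    · simp only [D₀]
      split_ifs with h
      · exact min_le_left _ _
      · exact le_rfl
    · simp only [D₀]
      split_ifs with h
      · rw [heq ⟨c + 1, h⟩ (by simpa using hc)]
        have : I c < I ⟨c + 1, h⟩ := hI (Fin.lt_def.2 (Nat.lt_succ_self (c : ℕ)))
        omega
      · rfl

/-- A minor of `(h_{i - j}(x_1, …, x_m))`. -/
noncomputable def hMinor (k m : ℕ) {p : ℕ} (I C : Fin p → ℕ) : MvPolynomial (Fin k) ℚ :=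
  (Matrix.of fun r c => completeZ (xvar k) m ((I r : ℤ) - (C c : ℤ))).det

theorem eval_hMinor (k m : ℕ) {p : ℕ} (I C : Fin p → ℕ) :
    eval (fun _ => (1 : ℚ)) (hMinor k m I C) = onesMinor m I C := by
  unfold hMinor onesMinor
  rw [RingHom.map_det]
  congr 1
  ext r c
  simp only [RingHom.mapMatrix_apply, Matrix.map_apply, Matrix.of_apply, map_completeZ]
  congr 1
  funext l
  unfold xvar
  split_ifs <;> simp

/-- If `I q < C q`, all entries in rows up to `q` and columns from `q` on have negative degree. -/
theorem hMinor_eq_zero {k m p : ℕ} {I C : Fin p → ℕ} (hI : Monotone I) (hC : Monotone C)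
    (q : Fin p) (h : I q < C q) : hMinor k m I C = 0 := by
  refine det_eq_zero_of_block _ q fun r c hr hc => ?_
  rw [Matrix.of_apply, completeZ_of_neg]
  have h1 := hI hr
  have h2 := hC hc
  omega

/-- With `p ≤ m` the agreement condition in `onesMinor_nonneg_and_pos` is void, so the value at `(1,
…, 1)` is positive. -/
theorem hMinor_ne_zero {k m p : ℕ} (hp : p ≤ m) {I C : Fin p → ℕ} (hI : StrictMono I)
    (hC : StrictMono C) (h : ∀ r, C r ≤ I r) : hMinor k m I C ≠ 0 := by
  intro h0
  have := (onesMinor_nonneg_and_pos m I C hI hC).2 h fun r hr => absurd r.2 (by omega)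
  rw [← eval_hMinor k, h0, map_zero] at this
  exact lt_irrefl _ this

theorem hMinor_ne_zero_iff {k m p : ℕ} (hp : p ≤ m) {I C : Fin p → ℕ} (hI : StrictMono I)
    (hC : StrictMono C) : hMinor k m I C ≠ 0 ↔ ∀ r, C r ≤ I r := by
  refine ⟨fun h r => ?_, hMinor_ne_zero hp hI hC⟩
  by_contra hr
  exact h (hMinor_eq_zero hI.monotone hC.monotone r (not_le.1 hr))

/-! ### The exchange relation of flag minors -/

/-- The leading `n × n` minor of an infinite matrix. -/
def leadingMinor {R : Type*} [CommRing R] (n : ℕ) (Z : ℕ → ℕ → R) : R :=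
  (Matrix.of fun r c : Fin n => Z r c).det

/-- The increasing enumeration of the natural numbers other than `e`. -/
def skip (e j : ℕ) : ℕ := if j < e then j else j + 1

section Exchange

theorem leadingMinor_congr {R : Type*} [CommRing R] {n : ℕ} {Z Y : ℕ → ℕ → R}
    (h : ∀ r c, r < n → c < n → Z r c = Y r c) : leadingMinor n Z = leadingMinor n Y := by
  unfold leadingMinor
  congr 1
  ext r c
  exact h r c r.2 c.2

theorem leadingMinor_rotate {R : Type*} [CommRing R] (n : ℕ) (Z : ℕ → ℕ → R) :
    leadingMinor (n + 1) Z =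
      (-1) ^ n * leadingMinor (n + 1) (fun r c => Z (if r < n then r + 1 else 0) c) := by
  have h := Matrix.det_permute (finRotate (n + 1)) (Matrix.of fun r c : Fin (n + 1) => Z r c)
  have e : (Matrix.of fun r c : Fin (n + 1) => Z r c).submatrix (finRotate (n + 1)) id =
      Matrix.of fun r c : Fin (n + 1) => Z (if (r : ℕ) < n then r + 1 else 0) c := by
    ext r c
    simp only [Matrix.submatrix_apply, Matrix.of_apply, id]
    congr 1
    split_ifs with hr
    · rw [coe_finRotate_of_ne_last (fun h => by simp [h] at hr)]
    · have : r = Fin.last n := Fin.ext (by have := r.2; simp; omega)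
      rw [this, finRotate_last]; rfl
  rw [e, sign_finRotate] at h
  unfold leadingMinor
  rw [h]
  push_cast
  rw [← mul_assoc, ← mul_pow]
  simp

theorem leadingMinor_unit_column {R : Type*} [CommRing R] (n e : ℕ) (he : e ≤ n)
    (Y : ℕ → ℕ → R) :
    leadingMinor (n + 1) (fun r c => if c = n then (if r = e then 1 else 0) else Y r c) =
      (-1) ^ (e + n) * leadingMinor n (fun r c => Y (skip e r) c) := by
  unfold leadingMinor
  rw [Matrix.det_succ_column _ (Fin.last n),
    Finset.sum_eq_single (⟨e, Nat.lt_succ_of_le he⟩ : Fin (n + 1))]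
  · simp only [Matrix.of_apply, Fin.val_last, if_true, mul_one]
    congr 2
    ext r c
    simp only [Matrix.submatrix_apply, Matrix.of_apply, Fin.succAbove_last, Fin.val_castSucc,
      if_neg c.2.ne]
    congr 1
    unfold skip Fin.succAbove
    simp only [Fin.lt_def, Fin.val_castSucc]
    split_ifs <;> simp
  · intro b _ hb
    have : (b : ℕ) ≠ e := fun h => hb (Fin.ext h)
    simp [this]
  · simp

variable {K : Type*} [Field K]

/-- The Schur complement of the leading `q × q` block. It reduces identities between minors that
share this block to identities of very small determinants. -/
theorem leadingMinor_add {q m : ℕ} (Z : ℕ → ℕ → K) (h : leadingMinor q Z ≠ 0) :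
    leadingMinor (q + m) Z = leadingMinor q Z *
      (Matrix.of fun i j : Fin m => Z (q + i) (q + j) -
        ∑ c : Fin q, (∑ r : Fin q, Z (q + i) r *
          (Matrix.of fun r c : Fin q => Z r c)⁻¹ r c) * Z c (q + j)).det := by
  unfold leadingMinor at *
  set A := (Matrix.of fun r c : Fin q => Z r c) with hA
  have : Invertible A := Matrix.invertibleOfIsUnitDet _ (isUnit_iff_ne_zero.2 h)
  have := Matrix.det_fromBlocks₁₁ A (Matrix.of fun (r : Fin q) (j : Fin m) => Z r (q + j))
    (Matrix.of fun (i : Fin m) (c : Fin q) => Z (q + i) c)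
    (Matrix.of fun (i j : Fin m) => Z (q + i) (q + j))
  rw [← Matrix.det_submatrix_equiv_self finSumFinEquiv]
  convert this using 2
  · ext (r | r) (c | c) <;> simp [hA]
  · congr 1
    ext i j
    simp [Matrix.mul_apply, Matrix.sub_apply]

/-- The Desnanot-Jacobi identity, for the first and the last row and the last two columns. -/
theorem leadingMinor_condensation (q : ℕ) (Z : ℕ → ℕ → K)
    (h : leadingMinor q (fun r c => Z (r + 1) c) ≠ 0) :
    leadingMinor (q + 2) Z * leadingMinor q (fun r c => Z (r + 1) c) =
      leadingMinor (q + 1) (fun r c => Z (r + 1) (if c < q then c else q + 1)) *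
          leadingMinor (q + 1) Z -
        leadingMinor (q + 1) (fun r c => Z (r + 1) c) *
          leadingMinor (q + 1) (fun r c => Z r (if c < q then c else q + 1)) := by
  have key : ∀ (m : ℕ) (Y : ℕ → ℕ → K), (∀ r c, r < q → c < q → Y r c = Z (r + 1) c) →
      leadingMinor (q + m) Y = leadingMinor q (fun r c => Z (r + 1) c) *
      (Matrix.of fun i j : Fin m => Y (q + i) (q + j) -
        ∑ c : Fin q, (∑ r : Fin q, Y (q + i) r *
          (Matrix.of fun r c : Fin q => Z (r + 1) c)⁻¹ r c) * Y c (q + j)).det := by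
    intro m Y hY
    have e : leadingMinor q Y = leadingMinor q (fun r c => Z (r + 1) c) := leadingMinor_congr hY
    have eA : (Matrix.of fun r c : Fin q => Y r c) = Matrix.of fun r c : Fin q => Z (r + 1) c := by
      ext r c
      exact hY r c r.2 c.2
    rw [leadingMinor_add Y (e ▸ h), e, eA]
  -- Moving the first row to the end makes the middle block the common pivot of all minors. What
  -- remains is the formula for a `2 × 2` determinant, up to signs.
  rw [leadingMinor_rotate (q + 1) Z, leadingMinor_rotate q Z,
    leadingMinor_rotate q (fun r c => Z r (if c < q then c else q + 1)),
    key 2, key 1, key 1, key 1, key 1]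
  · have hc : ∀ c : Fin q, (c : ℕ) < q := fun c => c.2
    have hc' : ∀ c : Fin q, (c : ℕ) < q + 1 := fun c => c.2.trans (Nat.lt_succ_self q)
    simp only [Matrix.det_fin_two, Matrix.det_unique, Matrix.of_apply, Fin.default_eq_zero,
      Fin.val_zero, Fin.val_one, add_zero, lt_irrefl, if_false, if_true, hc, hc',
      Nat.lt_succ_self]
    ring
  all_goals
    intro r c hr hc
    simp [hr, hc, hr.trans (Nat.lt_succ_self q)]

/-! ### Windows of a row sequence and the three-term relation -/

/-- The flag minor of `M` with the rows `ρ a, …, ρ (a + p - 1)` and the first `p` columns. -/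
def rowMinor {R : Type*} [CommRing R] (M : ℕ → ℕ → R) (ρ : ℕ → ℕ) (a p : ℕ) : R :=
  leadingMinor p (fun r c => M (ρ (a + r)) c)

theorem rowMinor_congr {R : Type*} [CommRing R] {M : ℕ → ℕ → R} {ρ ρ' : ℕ → ℕ} {a a' p : ℕ}
    (h : ∀ r < p, ρ (a + r) = ρ' (a' + r)) : rowMinor M ρ a p = rowMinor M ρ' a' p :=
  leadingMinor_congr fun r c hr _ => by rw [h r hr]

/-- The window of `ρ` from `a` to `a + p` contains the row `e` in its interior. Deleting `e` gives
`J ∪ {p, r}`, and the denominator is `J ∪ {q}` with `q` at position `e`. Both products on the right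
have sign `+`, so the formula is subtraction-free. -/
theorem rowMinor_exchange (M : ℕ → ℕ → K) (ρ : ℕ → ℕ) {a p e : ℕ} (hae : a < e)
    (hep : e < a + p) (hw : rowMinor M ρ (a + 1) (p - 1) ≠ 0) :
    rowMinor M (fun j => ρ (skip e j)) a p =
      (rowMinor M (fun j => ρ (skip e j)) a (p - 1) * rowMinor M ρ (a + 1) p +
        rowMinor M (fun j => ρ (skip e j)) (a + 1) (p - 1) * rowMinor M ρ a p) /
      rowMinor M ρ (a + 1) (p - 1) := by
  obtain ⟨q, rfl⟩ : ∃ q, p = q + 1 := ⟨p - 1, by omega⟩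
  obtain ⟨d, rfl⟩ : ∃ d, e = a + 1 + d := ⟨e - (a + 1), by omega⟩
  have hd : d < q := by omega
  rw [Nat.add_sub_cancel] at hw ⊢
  rw [eq_div_iff hw]
  -- The window is bordered by a unit column at the row `e`. Expansion along it deletes that row, so
  -- the condensation identity for `Z` becomes the exchange relation, up to signs that agree in all
  -- terms.
  set Z : ℕ → ℕ → K := fun r c =>
    if c = q + 1 then (if r = d + 1 then 1 else 0) else M (ρ (a + r)) c with hZ
  have hs : ∀ b r, skip (b + d) (b + r) = b + skip d r := by
    intro b r; unfold skip; split_ifs <;> omega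
  have e0 : leadingMinor q (fun r c => Z (r + 1) c) = rowMinor M ρ (a + 1) q := by
    refine leadingMinor_congr fun r c _ hc => ?_
    simp only [hZ, if_neg (show c ≠ q + 1 by omega), add_assoc, add_comm 1]
  have e1 : leadingMinor (q + 2) Z =
      (-1) ^ (d + 1 + (q + 1)) * rowMinor M (fun j => ρ (skip (a + 1 + d) j)) a (q + 1) := by
    rw [hZ, leadingMinor_unit_column (q + 1) (d + 1) (by omega) (fun r c => M (ρ (a + r)) c)]
    congr 1
    refine leadingMinor_congr fun r c _ _ => ?_
    rw [← show skip (a + 1 + d) (a + r) = a + skip (d + 1) r by unfold skip; split_ifs <;> omega]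
  have e2 : leadingMinor (q + 1) (fun r c => Z (r + 1) (if c < q then c else q + 1)) =
      (-1) ^ (d + q) * rowMinor M (fun j => ρ (skip (a + 1 + d) j)) (a + 1) q := by
    have := leadingMinor_unit_column q d hd.le (fun r c => M (ρ (a + 1 + r)) c)
    rw [rowMinor]
    simp only [hs]
    rw [← this]
    refine leadingMinor_congr fun r c _ hc => ?_
    rcases Nat.lt_succ_iff_lt_or_eq.1 hc with hc | rfl
    · simp only [hZ, if_pos hc, if_neg (show c ≠ q + 1 by omega), if_neg hc.ne, add_assoc,
        add_comm 1]
    · simp [hZ]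
  have e3 : leadingMinor (q + 1) Z = rowMinor M ρ a (q + 1) := by
    refine leadingMinor_congr fun r c _ hc => ?_
    simp only [hZ, if_neg (show c ≠ q + 1 by omega)]
  have e4 : leadingMinor (q + 1) (fun r c => Z (r + 1) c) = rowMinor M ρ (a + 1) (q + 1) := by
    refine leadingMinor_congr fun r c _ hc => ?_
    simp only [hZ, if_neg (show c ≠ q + 1 by omega), add_assoc, add_comm 1]
  have e5 : leadingMinor (q + 1) (fun r c => Z r (if c < q then c else q + 1)) =
      (-1) ^ (d + 1 + q) * rowMinor M (fun j => ρ (skip (a + 1 + d) j)) a q := by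
    have := leadingMinor_unit_column q (d + 1) (by omega) (fun r c => M (ρ (a + r)) c)
    have e : rowMinor M (fun j => ρ (skip (a + 1 + d) j)) a q =
        leadingMinor q (fun r c => M (ρ (a + skip (d + 1) r)) c) := by
      refine leadingMinor_congr fun r c _ _ => ?_
      rw [← show skip (a + 1 + d) (a + r) = a + skip (d + 1) r by unfold skip; split_ifs <;> omega]
    rw [e, ← this]
    refine leadingMinor_congr fun r c _ hc => ?_
    rcases Nat.lt_succ_iff_lt_or_eq.1 hc with hc | rfl
    · simp only [hZ, if_pos hc, if_neg (show c ≠ q + 1 by omega), if_neg hc.ne]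
    · simp [hZ]
  have h := leadingMinor_condensation q Z (e0 ▸ hw)
  rw [e0, e1, e2, e3, e4, e5] at h
  have hu : ((-1 : K) ^ (d + q)) * (-1) ^ (d + q) = 1 := by rw [← mul_pow]; simp
  simp only [pow_add, pow_one] at h hu
  linear_combination ((-1 : K) ^ d * (-1) ^ q) * h +
    (rowMinor M (fun j => ρ (skip (a + 1 + d) j)) a q * rowMinor M ρ (a + 1) (q + 1) +
      rowMinor M (fun j => ρ (skip (a + 1 + d) j)) (a + 1) q * rowMinor M ρ a (q + 1) -
      rowMinor M (fun j => ρ (skip (a + 1 + d) j)) a (q + 1) * rowMinor M ρ (a + 1) q) * hu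

end Exchange

/-! ### The flag matrix of the ordinary Schur polynomials -/

/-- The matrix `(h_{i - j}(x_1, …, x_j))`; the column `c` counts from `0`. -/
noncomputable def schurMatrix (k : ℕ) (i c : ℕ) : MvPolynomial (Fin k) ℚ :=
  completeZ (xvar k) (c + 1) ((i : ℤ) - (c + 1 : ℕ))

/-- By the recursion for complete functions, passing to the next row multiplies by a fixed
bidiagonal matrix. Row `0` is excluded because `h_0` of no variables is `1`. -/
theorem schurMatrix_succ (k i c : ℕ) (hi : 0 < i) :
    schurMatrix k (i + 1) c =
      schurMatrix k i c * xvar k c + if c = 0 then 0 else schurMatrix k i (c - 1) := by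
  unfold schurMatrix
  rw [completeZ_succ, show ((i + 1 : ℕ) : ℤ) - (c + 1 : ℕ) - 1 = (i : ℤ) - (c + 1 : ℕ) by
    push_cast; ring, mul_comm, add_comm]
  congr 1
  split_ifs with hc
  · subst hc
    rw [completeZ_zero_left, if_neg (by push_cast; omega)]
  · obtain ⟨b, rfl⟩ : ∃ b, c = b + 1 := ⟨c - 1, by omega⟩
    rw [Nat.add_sub_cancel]
    congr 1
    push_cast; ring

/-- The first `p` rows form a unitriangular matrix. Each shift of the window by one multiplies by
the bidiagonal matrix `B`, with diagonal `x_1, …, x_p`. -/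
theorem rowMinor_schurMatrix_interval (k a p : ℕ) :
    rowMinor (schurMatrix k) Nat.succ a p = (∏ l ∈ Finset.range p, xvar k l) ^ a := by
  induction a with
  | zero =>
    unfold rowMinor leadingMinor
    rw [Matrix.det_of_isLowerTriangular, pow_zero]
    · refine Finset.prod_eq_one fun r _ => ?_
      beta_reduce
      rw [Matrix.of_apply]
      rw [schurMatrix, show ((Nat.succ (0 + r) : ℕ) : ℤ) - ((r : ℕ) + 1 : ℕ) = 0 by
        push_cast; ring, completeZ_zero_right]
    · intro r c hrc
      rw [OrderDual.toDual_lt_toDual, Fin.lt_def] at hrc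
      rw [Matrix.of_apply]
      beta_reduce
      rw [schurMatrix, completeZ_of_neg]
      push_cast; omega
  | succ a ih =>
    let B : Matrix (Fin p) (Fin p) (MvPolynomial (Fin k) ℚ) := Matrix.of fun r c =>
      if r = c then xvar k c else if (r : ℕ) + 1 = c then 1 else 0
    have hB : B.det = ∏ l ∈ Finset.range p, xvar k l := by
      rw [Matrix.det_of_isUpperTriangular, Finset.prod_range]
      · exact Finset.prod_congr rfl fun r _ => by simp [B]
      · intro r c hrc
        have hrc : c < r := hrc
        rw [Fin.lt_def] at hrc
        simp only [B, Matrix.of_apply]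
        rw [if_neg (fun h => by rw [h] at hrc; omega), if_neg (by omega)]
    rw [pow_succ, ← ih, ← hB]
    unfold rowMinor leadingMinor
    rw [← Matrix.det_mul]
    congr 1
    ext1 r c
    rw [Matrix.mul_apply, Matrix.of_apply]
    beta_reduce
    rw [show Nat.succ (a + 1 + (r : ℕ)) = Nat.succ (a + r) + 1 by omega,
      schurMatrix_succ _ _ _ (Nat.succ_pos _)]
    simp only [Matrix.of_apply, B]
    rw [← Finset.add_sum_erase _ _ (Finset.mem_univ c), if_pos rfl]
    congr 1
    split_ifs with hc
    · symm
      refine Finset.sum_eq_zero fun d hd => ?_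
      rw [if_neg (Finset.ne_of_mem_erase hd), if_neg (by omega), mul_zero]
    · have hlt : (c : ℕ) - 1 < p := by omega
      rw [Finset.sum_eq_single (⟨c - 1, hlt⟩ : Fin p)]
      · rw [if_neg (fun h => by have := congrArg Fin.val h; simp at this; omega),
          if_pos (by simp; omega), mul_one]
      · intro d hd hne
        rw [if_neg (Finset.ne_of_mem_erase hd), if_neg, mul_zero]
        intro h
        exact hne (Fin.ext (by simp; omega))
      · intro h
        exact absurd (Finset.mem_erase.2 ⟨fun h => by
          have := congrArg Fin.val h; simp at this; omega, Finset.mem_univ _⟩) h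

/-- Adding multiples of the next column raises the number of variables in a column by one, so all
columns can be brought to `p` variables. After round `m` the column `c` has `max (c + 1) m`
variables. -/
theorem leadingMinor_schurMatrix (k p : ℕ) (I : ℕ → ℕ) :
    leadingMinor p (fun r c => schurMatrix k (I r) c) =
      hMinor k p (fun r : Fin p => I r) (fun c => c + 1) := by
  have key : ∀ m ≤ p, leadingMinor p (fun r c => schurMatrix k (I r) c) =
      leadingMinor p (fun r c => completeZ (xvar k) (max (c + 1) m) ((I r : ℤ) - (c + 1 : ℕ))) := by
    intro m hm
    induction m with
    | zero => rfl
    | succ m ih =>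
      rw [ih (by omega)]
      symm
      refine det_eq_of_col_add_next (fun c => if (c : ℕ) < m then xvar k m else 0) ?_ ?_
      · intro r c hc
        simp only [Matrix.of_apply]
        rw [max_eq_left (by omega), max_eq_left (by omega)]
      · intro r c hc
        simp only [Matrix.of_apply]
        split_ifs with h
        · rw [max_eq_right (by omega), max_eq_right (by omega), max_eq_right (by omega),
            completeZ_succ]
          congr 3
          push_cast; ring
        · rw [max_eq_left (by omega), max_eq_left (by omega), zero_mul, add_zero]
  rw [key p le_rfl]
  unfold hMinor leadingMinor
  congr 1
  ext1 r c
  rw [Matrix.of_apply, Matrix.of_apply]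
  beta_reduce
  rw [max_eq_right (by omega)]

theorem strictMono_comp_val {p : ℕ} {f : ℕ → ℕ} (hf : StrictMono f) (a : ℕ) :
    StrictMono fun r : Fin p => f (a + r) := fun _ _ h => hf (Nat.add_lt_add_left h a)

theorem strictMono_val_succ (p : ℕ) : StrictMono fun c : Fin p => (c : ℕ) + 1 :=
  fun _ _ h => Nat.succ_lt_succ h

/-- The columns are `1, …, p`, and increasing positive rows always dominate them. So no denominator
vanishes for this matrix. -/
theorem rowMinor_schurMatrix_ne_zero (k : ℕ) {ρ : ℕ → ℕ} (hρ : StrictMono ρ) (h0 : 0 < ρ 0)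
    (a p : ℕ) : rowMinor (schurMatrix k) ρ a p ≠ 0 := by
  unfold rowMinor
  rw [leadingMinor_schurMatrix k p (fun r => ρ (a + r))]
  refine hMinor_ne_zero le_rfl (strictMono_comp_val hρ a) (strictMono_val_succ p) fun r => ?_
  have : ∀ j, j + 1 ≤ ρ j := fun j => by
    induction j with
    | zero => exact h0
    | succ j ih => exact ih.trans_lt (hρ (Nat.lt_succ_self j))
  have := this (a + r)
  show (r : ℕ) + 1 ≤ _
  omega

/-! ### Schur polynomials as minors -/

theorem skewSchur_eq_hMinor (k : ℕ) {p : ℕ} (lam nu : Fin p → ℕ) :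
    skewSchur k lam nu =
      hMinor k k (fun r => lam r.rev + r + 1) (fun c => nu c.rev + c + 1) := by
  unfold skewSchur hMinor
  rw [← Matrix.det_submatrix_equiv_self Fin.revPerm]
  congr 1
  ext1 r c
  simp only [Matrix.submatrix_apply, Matrix.of_apply, hpoly_eq, Fin.revPerm_apply, Fin.val_rev]
  congr 1
  have := r.2
  have := c.2
  omega

/-- A part `0` at the end makes the last row `(0, …, 0, 1)`. Padding allows `k` rows for every Schur
polynomial, also if it has fewer parts. -/
theorem schur_pad (k p q : ℕ) (hpq : p ≤ q) (θ : ℕ → ℕ) (hθ : ∀ j, p ≤ j → θ j = 0) :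
    schur k (fun j : Fin q => θ j) = schur k (fun j : Fin p => θ j) := by
  induction q, hpq using Nat.le_induction with
  | base => rfl
  | succ q hq ih =>
    rw [← ih]
    unfold schur skewSchur
    rw [Matrix.det_succ_row _ (Fin.last q), Finset.sum_eq_single (Fin.last q)]
    · simp only [Matrix.of_apply, Fin.val_last, hθ q hq]
      rw [show ((0 : ℕ) : ℤ) - ((0 : ℕ) : ℤ) - q + q = 0 by simp, hpoly_eq, completeZ_zero_right,
        ← two_mul, pow_mul]
      simp only [Fin.succAbove_last, neg_one_sq, one_pow, one_mul]
      rfl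
    · intro c _ hc
      have : (c : ℕ) < q := lt_of_le_of_ne (Nat.lt_succ_iff.1 c.2) fun h => hc (Fin.ext h)
      simp only [Matrix.of_apply, Fin.val_last, hθ q hq]
      rw [hpoly_eq, completeZ_of_neg]
      · simp
      · push_cast; omega
    · simp

theorem rowMinor_schurMatrix_eq_schur (k p : ℕ) (hp : p ≤ k) (θ : ℕ → ℕ)
    (hθ : ∀ j, p ≤ j → θ j = 0) (W : ℕ → ℕ) (hW : ∀ r < k, W r = θ (k - 1 - r) + r + 1) :
    rowMinor (schurMatrix k) W 0 k = schur k (fun j : Fin p => θ j) := by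
  rw [← schur_pad k p k hp θ hθ, schur, skewSchur_eq_hMinor, rowMinor,
    leadingMinor_schurMatrix k k (fun r => W (0 + r))]
  congr 1
  · funext r
    rw [zero_add, hW r r.2, Fin.val_rev, show k - 1 - (r : ℕ) = k - (r + 1) by omega]
  · funext c
    simp

theorem column_strictMono {k : ℕ} {nu : Fin k → ℕ} (hnu : Antitone nu) :
    StrictMono (column nu) := by
  intro c d h
  unfold column
  have := hnu (Fin.rev_le_rev.2 h.le)
  have := Fin.lt_def.1 h
  omega

theorem flagMinor_eq {k : ℕ} (nu : Fin k → ℕ) (I : Finset ℕ) (hI : I.card ≤ k) {p : ℕ}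
    (hp : p ≤ k) (hc : I.card = p) (f : Fin p → ℕ) (hf : StrictMono f) (hfI : ∀ r, f r ∈ I) :
    flagMinor nu I hI = hMinor k k f (fun c => column nu (Fin.castLE hp c)) := by
  subst hc
  have : f = I.orderEmbOfFin rfl := Finset.orderEmbOfFin_unique rfl hfI hf
  subst this
  unfold flagMinor hMinor
  congr 1
  ext1 r c
  simp [toeplitz, hpoly_eq]

theorem flagMinor_interval {k : ℕ} (nu : Fin k → ℕ) (a p : ℕ) (hp : p ≤ k)
    (hI : (Finset.Icc (a + 1) (a + p)).card ≤ k) :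
    flagMinor nu (Finset.Icc (a + 1) (a + p)) hI =
      hMinor k k (fun r : Fin p => a + r + 1) (fun c => column nu (Fin.castLE hp c)) :=
  flagMinor_eq nu _ hI hp (by simp) _ (fun _ _ h => by
    have := Fin.lt_def.1 h; show _ + 1 < _ + 1; omega) fun r => by
      have := r.2; simp

/-- For consecutive rows the transpose is already a Jacobi-Trudi matrix: the offsets `a - ν` of the
columns become the parts. -/
theorem hMinor_interval_eq_schur {k : ℕ} (nu : Fin k → ℕ) (a p : ℕ) (hp : p ≤ k)
    (h : ∀ j : Fin p, nu (Fin.castLE hp j).rev ≤ a) :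
    hMinor k k (fun r : Fin p => a + r + 1) (fun c => column nu (Fin.castLE hp c)) =
      schur k (fun j : Fin p => a - nu (Fin.castLE hp j).rev) := by
  unfold hMinor schur skewSchur
  rw [← Matrix.det_transpose]
  congr 1
  ext1 r c
  simp only [Matrix.transpose_apply, Matrix.of_apply, hpoly_eq]
  congr 1
  unfold column
  have := h r
  simp only [Fin.val_castLE]
  omega

/-! ### Vanishing of skew Schur polynomials and flag minors -/

theorem skewSchur_ne_zero_iff (k : ℕ) (lam nu : Fin k → ℕ) (hlam : Antitone lam)
    (hnu : Antitone nu) : skewSchur k lam nu ≠ 0 ↔ ∀ i, nu i ≤ lam i := by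
  rw [skewSchur_eq_hMinor]
  refine (hMinor_ne_zero_iff le_rfl (column_strictMono hlam) (column_strictMono hnu)).trans ?_
  unfold column
  constructor
  · intro h i
    have := h i.rev
    simp only [Fin.rev_rev] at this
    omega
  · intro h r
    have := h r.rev
    omega

theorem flagMinor_ne_zero_iff {k : ℕ} {nu : Fin k → ℕ} (hnu : Antitone nu) (I : Finset ℕ)
    (hI : I.card ≤ k) :
    flagMinor nu I hI ≠ 0 ↔
      ∀ r : Fin I.card, column nu (Fin.castLE hI r) ≤ I.orderEmbOfFin rfl r := by
  rw [flagMinor_eq nu I hI hI rfl (I.orderEmbOfFin rfl) (OrderEmbedding.strictMono _)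
    (fun r => I.orderEmbOfFin_mem rfl r)]
  refine hMinor_ne_zero_iff hI (OrderEmbedding.strictMono _) ?_
  intro c d h
  exact column_strictMono hnu h

/-- Turns comparisons of sorted elements into counts, which are easy to follow when elements are
inserted. -/
theorem orderEmbOfFin_lt_iff (I : Finset ℕ) (r : Fin I.card) (b : ℕ) :
    I.orderEmbOfFin rfl r < b ↔ (r : ℕ) < (I.filter (· < b)).card := by
  have hcard : ∀ s : Finset (Fin I.card), (s.map (I.orderEmbOfFin rfl).toEmbedding).card = s.card :=
    fun s => Finset.card_map _
  constructor
  · intro h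
    have hsub : (Finset.Iic r).map (I.orderEmbOfFin rfl).toEmbedding ⊆ I.filter (· < b) := by
      intro x hx
      obtain ⟨c, hc, rfl⟩ := Finset.mem_map.1 hx
      refine Finset.mem_filter.2 ⟨I.orderEmbOfFin_mem rfl c, lt_of_le_of_lt ?_ h⟩
      exact (I.orderEmbOfFin rfl).monotone (Finset.mem_Iic.1 hc)
    have := Finset.card_le_card hsub
    rw [hcard, Fin.card_Iic] at this
    exact this
  · intro h
    by_contra hb
    have hsub : I.filter (· < b) ⊆ (Finset.Iio r).map (I.orderEmbOfFin rfl).toEmbedding := by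
      intro x hx
      obtain ⟨hxI, hxb⟩ := Finset.mem_filter.1 hx
      have : x ∈ Set.range (I.orderEmbOfFin rfl) := by
        rw [Finset.range_orderEmbOfFin]; exact hxI
      obtain ⟨c, rfl⟩ := this
      refine Finset.mem_map.2 ⟨c, Finset.mem_Iio.2 ?_, rfl⟩
      rw [← (I.orderEmbOfFin rfl).lt_iff_lt]
      exact lt_of_lt_of_le hxb (not_lt.1 hb)
    have := Finset.card_le_card hsub
    rw [hcard, Fin.card_Iio] at this
    omega

/-- A flag minor is nonzero when, for each of its columns, few enough of its rows lie below. Below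
any bound, `J ∪ {q}` has at most as many elements as `J ∪ {p, r}`: if `q` is below the bound, so is
`p`. Hence nonvanishing passes from the larger set to the smaller one. -/
theorem flagMinor_exchange_eq_zero {k : ℕ} {nu : Fin k → ℕ} (hnu : Antitone nu) (J : Finset ℕ)
    (p q r : ℕ) (hpq : p < q) (hp : p ∉ J) (hq : q ∉ J) (hr : r ∉ J) (hqr : q < r)
    (he : (insert q J).card ≤ k) (hf : (insert p (insert r J)).card ≤ k)
    (h : flagMinor nu (insert q J) he = 0) : flagMinor nu (insert p (insert r J)) hf = 0 := by
  by_contra hne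
  rw [← Ne, flagMinor_ne_zero_iff hnu] at hne
  refine absurd h ((flagMinor_ne_zero_iff hnu _ he).2 fun i => ?_)
  by_contra hi
  rw [not_le, orderEmbOfFin_lt_iff] at hi
  have hc1 : (insert q J).card = J.card + 1 := Finset.card_insert_of_notMem hq
  have hc2 : (insert p (insert r J)).card = J.card + 2 := by
    rw [Finset.card_insert_of_notMem, Finset.card_insert_of_notMem hr]
    simp only [Finset.mem_insert, not_or]
    exact ⟨by omega, hp⟩
  have := i.2
  have h2 := hne ⟨i, by omega⟩
  rw [← not_lt, orderEmbOfFin_lt_iff] at h2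
  apply h2
  refine lt_of_lt_of_le hi ?_
  show _ ≤ (Finset.filter (· < column nu (Fin.castLE he i)) _).card
  generalize column nu (Fin.castLE he i) = b
  rw [Finset.filter_insert]
  split_ifs with hb
  · rw [Finset.filter_insert, if_pos (hpq.trans hb)]
    refine (Finset.card_insert_le _ _).trans ?_
    rw [Finset.card_insert_of_notMem]
    · refine Nat.succ_le_succ (Finset.card_le_card ?_)
      exact Finset.filter_subset_filter _ (Finset.subset_insert _ _)
    · simp only [Finset.mem_filter, Finset.mem_insert, not_and]
      rintro (h | h)
      · omega
      · exact absurd h hp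
  · refine Finset.card_le_card (Finset.filter_subset_filter _ ?_)
    exact (Finset.subset_insert _ _).trans (Finset.subset_insert _ _)

/-- The matrix `H_ν` with columns indexed by natural numbers. -/
noncomputable def skewMatrix {k : ℕ} (nu : Fin k → ℕ) (i c : ℕ) : MvPolynomial (Fin k) ℚ :=
  if h : c < k then completeZ (xvar k) k ((i : ℤ) - (column nu ⟨c, h⟩ : ℕ)) else 0

theorem rowMinor_skewMatrix {k : ℕ} (nu : Fin k → ℕ) (ρ : ℕ → ℕ) (a p : ℕ) (hp : p ≤ k) :
    rowMinor (skewMatrix nu) ρ a p =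
      hMinor k k (fun r : Fin p => ρ (a + r)) (fun c => column nu (Fin.castLE hp c)) := by
  unfold rowMinor leadingMinor hMinor
  congr 1
  ext1 r c
  rw [Matrix.of_apply, Matrix.of_apply]
  beta_reduce
  rw [skewMatrix, dif_pos (c.2.trans_le hp)]
  rfl

/-- The same implication for windows. Entry by entry, the rows of the denominator are at least the
first `p - 1` rows of the desired minor, as skipping moves a position by at most one. -/
theorem rowMinor_skewMatrix_skip_eq_zero {k : ℕ} {nu : Fin k → ℕ} (hnu : Antitone nu)
    {ρ : ℕ → ℕ} (hρ : StrictMono ρ) {a p e : ℕ} (hp : p ≤ k)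
    (hw : rowMinor (skewMatrix nu) ρ (a + 1) (p - 1) = 0) :
    rowMinor (skewMatrix nu) (fun j => ρ (skip e j)) a p = 0 := by
  have hC : ∀ q (hq : q ≤ k), StrictMono fun c : Fin q => column nu (Fin.castLE hq c) :=
    fun q hq c d h => column_strictMono hnu h
  have hsk : StrictMono (skip e) := fun i j h => by unfold skip; split_ifs <;> omega
  rw [rowMinor_skewMatrix nu ρ (a + 1) (p - 1) (by omega)] at hw
  rw [rowMinor_skewMatrix nu _ a p hp]
  by_contra hne
  refine absurd hw (hMinor_ne_zero (by omega) (strictMono_comp_val hρ _) (hC _ _) fun r => ?_)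
  have hr : (r : ℕ) < p := by have := r.2; omega
  refine ((hMinor_ne_zero_iff hp (strictMono_comp_val (hρ.comp hsk) a) (hC _ _)).1 hne
    ⟨r, hr⟩).trans (hρ.monotone ?_)
  show skip e (a + r) ≤ _
  unfold skip
  split_ifs <;> omega

/-! ### Values of circuits -/

section Values

variable {k : ℕ}

/-- A rational function that is positive at `(1, …, 1)`, as a quotient of two polynomials that
are. -/
def IsPositive (y : RatField k) : Prop :=
  ∃ f g : MvPolynomial (Fin k) ℚ, 0 < eval (fun _ => (1 : ℚ)) f ∧ 0 < eval (fun _ => (1 : ℚ)) g ∧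
    y * algebraMap _ (RatField k) g = algebraMap _ (RatField k) f

theorem algebraMap_ne_zero_of_eval_pos {f : MvPolynomial (Fin k) ℚ}
    (h : 0 < eval (fun _ => (1 : ℚ)) f) : algebraMap _ (RatField k) f ≠ 0 := by
  intro h0
  rw [(injective_iff_map_eq_zero _).1 (IsFractionRing.injective (MvPolynomial (Fin k) ℚ)
    (RatField k)) f h0, map_zero] at h
  exact lt_irrefl _ h

theorem IsPositive.ne_zero {y : RatField k} (h : IsPositive y) : y ≠ 0 := by
  obtain ⟨f, g, hf, _, h⟩ := h
  rintro rfl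
  rw [zero_mul] at h
  exact algebraMap_ne_zero_of_eval_pos hf h.symm

theorem IsPositive.add {y z : RatField k} (hy : IsPositive y) (hz : IsPositive z) :
    IsPositive (y + z) := by
  obtain ⟨f, g, hf, hg, h⟩ := hy
  obtain ⟨f', g', hf', hg', h'⟩ := hz
  refine ⟨f * g' + f' * g, g * g', ?_, ?_, ?_⟩
  · simp only [map_add, map_mul]; positivity
  · simp only [map_mul]; positivity
  · simp only [map_add, map_mul]; rw [← h, ← h']; ring

theorem IsPositive.mul {y z : RatField k} (hy : IsPositive y) (hz : IsPositive z) :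
    IsPositive (y * z) := by
  obtain ⟨f, g, hf, hg, h⟩ := hy
  obtain ⟨f', g', hf', hg', h'⟩ := hz
  refine ⟨f * f', g * g', ?_, ?_, ?_⟩
  · simp only [map_mul]; positivity
  · simp only [map_mul]; positivity
  · simp only [map_mul]; rw [← h, ← h']; ring

theorem IsPositive.div {y z : RatField k} (hy : IsPositive y) (hz : IsPositive z) :
    IsPositive (y / z) := by
  have hz0 := hz.ne_zero
  obtain ⟨f, g, hf, hg, h⟩ := hy
  obtain ⟨f', g', hf', hg', h'⟩ := hz
  refine ⟨f * g', g * f', ?_, ?_, ?_⟩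
  · simp only [map_mul]; positivity
  · simp only [map_mul]; positivity
  · simp only [map_mul]; rw [← h, ← h']; field_simp

/-- The value of an operand, with a default value for the illegal ones. -/
noncomputable def operandValue (vals : List (RatField k)) : Operand → RatField k
  | .var i => if h : i < k then algebraMap (MvPolynomial (Fin k) ℚ) (RatField k) (X ⟨i, h⟩) else 0
  | .scalar c => c
  | .gate j => vals[j]?.getD 0

/-- The value of a gate. -/
noncomputable def gateValue (vals : List (RatField k)) (g : Gate) : RatField k :=
  match g.op with
  | .add => operandValue vals g.left + operandValue vals g.right
  | .mul => operandValue vals g.left * operandValue vals g.right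
  | .div => operandValue vals g.left / operandValue vals g.right

variable (k) in
/-- The values of the gates of a circuit. -/
noncomputable def values (c : Circuit) : List (RatField k) :=
  c.foldl (fun vals g => vals ++ [gateValue vals g]) []

theorem values_snoc (c : Circuit) (g : Gate) :
    values k (c ++ [g]) = values k c ++ [gateValue (values k c) g] := by
  simp [values]

theorem values_length (c : Circuit) : (values k c).length = c.length := by
  induction c using List.reverseRecOn with
  | nil => rfl
  | append_singleton c g ih => rw [values_snoc]; simp [ih]

theorem values_prefix {c c' : Circuit} (h : c <+: c') : values k c <+: values k c' := by
  obtain ⟨l, rfl⟩ := h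
  induction l using List.reverseRecOn with
  | nil => simp
  | append_singleton l g ih =>
    rw [← List.append_assoc, values_snoc]
    exact ih.trans (List.prefix_append _ _)

theorem OperandValue.eq {vals : List (RatField k)} {a : Operand} {y : RatField k}
    (h : OperandValue vals a y) : operandValue vals a = y := by
  cases h with
  | var i => simp [operandValue]
  | scalar c hc => rfl
  | gate j hj => simp [operandValue, hj]

theorem GateValue.eq {vals : List (RatField k)} {g : Gate} {y : RatField k}
    (h : GateValue vals g y) : gateValue vals g = y := by
  cases h with
  | add ha hb => simp [gateValue, ha.eq, hb.eq]
  | mul ha hb => simp [gateValue, ha.eq, hb.eq]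
  | div ha hb hz => simp [gateValue, ha.eq, hb.eq]

variable (k) in
/-- All gates of the circuit have a value. -/
def IsLegal (c : Circuit) : Prop := CircuitValues c (values k c)

theorem IsLegal.snoc {c : Circuit} (hc : IsLegal k c) {g : Gate} {y : RatField k}
    (hg : GateValue (values k c) g y) : IsLegal k (c ++ [g]) := by
  unfold IsLegal
  rw [values_snoc, hg.eq]
  exact .snoc hc hg

theorem OperandValue.isPositive {vals : List (RatField k)} {a : Operand} {y : RatField k}
    (h : OperandValue vals a y) (hv : ∀ z ∈ vals, IsPositive z) : IsPositive y := by
  cases h with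
  | var i => exact ⟨X i, 1, by simp, by simp, by simp⟩
  | scalar c hc => exact ⟨c, 1, by simpa using hc, by simp, by simp⟩
  | gate j hj => exact hv _ (List.getElem_mem hj)

/-- Variables and positive scalars are positive at `(1, …, 1)`, and sums, products and quotients
stay so. This justifies every division. -/
theorem CircuitValues.isPositive {c : Circuit} {vals : List (RatField k)}
    (h : CircuitValues c vals) : ∀ z ∈ vals, IsPositive z := by
  induction h with
  | nil => simp
  | snoc hc hg ih =>
    intro z hz
    rcases List.mem_append.1 hz with hz | hz
    · exact ih z hz
    · rw [List.mem_singleton.1 hz]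
      cases hg with
      | add ha hb => exact (ha.isPositive ih).add (hb.isPositive ih)
      | mul ha hb => exact (ha.isPositive ih).mul (hb.isPositive ih)
      | div ha hb hz => exact (ha.isPositive ih).div (hb.isPositive ih)

/-- The number `j` represents `y`: it is `0` if `y = 0`, and the number of a gate with the value
`y` otherwise. -/
def Represents (c : Circuit) (j : ℕ) (y : RatField k) : Prop :=
  if j = 0 then y = 0 else (values k c)[j]? = some y

theorem represents_zero (c : Circuit) : Represents c 0 (0 : RatField k) := by
  simp [Represents]

theorem Represents.mono {c c' : Circuit} (h : c <+: c') {j : ℕ} {y : RatField k}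
    (hy : Represents c j y) : Represents c' j y := by
  unfold Represents at *
  split_ifs at * with hj
  · exact hy
  · obtain ⟨l, hl⟩ := values_prefix (k := k) h
    rw [← hl, List.getElem?_append_left, hy]
    exact (List.getElem?_eq_some_iff.1 hy).1

theorem Represents.operandValue {c : Circuit} {j : ℕ} {y : RatField k} (hj : 0 < j)
    (hy : Represents c j y) : OperandValue (values k c) (.gate j) y := by
  unfold Represents at hy
  rw [if_neg hj.ne'] at hy
  obtain ⟨h, rfl⟩ := List.getElem?_eq_some_iff.1 hy
  exact .gate j h

theorem Represents.isPositive {c : Circuit} (hc : IsLegal k c) {j : ℕ} {y : RatField k}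
    (hj : 0 < j) (hy : Represents c j y) : IsPositive y :=
  (hy.operandValue hj).isPositive (CircuitValues.isPositive hc)

theorem Represents.pos {c : Circuit} {j : ℕ} {y : RatField k} (hy : Represents c j y)
    (h0 : y ≠ 0) : 0 < j := by
  rcases Nat.eq_zero_or_pos j with rfl | h
  · simp [Represents, h0] at hy
  · exact h

/-- The circuit must be nonempty, because the number `0` is reserved for the zero function. -/
theorem represents_snoc {c : Circuit} (hc : 0 < c.length) {g : Gate} {y : RatField k}
    (hg : GateValue (values k c) g y) : Represents (c ++ [g]) c.length y := by
  unfold Represents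
  rw [if_neg hc.ne', values_snoc, hg.eq, ← values_length (k := k) c]
  simp

theorem IsLegal.computes {c : Circuit} (hc : IsLegal k c) {g : Gate} {f : MvPolynomial (Fin k) ℚ}
    (hg : GateValue (values k c) g (algebraMap _ (RatField k) f)) : Computes (c ++ [g]) f :=
  ⟨values k c, .snoc hc hg⟩

end Values

/-! ### A program logic with cost bounds -/

/-- The registers that an instruction writes to. -/
def Instr.writes : Instr → List ℕ
  | .set x _ => [x]
  | .add x _ _ => [x]
  | .sub x _ _ => [x]
  | .mul x _ _ => [x]
  | .load x _ => [x]
  | .store _ _ => []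
  | .emit _ _ _ => []

/-- The registers that a program may write to. -/
def Program.writes : Program → List ℕ
  | .skip => []
  | .instr i => i.writes
  | .seq P Q => P.writes ++ Q.writes
  | .ifLt _ _ P Q => P.writes ++ Q.writes
  | .whileLt _ _ P => P.writes

theorem Exec.reg_eq {P : Program} {s s' : State} {t : ℕ} (h : Exec P s s' t) :
    ∀ x ∉ P.writes, s'.reg x = s.reg x := by
  induction h with
  | skip s => exact fun _ _ => rfl
  | instr i s =>
    intro x hx
    cases i <;> simp_all [Program.writes, Instr.writes, Instr.run]
  | seq hP hQ ihP ihQ =>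
    intro x hx
    simp only [Program.writes, List.mem_append, not_or] at hx
    rw [ihQ x hx.2, ihP x hx.1]
  | ifTrue h hP ih =>
    intro x hx
    simp only [Program.writes, List.mem_append, not_or] at hx
    exact ih x hx.1
  | ifFalse h hQ ih =>
    intro x hx
    simp only [Program.writes, List.mem_append, not_or] at hx
    exact ih x hx.2
  | whileTrue h hP hW ihP ihW =>
    intro x hx
    rw [ihW x hx, ihP x hx]
  | whileFalse h => exact fun _ _ => rfl

theorem Exec.out_prefix {P : Program} {s s' : State} {t : ℕ} (h : Exec P s s' t) :
    s.out <+: s'.out := by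
  induction h with
  | skip s => exact List.prefix_rfl
  | instr i s => cases i <;> simp [Instr.run]
  | seq hP hQ ihP ihQ => exact ihP.trans ihQ
  | ifTrue h hP ih => exact ih
  | ifFalse h hQ ih => exact ih
  | whileTrue h hP hW ihP ihW => exact ihP.trans ihW
  | whileFalse h => exact List.prefix_rfl

/-- All numbers in the registers and in the memory are at most `U`. -/
structure State.Bounded (s : State) (U : ℕ) : Prop where
  reg : ∀ x, s.reg x ≤ U
  mem : ∀ x, s.mem x ≤ U

/-- `Wp U P s τ Q`: if the numbers in the state `s` are at most `U`, and there is room for `τ` more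
gates below `U`, then the program `P` started in the state `s` halts after at most `τ`
instructions and tests, the numbers never exceed `U`, and the final state satisfies `Q`. -/
def Wp (U : ℕ) (P : Program) (s : State) (τ : ℕ) (Q : State → Prop) : Prop :=
  s.Bounded U → s.out.length + τ ≤ U → ∃ s' t, Exec P s s' t ∧ t ≤ τ * (1 + U.size) ^ 2 ∧
    s'.Bounded U ∧ s'.out.length ≤ s.out.length + τ ∧ Q s'

/-- The state after an assignment to a register. -/
def State.setReg (s : State) (x v : ℕ) : State := { s with reg := Function.update s.reg x v }

/-- The state after an assignment to a memory cell. -/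
def State.setMem (s : State) (x v : ℕ) : State := { s with mem := Function.update s.mem x v }

@[simp] theorem State.setReg_reg (s : State) (x v y : ℕ) :
    (s.setReg x v).reg y = if y = x then v else s.reg y := by
  simp [State.setReg, Function.update_apply]

@[simp] theorem State.setReg_mem (s : State) (x v : ℕ) : (s.setReg x v).mem = s.mem := rfl

@[simp] theorem State.setReg_out (s : State) (x v : ℕ) : (s.setReg x v).out = s.out := rfl

@[simp] theorem State.setMem_reg (s : State) (x v : ℕ) : (s.setMem x v).reg = s.reg := rfl

@[simp] theorem State.setMem_mem (s : State) (x v y : ℕ) :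
    (s.setMem x v).mem y = if y = x then v else s.mem y := by
  simp [State.setMem, Function.update_apply]

@[simp] theorem State.setMem_out (s : State) (x v : ℕ) : (s.setMem x v).out = s.out := rfl

theorem State.Bounded.setReg {s : State} {U : ℕ} (h : s.Bounded U) {x v : ℕ} (hv : v ≤ U) :
    (s.setReg x v).Bounded U :=
  ⟨fun y => by rw [State.setReg_reg]; split_ifs; exacts [hv, h.reg y], h.mem⟩

theorem State.Bounded.setMem {s : State} {U : ℕ} (h : s.Bounded U) {x v : ℕ} (hv : v ≤ U) :
    (s.setMem x v).Bounded U :=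
  ⟨h.reg, fun y => by rw [State.setMem_mem]; split_ifs; exacts [hv, h.mem y]⟩

namespace Wp

variable {U : ℕ} {s : State} {τ τ' : ℕ} {P P' : Program} {Q Q' : State → Prop}

theorem mono (h : Wp U P s τ Q) (hτ : τ ≤ τ') (hQ : ∀ s', Q s' → Q' s') : Wp U P s τ' Q' := by
  intro hb hl
  obtain ⟨s', t, he, ht, hb', hl', hq⟩ := h hb (by omega)
  exact ⟨s', t, he, ht.trans (Nat.mul_le_mul_right _ hτ), hb', by omega, hQ s' hq⟩

/-- Makes the bounds built into `Wp` available while it is being proved, for instance to see that a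
copied number is at most `U`. -/
theorem assume (h : s.Bounded U → s.out.length + τ ≤ U → Wp U P s τ Q) : Wp U P s τ Q :=
  fun hb hl => h hb hl hb hl

/-- Registers that do not occur as targets keep their contents, and gates are only appended.
Specifications can thus be limited to what a program changes. -/
theorem frame (h : Wp U P s τ Q) :
    Wp U P s τ fun s' => Q s' ∧ (∀ x ∉ P.writes, s'.reg x = s.reg x) ∧ s.out <+: s'.out := by
  intro hb hl
  obtain ⟨s', t, he, ht, hb', hl', hq⟩ := h hb hl
  exact ⟨s', t, he, ht, hb', hl', hq, he.reg_eq, he.out_prefix⟩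

theorem seq (h : Wp U P s τ fun s' => Wp U P' s' τ' Q) : Wp U (.seq P P') s (τ + τ') Q := by
  intro hb hl
  obtain ⟨s', t, he, ht, hb', hl', hq⟩ := h hb (by omega)
  obtain ⟨s'', t', he', ht', hb'', hl'', hq'⟩ := hq hb' (by omega)
  exact ⟨s'', t + t', .seq he he', by rw [Nat.add_mul]; omega, hb'', by omega, hq'⟩

theorem skip (h : Q s) : Wp U .skip s 0 Q := fun hb _ =>
  ⟨s, 0, .skip s, Nat.zero_le _, hb, Nat.le_refl _, h⟩

theorem linear_cost_le {x y U : ℕ} (hx : x ≤ U) (hy : y ≤ U) :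
    1 + x.size + y.size ≤ 1 * (1 + U.size) ^ 2 := by
  have h1 := Nat.size_le_size hx
  have h2 := Nat.size_le_size hy
  nlinarith

theorem instr (i : Instr) (hb' : s.Bounded U → (i.run s).Bounded U)
    (hc : s.Bounded U → i.cost s ≤ 1 * (1 + U.size) ^ 2)
    (hl : (i.run s).out.length ≤ s.out.length + 1) (h : Q (i.run s)) :
    Wp U (.instr i) s 1 Q :=
  fun hb _ => ⟨i.run s, i.cost s, .instr i s, hc hb, hb' hb, hl, h⟩

theorem set {x c : ℕ} (hc : c ≤ U) (h : Q (s.setReg x c)) : Wp U (.instr (.set x c)) s 1 Q :=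
  instr _ (fun hb => hb.setReg hc) (fun _ => (Nat.le_add_right _ _).trans (linear_cost_le hc hc))
    (Nat.le_succ _) h

theorem add {x y z : ℕ} (hc : s.reg y + s.reg z ≤ U) (h : Q (s.setReg x (s.reg y + s.reg z))) :
    Wp U (.instr (.add x y z)) s 1 Q :=
  instr _ (fun hb => hb.setReg hc) (fun hb => linear_cost_le (hb.reg y) (hb.reg z))
    (Nat.le_succ _) h

theorem sub {x y z : ℕ} (h : Q (s.setReg x (s.reg y - s.reg z))) :
    Wp U (.instr (.sub x y z)) s 1 Q :=
  instr _ (fun hb => hb.setReg ((Nat.sub_le _ _).trans (hb.reg y)))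
    (fun hb => linear_cost_le (hb.reg y) (hb.reg z)) (Nat.le_succ _) h

theorem mul {x y z : ℕ} (hc : s.reg y * s.reg z ≤ U) (h : Q (s.setReg x (s.reg y * s.reg z))) :
    Wp U (.instr (.mul x y z)) s 1 Q :=
  instr _ (fun hb => hb.setReg hc)
    (fun hb => by
      rw [one_mul, sq]
      exact Nat.mul_le_mul (Nat.add_le_add_left (Nat.size_le_size (hb.reg y)) 1)
        (Nat.add_le_add_left (Nat.size_le_size (hb.reg z)) 1))
    (Nat.le_succ _) h

theorem load {x y : ℕ} (h : Q (s.setReg x (s.mem (s.reg y)))) : Wp U (.instr (.load x y)) s 1 Q :=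
  instr _ (fun hb => hb.setReg (hb.mem _)) (fun hb => linear_cost_le (hb.reg y) (hb.mem _))
    (Nat.le_succ _) h

theorem store {x y : ℕ} (h : Q (s.setMem (s.reg x) (s.reg y))) :
    Wp U (.instr (.store x y)) s 1 Q :=
  instr _ (fun hb => hb.setMem (hb.reg _)) (fun hb => linear_cost_le (hb.reg x) (hb.reg y))
    (Nat.le_succ _) h

theorem emit {o : Op} {a b : Operand}
    (h : Q { s with out := s.out ++ [⟨o, a.read s.reg, b.read s.reg⟩] }) :
    Wp U (.instr (.emit o a b)) s 1 Q := by
  refine instr _ (fun hb => ⟨hb.reg, hb.mem⟩) (fun hb => ?_) (by simp [Instr.run]) h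
  have : ∀ c : Operand, ∃ v ≤ U, (c.read s.reg).bits = v.size := fun c => by
    cases c <;> exact ⟨_, hb.reg _, rfl⟩
  obtain ⟨v, hv, ha⟩ := this a
  obtain ⟨w, hw, hb⟩ := this b
  simp only [Instr.cost, ha, hb]
  exact linear_cost_le hv hw

theorem ifLt {x y : ℕ} (h : s.reg x < s.reg y → Wp U P s τ Q)
    (h' : ¬ s.reg x < s.reg y → Wp U P' s τ Q) : Wp U (.ifLt x y P P') s (τ + 1) Q := by
  intro hb hl
  have hc : s.testCost x y ≤ 1 * (1 + U.size) ^ 2 := linear_cost_le (hb.reg x) (hb.reg y)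
  by_cases hxy : s.reg x < s.reg y
  · obtain ⟨s', t, he, ht, hb', hl', hq⟩ := h hxy hb (by omega)
    exact ⟨s', _, .ifTrue hxy he, by rw [Nat.add_mul]; omega, hb', by omega, hq⟩
  · obtain ⟨s', t, he, ht, hb', hl', hq⟩ := h' hxy hb (by omega)
    exact ⟨s', _, .ifFalse hxy he, by rw [Nat.add_mul]; omega, hb', by omega, hq⟩

/-- A loop, with an invariant `I r` for the states in which `r` rounds remain. -/
theorem whileLt {x y : ℕ} (I : ℕ → State → Prop) (hlt : ∀ r s, I (r + 1) s → s.reg x < s.reg y)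
    (hend : ∀ s, I 0 s → ¬ s.reg x < s.reg y)
    (hbody : ∀ r s, I (r + 1) s → Wp U P s τ (I r)) (hQ : ∀ s, I 0 s → Q s) (r : ℕ) (h : I r s) :
    Wp U (.whileLt x y P) s (r * (τ + 1) + 1) Q := by
  induction r generalizing s with
  | zero =>
    intro hb _
    have hc : s.testCost x y ≤ 1 * (1 + U.size) ^ 2 := linear_cost_le (hb.reg x) (hb.reg y)
    exact ⟨s, _, .whileFalse (hend s h), by simpa using hc, hb, by omega, hQ s h⟩
  | succ r ih =>
    intro hb hl
    have hc : s.testCost x y ≤ 1 * (1 + U.size) ^ 2 := linear_cost_le (hb.reg x) (hb.reg y)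
    have e : (r + 1) * (τ + 1) + 1 = 1 + τ + (r * (τ + 1) + 1) := by ring
    rw [e] at hl ⊢
    obtain ⟨s', t, he, ht, hb', hl', hq⟩ := hbody r s h hb (by omega)
    obtain ⟨s'', t', he', ht', hb'', hl'', hq'⟩ := ih hq hb' (by omega)
    exact ⟨s'', _, .whileTrue (hlt r s h) he he', by rw [Nat.add_mul, Nat.add_mul]; omega, hb'',
      by omega, hq'⟩

/-- A counting loop, with an invariant `I j` for the states in which the counter is `j`. -/
theorem whileLt_up {x y : ℕ} (I : ℕ → State → Prop) (m : ℕ)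
    (hI : ∀ j s, I j s → s.reg x = j ∧ s.reg y = m)
    (hbody : ∀ j s, j < m → I j s → Wp U P s τ (I (j + 1))) (hQ : ∀ s, I m s → Q s) (j : ℕ)
    (hj : j ≤ m) (h : I j s) : Wp U (.whileLt x y P) s ((m - j) * (τ + 1) + 1) Q := by
  refine whileLt (fun r s => r ≤ m ∧ I (m - r) s) ?_ ?_ ?_ ?_ (m - j) ⟨by omega, ?_⟩
  · rintro r s ⟨hr, h⟩
    obtain ⟨h1, h2⟩ := hI _ _ h
    omega
  · rintro s ⟨_, h⟩
    obtain ⟨h1, h2⟩ := hI _ _ h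
    omega
  · rintro r s ⟨hr, h⟩
    refine (hbody _ s (by omega) h).mono le_rfl fun s' h' => ⟨by omega, ?_⟩
    rwa [show m - (r + 1) + 1 = m - r by omega] at h'
  · rintro s ⟨_, h⟩
    exact hQ s (by simpa using h)
  · rwa [Nat.sub_sub_self hj]

end Wp

/-! ### The registers -/

notation "rK" => (0 : ℕ)
notation "rOne" => (1 : ℕ)
notation "rBase" => (2 : ℕ)
notation "rGate" => (3 : ℕ)
notation "rZero" => (4 : ℕ)
notation "rKSucc" => (5 : ℕ)
-- `rTag` selects the table of minors and `rTagW` the list of rows to keep. `rTop` is the top layer,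
-- `rD` the layer being processed, and `(rA, rP)` the start and length of a window. `rC` is a
-- position in the row list and `rW` the row found there. The others are for intermediate results;
-- `rS` holds the address for writing.
notation "rTag" => (6 : ℕ)
notation "rTagW" => (7 : ℕ)
notation "rTop" => (8 : ℕ)
notation "rD" => (9 : ℕ)
notation "rDPred" => (10 : ℕ)
notation "rP" => (11 : ℕ)
notation "rPPred" => (12 : ℕ)
notation "rA" => (13 : ℕ)
notation "rASucc" => (14 : ℕ)
notation "rC" => (15 : ℕ)
notation "rW" => (16 : ℕ)
notation "rV" => (17 : ℕ)
notation "rX" => (18 : ℕ)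
notation "rY" => (19 : ℕ)
notation "rZ" => (20 : ℕ)
notation "rS" => (21 : ℕ)

infixr:60 " ;; " => Program.seq

/-- The registers with a permanent meaning. -/
def permanent : List ℕ := [rK, rOne, rBase, rGate, rZero, rKSucc]

/-- The permanent registers have their intended contents: `k`, `1`, the base `b` of the
addresses, the number of gates, `0` and `k + 1`. -/
structure Env (k b : ℕ) (s : State) : Prop where
  legal : IsLegal k s.out
  -- Ensures that the next gate gets a nonzero number.
  pos : 0 < s.out.length
  regK : s.reg rK = k
  regOne : s.reg rOne = 1
  regBase : s.reg rBase = b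
  regGate : s.reg rGate = s.out.length
  regZero : s.reg rZero = 0
  regKSucc : s.reg rKSucc = k + 1

section Programs

variable {k b U : ℕ} {s : State}

theorem Env.setReg (h : Env k b s) {r : ℕ} (hr : r ∉ permanent) (v : ℕ) :
    Env k b (s.setReg r v) := by
  simp only [permanent, List.mem_cons, List.not_mem_nil, or_false, not_or] at hr
  obtain ⟨h0, h1, h2, h3, h4, h5⟩ := hr
  refine ⟨h.legal, h.pos, ?_, ?_, ?_, ?_, ?_, ?_⟩
  · rw [State.setReg_reg, if_neg (Ne.symm h0), h.regK]
  · rw [State.setReg_reg, if_neg (Ne.symm h1), h.regOne]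
  · rw [State.setReg_reg, if_neg (Ne.symm h2), h.regBase]
  · rw [State.setReg_reg, if_neg (Ne.symm h3), h.regGate, State.setReg_out]
  · rw [State.setReg_reg, if_neg (Ne.symm h4), h.regZero]
  · rw [State.setReg_reg, if_neg (Ne.symm h5), h.regKSucc]

theorem Env.setMem (h : Env k b s) (x v : ℕ) : Env k b (s.setMem x v) :=
  ⟨h.legal, h.pos, h.regK, h.regOne, h.regBase, h.regGate, h.regZero, h.regKSucc⟩

/-- The effect of a program that computes a representation of `y` in the register `r`. -/
structure Yields (k b : ℕ) (s : State) (r : ℕ) (y : RatField k) (s' : State) : Prop where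
  env : Env k b s'
  represents : Represents s'.out (s'.reg r) y
  mem : s'.mem = s.mem
  reg : ∀ x, x ≠ r → x ≠ rGate → s'.reg x = s.reg x
  out : s.out <+: s'.out

theorem Yields.setReg (hs : Env k b s) {r : ℕ} (hr : r ∉ permanent) {v : ℕ} {y : RatField k}
    (h : Represents s.out v y) : Yields k b s r y (s.setReg r v) where
  env := hs.setReg hr v
  represents := by simpa using h
  mem := rfl
  reg := fun x hx _ => by rw [State.setReg_reg, if_neg hx]
  out := List.prefix_rfl

/-- Issue a gate, and put its number into the register `r`. -/
def emitTo (o : Op) (r : ℕ) (x y : Operand) : Program :=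
  .instr (.emit o x y) ;; .instr (.add r rGate rZero) ;; .instr (.add rGate rGate rOne)

theorem emitTo_wp (hs : Env k b s) {o : Op} {r : ℕ} (hr : r ∉ permanent) {x y : Operand}
    {v : RatField k} (hg : GateValue (values k s.out) ⟨o, x.read s.reg, y.read s.reg⟩ v) :
    Wp U (emitTo o r x y) s 3 (Yields k b s r v) := by
  refine Wp.assume fun hb hl => ?_
  have hr' := hr
  simp only [permanent, List.mem_cons, List.not_mem_nil, or_false, not_or] at hr'
  obtain ⟨h0, h1, h2, h3, h4, h5⟩ := hr'
  refine Wp.seq (τ := 1) (τ' := 2) (Wp.emit (Wp.seq (τ := 1) (τ' := 1) (Wp.add ?_ (Wp.add ?_ ?_))))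
  · simp only [hs.regGate, hs.regZero]; omega
  · simp only [State.setReg_reg, if_neg (Ne.symm h3), if_neg (Ne.symm h1), hs.regGate, hs.regOne]
    omega
  · refine ⟨⟨hs.legal.snoc hg, by simp, ?_, ?_, ?_, ?_, ?_, ?_⟩, ?_, rfl, ?_, by simp⟩
    · simp [Ne.symm h0, hs.regK]
    · simp [Ne.symm h1, hs.regOne]
    · simp [Ne.symm h2, hs.regBase]
    · simp [Ne.symm h3, Ne.symm h1, hs.regGate, hs.regOne]
    · simp [Ne.symm h4, hs.regZero]
    · simp [Ne.symm h5, hs.regKSucc]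
    · have := represents_snoc hs.pos hg
      simpa [h3, hs.regGate, hs.regZero] using this
    · intro z hz hz3
      simp [hz, hz3]

/-- Multiplication or division of two represented functions. -/
def combine (o : Op) (r u v : ℕ) : Program :=
  .ifLt rZero u
    (.ifLt rZero v (emitTo o r (.gate u) (.gate v)) (.instr (.set r 0)))
    (.instr (.set r 0))

/-- No gate is issued if an operand is marked as zero. For a zero denominator this matches the
convention `y / 0 = 0`; a denominator with a gate is nonzero by positivity. -/
theorem combine_wp (hs : Env k b s) {o : Op} {r u v : ℕ} (hr : r ∉ permanent) {y z w : RatField k}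
    (hy : Represents s.out (s.reg u) y) (hz : Represents s.out (s.reg v) z)
    (ho : (o = .mul ∧ w = y * z) ∨ (o = .div ∧ w = y / z)) :
    Wp U (combine o r u v) s 5 (Yields k b s r w) := by
  have zero : w = 0 → Wp U (.instr (.set r 0)) s 3 (Yields k b s r w) := by
    rintro rfl
    exact (Wp.set (Nat.zero_le _) (Yields.setReg hs hr (represents_zero _))).mono (by omega)
      fun _ h => h
  refine Wp.ifLt (τ := 4) (fun hu => Wp.ifLt (τ := 3) (fun hv => ?_) fun hv => zero ?_)
    fun hu => (zero ?_).mono (by omega) fun _ h => h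
  · rw [hs.regZero] at hu hv
    refine emitTo_wp hs hr ?_
    rcases ho with ⟨rfl, rfl⟩ | ⟨rfl, rfl⟩
    · exact .mul (hy.operandValue hu) (hz.operandValue hv)
    · exact .div (hy.operandValue hu) (hz.operandValue hv) (hz.isPositive hs.legal hv).ne_zero
  · have : z = 0 := by
      by_contra h
      exact hv (by rw [hs.regZero]; exact hz.pos h)
    rcases ho with ⟨_, rfl⟩ | ⟨_, rfl⟩ <;> simp [this]
  · have : y = 0 := by
      by_contra h
      exact hu (by rw [hs.regZero]; exact hy.pos h)
    rcases ho with ⟨_, rfl⟩ | ⟨_, rfl⟩ <;> simp [this]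

/-- Addition of two represented functions. -/
def plus (r u v : ℕ) : Program :=
  .ifLt rZero u
    (.ifLt rZero v (emitTo .add r (.gate u) (.gate v)) (.instr (.add r u rZero)))
    (.instr (.add r v rZero))

theorem plus_wp (hs : Env k b s) {r u v : ℕ} (hr : r ∉ permanent) {y z : RatField k}
    (hy : Represents s.out (s.reg u) y) (hz : Represents s.out (s.reg v) z) :
    Wp U (plus r u v) s 5 (Yields k b s r (y + z)) := by
  refine Wp.assume fun hb _ => ?_
  have copy : ∀ c w, s.reg c = w → Represents s.out w (y + z) →
      Wp U (.instr (.add r c rZero)) s 3 (Yields k b s r (y + z)) := by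
    rintro c _ rfl h
    refine (Wp.add ?_ ?_).mono (show 1 ≤ 3 by omega) fun _ h => h
    · rw [hs.regZero]; exact hb.reg c
    · rw [hs.regZero]; exact Yields.setReg hs hr h
  refine Wp.ifLt (τ := 4) (fun hu => Wp.ifLt (τ := 3) (fun hv => ?_) fun hv => copy u _ rfl ?_)
    fun hu => (copy v _ rfl ?_).mono (by omega) fun _ h => h
  · rw [hs.regZero] at hu hv
    exact emitTo_wp hs hr (.add (hy.operandValue hu) (hz.operandValue hv))
  · have : z = 0 := by
      by_contra h
      exact hv (by rw [hs.regZero]; exact hz.pos h)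
    rwa [this, add_zero]
  · have : y = 0 := by
      by_contra h
      exact hu (by rw [hs.regZero]; exact hy.pos h)
    rwa [this, zero_add]

/-! ### Tables in the memory -/

/-- The address of the entry `(d, a, p)` of the table `t`. -/
def address (b t d a p : ℕ) : ℕ := ((t * b + d) * b + a) * b + p

theorem mul_add_inj {b x y p q : ℕ} (hp : p < b) (hq : q < b) (h : x * b + p = y * b + q) :
    x = y ∧ p = q := by
  have hb : 0 < b := by omega
  have h1 := congrArg (· / b) h
  have h2 := congrArg (· % b) h
  simp only [Nat.add_comm (_ * b), Nat.add_mul_div_right _ _ hb, Nat.add_mul_mod_self_right,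
    Nat.div_eq_of_lt hp, Nat.div_eq_of_lt hq, Nat.mod_eq_of_lt hp, Nat.mod_eq_of_lt hq,
    zero_add] at h1 h2
  exact ⟨h1, h2⟩

/-- `d`, `a` and `p` are the last three digits to the base `b`, so different entries occupy
different cells. -/
theorem address_inj {t d a p t' d' a' p' : ℕ} (hd : d < b) (ha : a < b) (hp : p < b)
    (hd' : d' < b) (ha' : a' < b) (hp' : p' < b)
    (h : address b t d a p = address b t' d' a' p') : t = t' ∧ d = d' ∧ a = a' ∧ p = p' := by
  obtain ⟨h, h1⟩ := mul_add_inj hp hp' h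
  obtain ⟨h, h2⟩ := mul_add_inj ha ha' h
  obtain ⟨h, h3⟩ := mul_add_inj hd hd' h
  exact ⟨h, h3, h2, h1⟩

theorem address_lt {t d a p : ℕ} (ht : t ≤ 4) (hd : d < b) (ha : a < b) (hp : p < b) :
    address b t d a p < 5 * b ^ 3 := by
  have h1 : t * b + d + 1 ≤ 5 * b := by nlinarith
  have h2 : (t * b + d) * b + a + 1 ≤ 5 * b * b := by nlinarith
  have h3 : ((t * b + d) * b + a) * b + p + 1 ≤ 5 * b * b * b := by nlinarith
  calc address b t d a p < 5 * b * b * b := h3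
    _ = 5 * b ^ 3 := by ring

/-- Compute an address. -/
def locate (x t d a p : ℕ) : Program :=
  .instr (.mul x t rBase) ;; .instr (.add x x d) ;; .instr (.mul x x rBase) ;;
    .instr (.add x x a) ;; .instr (.mul x x rBase) ;; .instr (.add x x p)

theorem State.setReg_setReg (s : State) (x v w : ℕ) : (s.setReg x v).setReg x w = s.setReg x w := by
  simp [State.setReg]

theorem locate_wp {x t d a p T D A P : ℕ} {Q : State → Prop} (hb : s.reg rBase = b)
    (ht : s.reg t = T) (hd : s.reg d = D) (ha : s.reg a = A) (hp : s.reg p = P)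
    (hx : x ≠ d ∧ x ≠ a ∧ x ≠ p ∧ x ≠ rBase) (hU : address b T D A P ≤ U)
    (hQ : Q (s.setReg x (address b T D A P))) : Wp U (locate x t d a p) s 6 Q := by
  obtain ⟨hxd, hxa, hxp, hxb⟩ := hx
  -- For `b > 0` all intermediate results are bounded by the final address; for `b = 0` they are
  -- bounded by the registers.
  rcases Nat.eq_zero_or_pos b with rfl | hb0
  · have hU : P ≤ U := by simpa [address] using hU
    refine Wp.assume fun hbd _ => ?_
    have hD := hbd.reg d
    have hA := hbd.reg a
    rw [hd] at hD
    rw [ha] at hA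
    have e : address 0 T D A P = P := by simp [address]
    rw [e] at hQ
    refine Wp.seq (τ := 1) (τ' := 5) (Wp.mul ?_ (Wp.seq (τ := 1) (τ' := 4) (Wp.add ?_
      (Wp.seq (τ := 1) (τ' := 3) (Wp.mul ?_ (Wp.seq (τ := 1) (τ' := 2) (Wp.add ?_
        (Wp.seq (τ := 1) (τ' := 1) (Wp.mul ?_ (Wp.add ?_ ?_))))))))))
    all_goals
      simp only [State.setReg_setReg, State.setReg_reg, if_true, if_neg hxd.symm, if_neg hxa.symm,
        if_neg hxp.symm, if_neg hxb.symm, hb, ht, hd, ha, hp, mul_zero, zero_add]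
    all_goals first | assumption | exact Nat.zero_le _
  · have h3 : ((T * b + D) * b + A) * b + P ≤ U := hU
    have h2 : ((T * b + D) * b + A) * b ≤ U := by omega
    have h1 : (T * b + D) * b + A ≤ U := (Nat.le_mul_of_pos_right _ hb0).trans h2
    have h0 : (T * b + D) * b ≤ U := by omega
    have h0' : T * b + D ≤ U := (Nat.le_mul_of_pos_right _ hb0).trans h0
    refine Wp.seq (τ := 1) (τ' := 5) (Wp.mul ?_ (Wp.seq (τ := 1) (τ' := 4) (Wp.add ?_
      (Wp.seq (τ := 1) (τ' := 3) (Wp.mul ?_ (Wp.seq (τ := 1) (τ' := 2) (Wp.add ?_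
        (Wp.seq (τ := 1) (τ' := 1) (Wp.mul ?_ (Wp.add ?_ ?_))))))))))
    all_goals
      simp only [State.setReg_setReg, State.setReg_reg, if_true, if_neg hxd.symm, if_neg hxa.symm,
        if_neg hxp.symm, if_neg hxb.symm, hb, ht, hd, ha, hp]
    all_goals first | assumption | omega

/-- Read a table entry. -/
def fetch (v t d a p : ℕ) : Program := locate v t d a p ;; .instr (.load v v)

theorem fetch_wp {v t d a p T D A P : ℕ} {Q : State → Prop} (hb : s.reg rBase = b)
    (ht : s.reg t = T) (hd : s.reg d = D) (ha : s.reg a = A) (hp : s.reg p = P)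
    (hv : v ≠ d ∧ v ≠ a ∧ v ≠ p ∧ v ≠ rBase) (hU : address b T D A P ≤ U)
    (hQ : Q (s.setReg v (s.mem (address b T D A P)))) : Wp U (fetch v t d a p) s 7 Q := by
  refine Wp.seq (τ := 6) (τ' := 1) (locate_wp hb ht hd ha hp hv hU (Wp.load ?_))
  simpa [State.setReg_setReg] using hQ

/-- Write a table entry; the register `rS` is used. -/
def put (t d a p v : ℕ) : Program := locate rS t d a p ;; .instr (.store rS v)

theorem put_wp {v t d a p T D A P V : ℕ} {Q : State → Prop} (hb : s.reg rBase = b)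
    (ht : s.reg t = T) (hd : s.reg d = D) (ha : s.reg a = A) (hp : s.reg p = P)
    (hv : s.reg v = V)
    (hS : rS ≠ d ∧ rS ≠ a ∧ rS ≠ p ∧ rS ≠ rBase) (hSv : v ≠ rS) (hU : address b T D A P ≤ U)
    (hQ : Q ((s.setReg rS (address b T D A P)).setMem (address b T D A P) V)) :
    Wp U (put t d a p v) s 7 Q := by
  refine Wp.seq (τ := 6) (τ' := 1) (locate_wp hb ht hd ha hp hS hU (Wp.store ?_))
  simpa [hSv, hv] using hQ

/-! ### Deletion of a row -/

/-- The exchange relation, for the entry `(a, p)` of the next layer. -/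
def exchange : Program :=
  fetch rX rTag rDPred rA rPPred ;; fetch rY rTag rD rASucc rP ;; combine .mul rX rX rY ;;
    fetch rY rTag rDPred rASucc rPPred ;; fetch rZ rTag rD rA rP ;; combine .mul rY rY rZ ;;
    plus rV rX rY ;; fetch rX rTag rD rASucc rPPred ;; combine .div rV rV rX

/-- In the application `u₁` and `u₂` are shorter windows from the new layer `d - 1`, and `v₁`, `v₂`,
`w` are windows from the old layer `d`. The 55 steps are five table accesses (7 each) and four
operations (5 each). -/
theorem exchange_wp {t d a p : ℕ} {u₁ v₁ u₂ v₂ w : RatField k} (hs : Env k b s)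
    (hU : 5 * b ^ 3 ≤ U) (ht : t ≤ 4) (hd : d < b) (ha : a + 1 < b) (hp : p < b)
    (rt : s.reg rTag = t) (rd : s.reg rD = d) (rd' : s.reg rDPred = d - 1) (rp : s.reg rP = p)
    (rp' : s.reg rPPred = p - 1) (ra : s.reg rA = a) (ra' : s.reg rASucc = a + 1)
    (hu₁ : Represents s.out (s.mem (address b t (d - 1) a (p - 1))) u₁)
    (hv₁ : Represents s.out (s.mem (address b t d (a + 1) p)) v₁)
    (hu₂ : Represents s.out (s.mem (address b t (d - 1) (a + 1) (p - 1))) u₂)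
    (hv₂ : Represents s.out (s.mem (address b t d a p)) v₂)
    (hw : Represents s.out (s.mem (address b t d (a + 1) (p - 1))) w) :
    Wp U exchange s 55 fun s' => Env k b s' ∧
      Represents s'.out (s'.reg rV) ((u₁ * v₁ + u₂ * v₂) / w) ∧ s'.mem = s.mem := by
  have hA : ∀ {d' a' p'}, d' < b → a' < b → p' < b → address b t d' a' p' ≤ U :=
    fun h1 h2 h3 => (address_lt ht h1 h2 h3).le.trans hU
  have hd' : d - 1 < b := by omega
  have hp' : p - 1 < b := by omega
  have ha0 : a < b := by omega
  refine Wp.seq (τ := 7) (τ' := 48) (fetch_wp hs.regBase rt rd' ra rp' (by decide)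
    (hA hd' ha0 hp') ?_)
  have hs := hs.setReg (r := rX) (by decide) (s.mem (address b t (d - 1) a (p - 1)))
  refine Wp.seq (τ := 7) (τ' := 41) (fetch_wp hs.regBase (by simpa using rt) (by simpa using rd)
    (by simpa using ra') (by simpa using rp) (by decide) (hA hd ha hp) ?_)
  have hs := hs.setReg (r := rY) (by decide) (s.mem (address b t d (a + 1) p))
  refine Wp.seq (τ := 5) (τ' := 36) ((combine_wp hs (by decide) (by simpa using hu₁)
    (by simpa using hv₁) (.inl ⟨rfl, rfl⟩)).mono le_rfl fun s₁ h₁ => ?_)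
  have r₁ : ∀ x, x ≠ rX → x ≠ rY → x ≠ rGate → s₁.reg x = s.reg x := fun x h h' h'' => by
    rw [h₁.reg x h h'']; simp [h, h']
  have m₁ : s₁.mem = s.mem := h₁.mem
  have o₁ : s.out <+: s₁.out := h₁.out
  have c₁ := h₁.represents
  refine Wp.seq (τ := 7) (τ' := 29) (fetch_wp h₁.env.regBase ((r₁ _ (by decide) (by decide)
    (by decide)).trans rt) ((r₁ _ (by decide) (by decide) (by decide)).trans rd')
    ((r₁ _ (by decide) (by decide) (by decide)).trans ra')
    ((r₁ _ (by decide) (by decide) (by decide)).trans rp') (by decide) (hA hd' ha hp') ?_)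
  have hs := h₁.env.setReg (r := rY) (by decide) (s₁.mem (address b t (d - 1) (a + 1) (p - 1)))
  have q₁ : ∀ x v, x ≠ rX → x ≠ rY → x ≠ rGate → (s₁.setReg rY v).reg x = s.reg x :=
    fun x v h h' h'' => by rw [State.setReg_reg, if_neg h', r₁ x h h' h'']
  refine Wp.seq (τ := 7) (τ' := 22) (fetch_wp hs.regBase ((q₁ _ _ (by decide) (by decide)
    (by decide)).trans rt) ((q₁ _ _ (by decide) (by decide) (by decide)).trans rd)
    ((q₁ _ _ (by decide) (by decide) (by decide)).trans ra)
    ((q₁ _ _ (by decide) (by decide) (by decide)).trans rp) (by decide) (hA hd ha0 hp) ?_)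
  have hs := hs.setReg (r := rZ) (by decide) (s₁.mem (address b t d a p))
  refine Wp.seq (τ := 5) (τ' := 17) ((combine_wp hs (y := u₂) (z := v₂) (by decide)
    (by simpa [m₁] using hu₂.mono o₁) (by simpa [m₁] using hv₂.mono o₁)
    (.inl ⟨rfl, rfl⟩)).mono le_rfl fun s₂ h₂ => ?_)
  have r₂ : ∀ x, x ≠ rX → x ≠ rY → x ≠ rZ → x ≠ rGate → s₂.reg x = s.reg x :=
    fun x h h' h'' h3 => by
      rw [h₂.reg x h' h3, State.setReg_reg, if_neg h'', q₁ x _ h h' h3]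
  have m₂ : s₂.mem = s.mem := h₂.mem.trans m₁
  have o₂ : s₁.out <+: s₂.out := h₂.out
  have c₂ : Represents s₂.out (s₂.reg rX) (u₁ * v₁) := by
    rw [h₂.reg rX (by decide) (by decide)]
    simpa using c₁.mono o₂
  refine Wp.seq (τ := 5) (τ' := 12) ((plus_wp h₂.env (r := rV) (by decide) c₂
    h₂.represents).mono le_rfl fun s₃ h₃ => ?_)
  have r₃ : ∀ x, x ≠ rX → x ≠ rY → x ≠ rZ → x ≠ rGate → x ≠ rV → s₃.reg x = s.reg x :=
    fun x h h' h'' h3 h4 => by rw [h₃.reg x h4 h3, r₂ x h h' h'' h3]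
  have m₃ : s₃.mem = s.mem := h₃.mem.trans m₂
  have o₃ : s.out <+: s₃.out := (o₁.trans o₂).trans h₃.out
  refine Wp.seq (τ := 7) (τ' := 5) (fetch_wp h₃.env.regBase
    ((r₃ _ (by decide) (by decide) (by decide) (by decide) (by decide)).trans rt)
    ((r₃ _ (by decide) (by decide) (by decide) (by decide) (by decide)).trans rd)
    ((r₃ _ (by decide) (by decide) (by decide) (by decide) (by decide)).trans ra')
    ((r₃ _ (by decide) (by decide) (by decide) (by decide) (by decide)).trans rp')
    (by decide) (hA hd ha hp') ?_)
  have hs := h₃.env.setReg (r := rX) (by decide) (s₃.mem (address b t d (a + 1) (p - 1)))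
  refine (combine_wp hs (r := rV) (y := u₁ * v₁ + u₂ * v₂) (z := w) (by decide)
    (by simpa using h₃.represents) (by simpa [m₃] using hw.mono o₃)
    (.inr ⟨rfl, rfl⟩)).mono le_rfl fun s₄ h₄ => ?_
  exact ⟨h₄.env, h₄.represents, h₄.mem.trans m₃⟩

/-- Compute the entry `(a, p)` of the next layer. -/
def cell : Program :=
  .instr (.add rASucc rA rOne) ;;
    .ifLt rW rD
      (.instr (.add rS rA rP) ;;
        .ifLt rS rD (fetch rV rTag rD rA rP)
          (.ifLt rASucc rD exchange (fetch rV rTag rD rASucc rP)))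
      (fetch rV rTag rD rA rP) ;;
    put rTag rDPred rA rP rV

/-- Whenever a minor in the denominator of the exchange relation vanishes, so does the minor that
is to be computed. -/
def IsExchangeable (k : ℕ) (M : ℕ → ℕ → RatField k) : Prop :=
  ∀ ρ : ℕ → ℕ, StrictMono ρ → 0 < ρ 0 → ∀ a p e, p ≤ k → rowMinor M ρ (a + 1) (p - 1) = 0 →
    rowMinor M (fun j => ρ (skip e j)) a p = 0

/-- The entries `(a, p)` with `dom a p` of the layer `d` of the table `t` represent the flag
minors of `M` with the rows `ρ`. -/
def IsTable (k b t : ℕ) (M : ℕ → ℕ → RatField k) (s : State) (d : ℕ) (ρ : ℕ → ℕ)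
    (dom : ℕ → ℕ → Prop) : Prop :=
  ∀ a p, dom a p → 1 ≤ p → p ≤ k →
    Represents s.out (s.mem (address b t d a p)) (rowMinor M ρ a p)

/-- The deleted row `d` has position `d - 1`. A window that ends before it is copied, one that
starts at it is copied with the start shifted by one, and one that jumps over it needs the exchange
relation. If the row `d` is kept, the whole layer is copied. -/
theorem cell_wp {t d a p w : ℕ} {M : ℕ → ℕ → RatField k} (hM : IsExchangeable k M)
    {ρ ρ' : ℕ → ℕ} (hρ : StrictMono ρ) (hρ0 : 0 < ρ 0) (hs : Env k b s)
    (hU : 5 * b ^ 3 ≤ U) (ht : t ≤ 4) (hkb : k < b) (hd : d < b) (ha : a < d) (hp1 : 1 ≤ p)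
    (hp : p ≤ k)
    (rt : s.reg rTag = t) (rd : s.reg rD = d) (rd' : s.reg rDPred = d - 1) (rp : s.reg rP = p)
    (rp' : s.reg rPPred = p - 1) (ra : s.reg rA = a) (rw' : s.reg rW = w)
    (hold : IsTable k b t M s d ρ fun a' _ => a' ≤ d)
    (hnew : IsTable k b t M s (d - 1) ρ' fun a' p' => a' ≤ d - 1 ∧ p' < p)
    (hcase : (w < d ∧ ρ' = fun j => ρ (skip (d - 1) j)) ∨ (¬ w < d ∧ ρ' = ρ)) :
    Wp U cell s 67 fun s' => Env k b s' ∧ ∃ v,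
      s'.mem = (s.setMem (address b t (d - 1) a p) v).mem ∧
        Represents s'.out v (rowMinor M ρ' a p) := by
  refine Wp.assume fun hbd _ => ?_
  have hA : ∀ {d' a' p'}, d' < b → a' < b → p' < b → address b t d' a' p' ≤ U :=
    fun h1 h2 h3 => (address_lt ht h1 h2 h3).le.trans hU
  have hbU : 5 * b ≤ U := le_trans (Nat.mul_le_mul_left 5 (Nat.le_self_pow (by decide) b)) hU
  have hd' : d - 1 < b := by omega
  have ha0 : a < b := by omega
  have ha1 : a + 1 < b := by omega
  have hpb : p < b := by omega
  refine Wp.seq (τ := 1) (τ' := 66) (Wp.add (by rw [ra, hs.regOne]; omega) ?_)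
  rw [ra, hs.regOne]
  have hs := hs.setReg (r := rASucc) (by decide) (a + 1)
  set s₀ := s.setReg rASucc (a + 1) with hs₀
  have r₀ : ∀ x, x ≠ rASucc → s₀.reg x = s.reg x := fun x h => by simp [hs₀, h]
  have rA₀ : s₀.reg rASucc = a + 1 := by simp [hs₀]
  have copy : ∀ (a' : ℕ) (ra : ℕ) (s₁ : State) (τ : ℕ), 7 ≤ τ → s₁.mem = s.mem → s₁.out = s.out →
      (∀ x, x ≠ rASucc → x ≠ rS → s₁.reg x = s.reg x) → Env k b s₁ → s₁.reg ra = a' → a' ≤ d →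
      ra ≠ rV → rowMinor M ρ a' p = rowMinor M ρ' a p →
      Wp U (fetch rV rTag rD ra rP) s₁ τ fun s' => Env k b s' ∧
        Represents s'.out (s'.reg rV) (rowMinor M ρ' a p) ∧ s'.mem = s.mem := by
    intro a' ra s₁ τ hτ hm ho hr he hra hle hne heq
    refine (fetch_wp he.regBase ((hr _ (by decide) (by decide)).trans rt)
      ((hr _ (by decide) (by decide)).trans rd) hra ((hr _ (by decide) (by decide)).trans rp)
      ⟨by decide, hne.symm, by decide, by decide⟩ (hA hd (by omega) hpb) ?_).mono hτ fun _ h => h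
    refine ⟨he.setReg (by decide) _, ?_, hm⟩
    rw [← heq]
    simpa [hm, ho] using hold a' p hle hp1 hp
  have hvalue : Wp U (.ifLt rW rD
      (.instr (.add rS rA rP) ;;
        .ifLt rS rD (fetch rV rTag rD rA rP)
          (.ifLt rASucc rD exchange (fetch rV rTag rD rASucc rP)))
      (fetch rV rTag rD rA rP)) s₀ 59 fun s' => Env k b s' ∧
        Represents s'.out (s'.reg rV) (rowMinor M ρ' a p) ∧ s'.mem = s.mem := by
    refine Wp.ifLt (τ := 58) (fun hw => ?_) fun hw => ?_
    · rw [r₀ rW (by decide), r₀ rD (by decide), rw', rd] at hw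
      obtain rfl : ρ' = fun j => ρ (skip (d - 1) j) := by
        rcases hcase with h | h
        · exact h.2
        · exact absurd hw h.1
      refine Wp.seq (τ := 1) (τ' := 57) (Wp.add ?_ ?_)
      · rw [r₀ rA (by decide), r₀ rP (by decide), ra, rp]; omega
      rw [r₀ rA (by decide), r₀ rP (by decide), ra, rp]
      have hs := hs.setReg (r := rS) (by decide) (a + p)
      set s₁ := s₀.setReg rS (a + p) with hs₁
      have r₁ : ∀ x, x ≠ rASucc → x ≠ rS → s₁.reg x = s.reg x := fun x h h' => by
        rw [← r₀ x h, hs₁, State.setReg_reg, if_neg h']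
      have rA₁ : s₁.reg rASucc = a + 1 := rA₀
      have rS₁ : s₁.reg rS = a + p := by simp [hs₁]
      refine Wp.ifLt (τ := 56) (fun h => ?_) fun h => Wp.ifLt (τ := 55) (fun h' => ?_) fun h' => ?_
      · rw [rS₁, r₁ rD (by decide) (by decide), rd] at h
        refine copy a rA s₁ 56 (by omega) rfl rfl r₁ hs ((r₁ _ (by decide) (by decide)).trans ra)
          (by omega) (by decide) (rowMinor_congr fun r hr => ?_)
        rw [skip, if_pos (by omega)]
      · rw [rS₁, r₁ rD (by decide) (by decide), rd] at h
        rw [rA₁, r₁ rD (by decide) (by decide), rd] at h'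
        -- Here `a + p ≥ d` and `a + 1 < d`, so `p ≥ 2`; the windows of length `p - 1` are nonempty
        -- and present in the tables.
        refine (exchange_wp (p := p) (d := d) (a := a) hs hU ht hd (by omega) hpb
          ((r₁ _ (by decide) (by decide)).trans rt) ((r₁ _ (by decide) (by decide)).trans rd)
          ((r₁ _ (by decide) (by decide)).trans rd') ((r₁ _ (by decide) (by decide)).trans rp)
          ((r₁ _ (by decide) (by decide)).trans rp') ((r₁ _ (by decide) (by decide)).trans ra) rA₁
          (hnew a (p - 1) ⟨by omega, by omega⟩ (by omega) (by omega))
          (hold (a + 1) p (by omega) hp1 hp)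
          (hnew (a + 1) (p - 1) ⟨by omega, by omega⟩ (by omega) (by omega))
          (hold a p (by omega) hp1 hp)
          (hold (a + 1) (p - 1) (by omega) (by omega) (by omega))).mono le_rfl ?_
        rintro s' ⟨he, hr, hm⟩
        refine ⟨he, ?_, hm⟩
        -- With a zero denominator the machine returns zero, which is correct by `IsExchangeable`.
        by_cases h0 : rowMinor M ρ (a + 1) (p - 1) = 0
        · rw [hM ρ hρ hρ0 a p (d - 1) hp h0]
          rwa [h0, div_zero] at hr
        · rwa [rowMinor_exchange M ρ (by omega) (by omega) h0]
      · rw [rA₁, r₁ rD (by decide) (by decide), rd] at h'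
        refine copy (a + 1) rASucc s₁ 55 (by omega) rfl rfl r₁ hs rA₁ (by omega) (by decide)
          (rowMinor_congr fun r hr => ?_)
        rw [skip, if_neg (by omega)]
        congr 1
        omega
    · rw [r₀ rW (by decide), r₀ rD (by decide), rw', rd] at hw
      obtain rfl : ρ' = ρ := by
        rcases hcase with h | h
        · exact absurd h.1 hw
        · exact h.2
      exact copy a rA s₀ 58 (by omega) rfl rfl (fun x h _ => r₀ x h) hs
        ((r₀ _ (by decide)).trans ra) (by omega) (by decide) rfl
  refine Wp.seq (τ := 59) (τ' := 7) (hvalue.frame.mono le_rfl ?_)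
  rintro s₁ ⟨⟨he, hr, hm⟩, hf, -⟩
  have r₁ : ∀ x, x ∈ [rTag, rDPred, rA, rP] → s₁.reg x = s.reg x := by
    intro x hx
    rw [hf x (by revert x; decide), r₀ x (by rintro rfl; revert hx; decide)]
  refine put_wp he.regBase ((r₁ _ (by decide)).trans rt) ((r₁ _ (by decide)).trans rd')
    ((r₁ _ (by decide)).trans ra) ((r₁ _ (by decide)).trans rp) rfl (by decide) (by decide)
    (hA hd' ha0 hpb) ?_
  refine ⟨(he.setReg (by decide) _).setMem _ _, s₁.reg rV, ?_, hr⟩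
  simp only [State.setMem, State.setReg_mem, hm]

end Programs

/-! ### Filling a layer of windows -/

section Deletion

variable {k b U : ℕ} {s : State}

theorem IsTable.congr {t d : ℕ} {M : ℕ → ℕ → RatField k} {s s' : State} {ρ : ℕ → ℕ}
    {dom dom' : ℕ → ℕ → Prop} (h : IsTable k b t M s d ρ dom) (ho : s.out <+: s'.out)
    (hm : ∀ a p, dom' a p → 1 ≤ p → p ≤ k → dom a p ∧
      s'.mem (address b t d a p) = s.mem (address b t d a p)) :
    IsTable k b t M s' d ρ dom' := by
  intro a p hap h1 h2
  obtain ⟨h3, h4⟩ := hm a p hap h1 h2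
  rw [h4]
  exact (h a p h3 h1 h2).mono ho

/-- Compute the entries of the next layer with a given `p`. -/
def rowLoop : Program :=
  .instr (.set rA 0) ;; .whileLt rA rD (cell ;; .instr (.add rA rA rOne))

/-- The memory of the two states differs at most in the layers below `N` of the table `t`. -/
def SameOutside (k b t N : ℕ) (s s' : State) : Prop :=
  ∀ x, (∀ d a p, d < N → a < b → p ≤ k → x ≠ address b t d a p) → s'.mem x = s.mem x

/-- Only shorter windows of the new layer are needed, so the order within a fixed length `p` is
irrelevant. Writes go to the layer `d - 1`, so the old layer stays intact. -/
theorem rowLoop_wp {t d p w : ℕ} {M : ℕ → ℕ → RatField k} (hM : IsExchangeable k M)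
    {ρ ρ' : ℕ → ℕ} (hρ : StrictMono ρ) (hρ0 : 0 < ρ 0) (hs : Env k b s)
    (hU : 5 * b ^ 3 ≤ U) (ht : t ≤ 4) (hkb : k < b) (hd : d < b) (hd0 : 0 < d) (hp1 : 1 ≤ p)
    (hp : p ≤ k)
    (rt : s.reg rTag = t) (rd : s.reg rD = d) (rd' : s.reg rDPred = d - 1) (rp : s.reg rP = p)
    (rp' : s.reg rPPred = p - 1) (rw' : s.reg rW = w)
    (hold : IsTable k b t M s d ρ fun a' _ => a' ≤ d)
    (hnew : IsTable k b t M s (d - 1) ρ' fun a' p' => a' ≤ d - 1 ∧ p' < p)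
    (hcase : (w < d ∧ ρ' = fun j => ρ (skip (d - 1) j)) ∨ (¬ w < d ∧ ρ' = ρ)) :
    Wp U rowLoop s (69 * d + 2) fun s' => Env k b s' ∧
      IsTable k b t M s' d ρ (fun a' _ => a' ≤ d) ∧
      IsTable k b t M s' (d - 1) ρ' (fun a' p' => a' ≤ d - 1 ∧ p' < p + 1) ∧
      SameOutside k b t d s s' := by
  have hbU : 5 * b ≤ U := le_trans (Nat.mul_le_mul_left 5 (Nat.le_self_pow (by decide) b)) hU
  let I : ℕ → State → Prop := fun j s' => Env k b s' ∧ s'.reg rA = j ∧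
    (∀ x ∈ [rTag, rD, rDPred, rP, rPPred, rW], s'.reg x = s.reg x) ∧
    IsTable k b t M s' d ρ (fun a' _ => a' ≤ d) ∧
    IsTable k b t M s' (d - 1) ρ' (fun a' p' => a' ≤ d - 1 ∧ (p' < p ∨ p' = p ∧ a' < j)) ∧
    SameOutside k b t d s s'
  refine (Wp.seq (τ := 1) (τ' := (d - 0) * (68 + 1) + 1) (Wp.set (Nat.zero_le _)
    (Wp.whileLt_up I d ?_ ?_ ?_ 0 (Nat.zero_le _) ?_))).mono (by omega) fun _ h => h
  · rintro j s' ⟨_, h1, h2, _⟩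
    exact ⟨h1, (h2 _ (by decide)).trans rd⟩
  · rintro j s' hj ⟨he, h1, h2, h3, h4, h5⟩
    have hc := cell_wp (a := j) (p := p) (w := w) hM hρ hρ0 he hU ht hkb hd hj hp1 hp
      ((h2 _ (by decide)).trans rt) ((h2 _ (by decide)).trans rd) ((h2 _ (by decide)).trans rd')
      ((h2 _ (by decide)).trans rp) ((h2 _ (by decide)).trans rp') h1
      ((h2 _ (by decide)).trans rw') h3
      (h4.congr List.prefix_rfl fun a' p' h _ _ => ⟨⟨h.1, .inl h.2⟩, rfl⟩) hcase
    refine Wp.seq (τ := 67) (τ' := 1) (hc.frame.mono le_rfl ?_)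
    rintro s₁ ⟨⟨he₁, v, hm, hr⟩, hf, ho⟩
    have hj₁ : s₁.reg rA = j := (hf _ (by decide)).trans h1
    refine Wp.add (by rw [hj₁, he₁.regOne]; omega) ?_
    rw [hj₁, he₁.regOne]
    have hmem : ∀ x, s₁.mem x = if x = address b t (d - 1) j p then v else s'.mem x := by
      intro x; rw [hm, State.setMem_mem]
    refine ⟨he₁.setReg (by decide) _, by simp, ?_, ?_, ?_, ?_⟩
    · intro x hx
      rw [State.setReg_reg, if_neg (by rintro rfl; revert hx; decide), hf x (by revert x; decide),
        h2 x hx]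
    · refine h3.congr ho fun a' p' h _ hp' => ⟨h, ?_⟩
      rw [State.setReg_mem, hmem, if_neg]
      intro h
      have := (address_inj hd (by omega) (by omega) (by omega) (by omega) (by omega) h).2.1
      omega
    · intro a' p' ⟨ha', hp'⟩ h1' h2'
      rw [State.setReg_mem, State.setReg_out, hmem]
      split_ifs with h
      · obtain ⟨-, -, rfl, rfl⟩ := address_inj (by omega) (by omega) (by omega) (by omega)
          (by omega) (by omega) h
        exact hr
      · refine (h4 a' p' ⟨ha', ?_⟩ h1' h2').mono ho
        rcases hp' with hp' | ⟨rfl, hlt⟩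
        · exact .inl hp'
        · refine .inr ⟨rfl, lt_of_le_of_ne (Nat.lt_succ_iff.1 hlt) ?_⟩
          rintro rfl
          exact h rfl
    · intro x hx
      rw [State.setReg_mem, hmem, if_neg (hx _ _ _ (by omega) (by omega) hp), h5 x hx]
  · rintro s' ⟨he, h1, h2, h3, h4, h5⟩
    exact ⟨he, h3, h4.congr List.prefix_rfl fun a' p' h _ _ => ⟨⟨h.1, by omega⟩, rfl⟩, h5⟩
  · refine ⟨hs.setReg (by decide) _, by simp, ?_, hold, ?_, fun _ _ => rfl⟩
    · intro x hx
      rw [State.setReg_reg, if_neg (by rintro rfl; revert hx; decide)]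
    · exact hnew.congr List.prefix_rfl fun a' p' h _ _ => ⟨⟨h.1, by omega⟩, rfl⟩

/-- Compute the next layer. -/
def colLoop : Program :=
  .instr (.set rP 1) ;; .whileLt rP rKSucc
    (.instr (.sub rPPred rP rOne) ;; rowLoop ;; .instr (.add rP rP rOne))

theorem colLoop_wp {t d w : ℕ} {M : ℕ → ℕ → RatField k} (hM : IsExchangeable k M)
    {ρ ρ' : ℕ → ℕ} (hρ : StrictMono ρ) (hρ0 : 0 < ρ 0) (hs : Env k b s)
    (hU : 5 * b ^ 3 ≤ U) (ht : t ≤ 4) (hkb : k < b) (hd : d < b) (hd0 : 0 < d)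
    (rt : s.reg rTag = t) (rd : s.reg rD = d) (rd' : s.reg rDPred = d - 1) (rw' : s.reg rW = w)
    (hold : IsTable k b t M s d ρ fun a' _ => a' ≤ d)
    (hcase : (w < d ∧ ρ' = fun j => ρ (skip (d - 1) j)) ∨ (¬ w < d ∧ ρ' = ρ)) :
    Wp U colLoop s (k * (69 * d + 5) + 2) fun s' => Env k b s' ∧
      IsTable k b t M s' (d - 1) ρ' (fun a' _ => a' ≤ d - 1) ∧ SameOutside k b t d s s' := by
  have hbU : 5 * b ≤ U := le_trans (Nat.mul_le_mul_left 5 (Nat.le_self_pow (by decide) b)) hU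
  let I : ℕ → State → Prop := fun j s' => Env k b s' ∧ s'.reg rP = j ∧ 1 ≤ j ∧
    (∀ x ∈ [rTag, rD, rDPred, rW], s'.reg x = s.reg x) ∧
    IsTable k b t M s' d ρ (fun a' _ => a' ≤ d) ∧
    IsTable k b t M s' (d - 1) ρ' (fun a' p' => a' ≤ d - 1 ∧ p' < j) ∧ SameOutside k b t d s s'
  refine (Wp.seq (τ := 1) (τ' := (k + 1 - 1) * ((1 + ((69 * d + 2) + 1)) + 1) + 1)
    (Wp.set (by omega) (Wp.whileLt_up I (k + 1) ?_ ?_ ?_ 1 (by omega) ?_))).mono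
    (by rw [Nat.add_sub_cancel, show 1 + (69 * d + 2 + 1) + 1 = 69 * d + 5 by omega]; omega)
    fun _ h => h
  · rintro j s' ⟨he, h1, _⟩
    exact ⟨h1, he.regKSucc⟩
  · rintro j s' hj ⟨he, h1, hj1, h2, h3, h4, h5⟩
    refine Wp.seq (Wp.sub ?_)
    rw [h1, he.regOne]
    have he := he.setReg (r := rPPred) (by decide) (j - 1)
    have hc := rowLoop_wp (p := j) (w := w) hM hρ hρ0 he hU ht hkb hd hd0 hj1 (by omega)
      ((h2 _ (by decide)).trans rt) ((h2 _ (by decide)).trans rd) ((h2 _ (by decide)).trans rd')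
      h1 (by simp) ((h2 _ (by decide)).trans rw') h3 h4 hcase
    refine Wp.seq (hc.frame.mono le_rfl ?_)
    rintro s₁ ⟨⟨he₁, ht₁, ht₂, hm⟩, hf, ho⟩
    have hj₁ : s₁.reg rP = j := (hf _ (by decide)).trans h1
    refine Wp.add (by rw [hj₁, he₁.regOne]; omega) ?_
    rw [hj₁, he₁.regOne]
    refine ⟨he₁.setReg (by decide) _, by simp, by omega, ?_, ht₁, ht₂, ?_⟩
    · intro x hx
      rw [State.setReg_reg, if_neg (by rintro rfl; revert hx; decide), hf x (by revert x; decide),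
        State.setReg_reg, if_neg (by rintro rfl; revert hx; decide), h2 x hx]
    · intro x hx
      exact (hm x hx).trans (h5 x hx)
  · rintro s' ⟨he, h1, _, h2, h3, h4, h5⟩
    exact ⟨he, h4.congr List.prefix_rfl fun a' p' h _ h' => ⟨⟨h, by omega⟩, rfl⟩, h5⟩
  · refine ⟨hs.setReg (by decide) _, by simp, le_rfl, ?_, hold, ?_, fun _ _ => rfl⟩
    · intro x hx
      rw [State.setReg_reg, if_neg (by rintro rfl; revert hx; decide)]
    · rintro a' p' ⟨_, h⟩ h1 h2
      omega

/-! ### Deletion of all rows outside of a given set -/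

/-- The rows that remain when the rows above `d` that are not values of `W` have been deleted;
`W 1 < ⋯ < W c` are the values of `W` that are at most `d`. -/
def remaining (W : ℕ → ℕ) (c d j : ℕ) : ℕ := if j < d then j + 1 else W (c + 1 + (j - d))

theorem remaining_strictMono {W : ℕ → ℕ} (hW : StrictMono W) {c d : ℕ} (h : d < W (c + 1)) :
    StrictMono (remaining W c d) := by
  intro i j hij
  unfold remaining
  split_ifs
  · omega
  · have := hW.monotone (show c + 1 ≤ c + 1 + (j - d) by omega)
    omega
  · omega
  · exact hW (by omega)

theorem remaining_pos {W : ℕ → ℕ} (hW : StrictMono W) (c d : ℕ) : 0 < remaining W c d 0 := by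
  unfold remaining
  split_ifs
  · omega
  · exact (Nat.zero_le _).trans_lt (hW (show 0 < c + 1 + (0 - d) by omega))

/-- The case in which the row `d` is dropped: it stands at position `d - 1`. -/
theorem remaining_of_lt (W : ℕ → ℕ) (c d : ℕ) (hd : 0 < d) :
    remaining W c (d - 1) = fun j => remaining W c d (skip (d - 1) j) := by
  funext j
  unfold remaining skip
  split_ifs <;> first | omega | (congr 1; omega)

/-- The case in which the row `d` is kept: the list is unchanged, and `d` only moves from the
initial segment to the part described by `W`. -/
theorem remaining_of_eq {W : ℕ → ℕ} {c d : ℕ} (hd : 0 < d) (hc : 0 < c) (h : W c = d) :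
    remaining W (c - 1) (d - 1) = remaining W c d := by
  funext j
  unfold remaining
  split_ifs
  · omega
  · omega
  · obtain rfl : j = d - 1 := by omega
    rw [show c - 1 + 1 + (d - 1 - (d - 1)) = c by omega, h]; omega
  · congr 1; omega

/-- Delete the row `d` if necessary. -/
def deletionStep : Program :=
  fetch rW rTagW rZero rZero rC ;; .instr (.sub rDPred rD rOne) ;; colLoop ;;
    .ifLt rW rD .skip (.instr (.sub rC rC rOne)) ;; .instr (.sub rD rD rOne)

/-- Compute the flag minor with the rows `W 1, …, W k` from the interval flag minors. -/
def deletion : Program :=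
  .instr (.add rC rK rZero) ;; .instr (.add rD rTop rZero) ;; .whileLt rZero rD deletionStep

/-- The number of steps of `deletion`. -/
def deletionTime (k N : ℕ) : ℕ := N * (k * (69 * N + 5) + 14) + 3

/-- `W` continues with all rows above `N`, since windows that start at or below `N` may extend
beyond it. Layers below `N` are scratch space; the top layer survives and can serve again. -/
theorem deletion_wp {t N : ℕ} {M : ℕ → ℕ → RatField k} (hM : IsExchangeable k M) (hs : Env k b s)
    (hU : 5 * b ^ 3 ≤ U) (ht : t ≤ 2) (hk : 0 < k) (hkb : k < b) (hN : N < b)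
    {W : ℕ → ℕ} (hW : StrictMono W) (hW0 : W 0 = 0) (hWk : W k ≤ N)
    (hWN : ∀ j, W (k + 1 + j) = N + 1 + j)
    (rt : s.reg rTag = t) (rtw : s.reg rTagW = t + 2) (rtop : s.reg rTop = N)
    (hmem : ∀ c ≤ k, s.mem (address b (t + 2) 0 0 c) = W c)
    (htable : IsTable k b t M s N Nat.succ fun a _ => a ≤ N) :
    Wp U deletion s (deletionTime k N) fun s' => Env k b s' ∧
      Represents s'.out (s'.mem (address b t 0 0 k)) (rowMinor M (fun r => W (r + 1)) 0 k) ∧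
      SameOutside k b t N s s' := by
  let I : ℕ → State → Prop := fun d s' => Env k b s' ∧ s'.reg rD = d ∧ d ≤ N ∧
    (∀ x ∈ [rTag, rTagW, rTop], s'.reg x = s.reg x) ∧ SameOutside k b t N s s' ∧
    ∃ c ≤ k, s'.reg rC = c ∧ W c ≤ d ∧ d < W (c + 1) ∧
      IsTable k b t M s' d (remaining W c d) fun a _ => a ≤ d
  refine Wp.assume fun hbd _ => ?_
  unfold deletionTime
  rw [show N * (k * (69 * N + 5) + 14) + 3 =
    1 + (1 + (N * ((7 + (1 + ((k * (69 * N + 5) + 2) + ((1 + 1) + 1)))) + 1) + 1)) by ring]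
  refine Wp.seq (Wp.add (by rw [hs.regZero]; exact hbd.reg _) (Wp.seq (Wp.add ?_ ?_)))
  · simp only [State.setReg_reg]
    rw [if_neg (by decide), if_neg (by decide), hs.regZero]; exact hbd.reg _
  simp only [State.setReg_reg]
  rw [if_neg (by decide), if_neg (by decide), hs.regZero, hs.regK, rtop, add_zero, add_zero]
  refine Wp.whileLt I ?_ ?_ ?_ ?_ N ?_
  · rintro r s' ⟨he, h, _⟩
    rw [he.regZero, h]; omega
  · rintro s' ⟨he, h, _⟩
    rw [he.regZero, h]; omega
  · rintro d s' ⟨he, h1, hdN, h2, h3, c, hck, h4, h5, h6, h7⟩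
    have h0b : 0 < b := by omega
    refine Wp.seq (fetch_wp he.regBase ((h2 _ (by decide)).trans rtw) he.regZero he.regZero h4
      (by decide) ((address_lt (by omega) h0b h0b (by omega)).le.trans hU) ?_)
    have hWc : s'.mem (address b (t + 2) 0 0 c) = W c := by
      rw [h3, hmem c hck]
      intro d' a' p' hd' ha' hp' h
      have := (address_inj h0b h0b (by omega) (by omega) ha' (by omega) h).1
      omega
    rw [hWc]
    refine Wp.seq (Wp.sub ?_)
    simp only [State.setReg_reg]
    rw [if_neg (by decide), if_neg (by decide), h1, he.regOne, Nat.add_sub_cancel]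
    have he := (he.setReg (r := rW) (by decide) (W c)).setReg (r := rDPred) (by decide) d
    set s₁ := (s'.setReg rW (W c)).setReg rDPred d with hs₁
    have r₁ : ∀ x, x ≠ rW → x ≠ rDPred → s₁.reg x = s'.reg x := fun x h h' => by
      simp [hs₁, h, h']
    -- The counter is the number of values of `W` that are at most the current layer, so it drops
    -- exactly when the row `d + 1` is kept.
    have hc : ∃ c' ≤ k, c' = (if W c < d + 1 then c else c - 1) ∧ W c' ≤ d ∧ d < W (c' + 1) ∧
        ((W c < d + 1 ∧
          remaining W c' d = fun j => remaining W c (d + 1) (skip (d + 1 - 1) j)) ∨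
          (¬ W c < d + 1 ∧ remaining W c' d = remaining W c (d + 1))) := by
      by_cases h : W c < d + 1
      · refine ⟨c, hck, by rw [if_pos h], by omega, by omega, .inl ⟨h, ?_⟩⟩
        exact remaining_of_lt W c (d + 1) (by omega)
      · have hc0 : 0 < c := by
          rcases Nat.eq_zero_or_pos c with rfl | h
          · omega
          · exact h
        refine ⟨c - 1, by omega, by rw [if_neg h], ?_, ?_, .inr ⟨h, ?_⟩⟩
        · have := hW (show c - 1 < c by omega)
          omega
        · rw [Nat.sub_add_cancel hc0]; omega
        · exact remaining_of_eq (d := d + 1) (by omega) hc0 (by omega)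
    obtain ⟨c', hck', hc', h5', h6', hcase⟩ := hc
    have hcol := colLoop_wp (t := t) (d := d + 1) (w := W c) hM
      (remaining_strictMono hW h6) (remaining_pos hW c (d + 1)) he hU (by omega) hkb (by omega)
      (by omega) ((h2 _ (by decide)).trans rt) h1 (by simp [hs₁]) (by simp [hs₁]) h7 hcase
    refine Wp.seq ((hcol.mono (τ' := k * (69 * N + 5) + 2) ?_ fun _ h => h).frame.mono le_rfl ?_)
    · exact Nat.add_le_add_right (Nat.mul_le_mul_left _ (by omega)) _
    rintro s₂ ⟨⟨he₂, ht₂, hm₂⟩, hf, ho⟩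
    have r₂ : ∀ x ∈ [rTag, rTagW, rTop, rC, rD], s₂.reg x = s'.reg x := by
      intro x hx
      rw [hf x (by revert x; decide)]
      exact r₁ x (by rintro rfl; revert hx; decide) (by rintro rfl; revert hx; decide)
    have hw₂ : s₂.reg rW = W c := by rw [hf _ (by decide)]; simp [hs₁]
    have hm₃ : SameOutside k b t N s s₂ := fun x hx =>
      (hm₂ x fun d' a' p' hd' => hx d' a' p' (by omega)).trans (h3 x hx)
    refine Wp.seq (τ := 1 + 1) (τ' := 1) (Wp.ifLt (fun hlt => ?_) fun hlt => ?_)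
    · rw [hw₂, r₂ _ (by decide), h1] at hlt
      refine (Wp.skip (Wp.sub ?_)).mono (Nat.zero_le _) fun _ h => h
      rw [r₂ _ (by decide), h1, he₂.regOne, Nat.add_sub_cancel]
      refine ⟨he₂.setReg (by decide) _, by simp, by omega, ?_, hm₃, c', hck', ?_, h5', h6', ht₂⟩
      · intro x hx
        rw [State.setReg_reg, if_neg (by rintro rfl; revert hx; decide), r₂ x (by revert x; decide),
          h2 x hx]
      · rw [hc', if_pos hlt, State.setReg_reg, if_neg (by decide), r₂ _ (by decide), h4]
    · rw [hw₂, r₂ _ (by decide), h1] at hlt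
      refine Wp.sub (Wp.sub ?_)
      simp only [State.setReg_reg]
      rw [if_neg (by decide), if_neg (by decide), he₂.regOne, r₂ rC (by decide), r₂ rD (by decide),
        h1, h4, Nat.add_sub_cancel]
      refine ⟨(he₂.setReg (by decide) _).setReg (by decide) _, by simp, by omega, ?_, hm₃, c', hck',
        ?_, h5', h6', ht₂⟩
      · intro x hx
        rw [State.setReg_reg, if_neg (by rintro rfl; revert hx; decide), State.setReg_reg,
          if_neg (by rintro rfl; revert hx; decide), r₂ x (by revert x; decide), h2 x hx]
      · rw [hc', if_neg hlt]; simp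
  · rintro s' ⟨he, h1, hdN, h2, h3, c, hck, h4, h5, h6, h7⟩
    -- At layer `0` only the rows `W 1, W 2, …` are left, and the first window of length `k` is the
    -- desired minor.
    obtain rfl : c = 0 := by
      by_contra hc
      have := hW (Nat.pos_of_ne_zero hc)
      omega
    refine ⟨he, ?_, h3⟩
    have := h7 0 k le_rfl hk le_rfl
    rwa [rowMinor_congr (ρ' := fun r => W (r + 1)) (a' := 0) fun r _ => by
      simp [remaining, add_comm]] at this
  · refine ⟨(hs.setReg (by decide) _).setReg (by decide) _, by simp, le_rfl, ?_, fun _ _ => rfl, k,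
      le_rfl, by simp, hWk, by have := hWN 0; rw [add_zero] at this; omega, ?_⟩
    · intro x hx
      rw [State.setReg_reg, if_neg (by rintro rfl; revert hx; decide), State.setReg_reg,
        if_neg (by rintro rfl; revert hx; decide)]
    · have : remaining W k N = Nat.succ := by
        funext j
        unfold remaining
        split_ifs
        · rfl
        · rw [hWN]; omega
      rw [this]
      exact htable

end Deletion

notation "rN" => (22 : ℕ)
notation "rNSucc" => (23 : ℕ)
notation "rNK" => (24 : ℕ)
notation "rOuterA" => (25 : ℕ)
notation "rOuterP" => (26 : ℕ)

section Schur

variable {k b U : ℕ} {s : State}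

/-! ### The interval flag minors of the first flag matrix -/

/-- The entries `x_p ^ a ⋯ x_1 ^ a` for a given `p`. -/
def monomialColumn : Program :=
  .instr (.set rY 1) ;; .instr (.set rA 0) ;; put rTag rTop rA rP rY ;;
    .whileLt rA rTop (emitTo .mul rY (.gate rY) (.gate rX) ;; .instr (.add rA rA rOne) ;;
      put rTag rTop rA rP rY)

/-- The powers of `x_1 ⋯ x_p`, as the top layer of a table. -/
def monomials : Program :=
  .instr (.set rX 1) ;; .instr (.set rP 1) ;; .whileLt rP rKSucc
    (.instr (.sub rPPred rP rOne) ;; emitTo .mul rX (.gate rX) (.var rPPred) ;; monomialColumn ;;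
      .instr (.add rP rP rOne))

theorem monomialColumn_wp {t p N : ℕ} {y : RatField k} (hs : Env k b s) (hU : 5 * b ^ 3 ≤ U)
    (ht : t ≤ 4) (hkb : k < b) (hN : N < b) (hp : p ≤ k) (rt : s.reg rTag = t)
    (rp : s.reg rP = p) (rtop : s.reg rTop = N) (hx : Represents s.out (s.reg rX) y) (hy : y ≠ 0)
    (hone : Represents s.out 1 (1 : RatField k)) :
    Wp U monomialColumn s (12 * N + 10) fun s' => Env k b s' ∧
      (∀ a ≤ N, Represents s'.out (s'.mem (address b t N a p)) (y ^ a)) ∧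
      ∀ x, (∀ a ≤ N, x ≠ address b t N a p) → s'.mem x = s.mem x := by
  have hbU : 5 * b ≤ U := le_trans (Nat.mul_le_mul_left 5 (Nat.le_self_pow (by decide) b)) hU
  let I : ℕ → State → Prop := fun j s' => Env k b s' ∧ s'.reg rA = j ∧ j ≤ N ∧
    (∀ x ∈ [rTag, rP, rTop, rX], s'.reg x = s.reg x) ∧ s.out <+: s'.out ∧
    Represents s'.out (s'.reg rY) (y ^ j) ∧
    (∀ a ≤ j, Represents s'.out (s'.mem (address b t N a p)) (y ^ a)) ∧
    ∀ x, (∀ a ≤ N, x ≠ address b t N a p) → s'.mem x = s.mem x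
  have hA : ∀ {a'}, a' < b → address b t N a' p ≤ U :=
    fun h => (address_lt ht hN h (by omega)).le.trans hU
  rw [show 12 * N + 10 = 1 + (1 + (7 + ((N - 0) * ((3 + (1 + 7)) + 1) + 1))) by omega]
  refine Wp.seq (Wp.set (by omega) (Wp.seq (Wp.set (Nat.zero_le _) ?_)))
  have hs := (hs.setReg (r := rY) (by decide) 1).setReg (r := rA) (by decide) 0
  refine Wp.seq (put_wp (V := 1) hs.regBase rt rtop (A := 0) (by simp) rp (by simp) (by decide)
    (by decide) (hA (by omega)) (Wp.whileLt_up I N ?_ ?_ ?_ 0 (Nat.zero_le _) ?_))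
  · rintro j s' ⟨_, h1, _, h2, _⟩
    exact ⟨h1, (h2 _ (by decide)).trans rtop⟩
  · rintro j s' hj ⟨he, h1, _, h2, ho, h3, h4, h5⟩
    have hx' := hx.mono ho
    rw [← h2 rX (by decide)] at hx'
    refine Wp.seq ((emitTo_wp he (r := rY) (x := .gate rY) (y := .gate rX) (by decide)
      (.mul (h3.operandValue (h3.pos (pow_ne_zero j hy)))
        (hx'.operandValue (hx'.pos hy)))).mono le_rfl fun s₁ h₁ => ?_)
    have r₁ : ∀ x ∈ [rTag, rP, rTop, rX], s₁.reg x = s.reg x := fun x hx => by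
      rw [h₁.reg x (by rintro rfl; revert hx; decide) (by rintro rfl; revert hx; decide), h2 x hx]
    have hj₁ : s₁.reg rA = j := (h₁.reg _ (by decide) (by decide)).trans h1
    have he₁ := h₁.env
    refine Wp.seq (τ := 1) (τ' := 7) (Wp.add (by rw [hj₁, he₁.regOne]; omega) ?_)
    rw [hj₁, he₁.regOne]
    have he₂ := he₁.setReg (r := rA) (by decide) (j + 1)
    refine put_wp (A := j + 1) he₂.regBase ((r₁ _ (by decide)).trans rt)
      ((r₁ _ (by decide)).trans rtop) (by simp) ((r₁ _ (by decide)).trans rp) rfl (by decide)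
      (by decide) (hA (by omega)) ?_
    refine ⟨(he₂.setReg (by decide) _).setMem _ _, by simp, hj, ?_, ho.trans h₁.out, ?_, ?_, ?_⟩
    · intro x hx
      rw [State.setMem_reg, State.setReg_reg, if_neg (by rintro rfl; revert hx; decide),
        State.setReg_reg, if_neg (by rintro rfl; revert hx; decide), r₁ x hx]
    · rw [pow_succ]; exact h₁.represents
    · intro a ha
      rw [State.setMem_mem]
      split_ifs with h
      · obtain ⟨-, -, rfl, -⟩ := address_inj hN (by omega) (by omega) hN (by omega) (by omega) h
        rw [pow_succ]; exact h₁.represents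
      · have ha' : a ≤ j := by
          by_contra hc
          obtain rfl : a = j + 1 := by omega
          exact h rfl
        rw [State.setReg_mem, State.setReg_mem, h₁.mem]
        exact (h4 a ha').mono h₁.out
    · intro x hx
      rw [State.setMem_mem, if_neg (hx _ (by omega)), State.setReg_mem, State.setReg_mem, h₁.mem,
        h5 x hx]
  · rintro s' ⟨he, h1, _, h2, ho, h3, h4, h5⟩
    exact ⟨he, h4, h5⟩
  · refine ⟨(hs.setReg (by decide) _).setMem _ _, by simp, Nat.zero_le _, ?_, List.prefix_rfl, ?_,
      ?_, ?_⟩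
    · intro x hx
      simp only [List.mem_cons, List.not_mem_nil, or_false] at hx
      rcases hx with rfl | rfl | rfl | rfl <;> simp
    · rw [pow_zero]; simpa using hone
    · intro a ha
      obtain rfl : a = 0 := by omega
      rw [pow_zero]; simpa using hone
    · intro x hx
      rw [State.setMem_mem, if_neg (hx _ (Nat.zero_le _))]; rfl

/-- The flag matrix of the ordinary Schur polynomials, over the rational functions. -/
noncomputable def schurMatrixField (k i c : ℕ) : RatField k :=
  algebraMap (MvPolynomial (Fin k) ℚ) (RatField k) (schurMatrix k i c)

theorem map_rowMinor {R S : Type*} [CommRing R] [CommRing S] (f : R →+* S) (M : ℕ → ℕ → R)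
    (ρ : ℕ → ℕ) (a p : ℕ) : f (rowMinor M ρ a p) = rowMinor (fun i c => f (M i c)) ρ a p := by
  unfold rowMinor leadingMinor
  rw [RingHom.map_det]
  rfl

theorem algebraMap_injective (k : ℕ) :
    Function.Injective (algebraMap (MvPolynomial (Fin k) ℚ) (RatField k)) :=
  IsFractionRing.injective _ _

/-- Vacuous, as flag minors of this matrix never vanish. -/
theorem isExchangeable_schurMatrixField (k : ℕ) : IsExchangeable k (schurMatrixField k) := by
  intro ρ hρ h0 a p e _ h
  unfold schurMatrixField at h
  rw [← map_rowMinor, map_eq_zero_iff _ (algebraMap_injective k)] at h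
  exact absurd h (rowMinor_schurMatrix_ne_zero k hρ h0 _ _)

/-- The number of steps of `monomials`. -/
def monomialsTime (k N : ℕ) : ℕ := k * (12 * N + 16) + 3

/-- The interval minors are powers of `x_1 ⋯ x_p`, so each entry costs one multiplication; the gate
`1` supplies the zeroth powers. -/
theorem monomials_wp {t N : ℕ} (hs : Env k b s) (hU : 5 * b ^ 3 ≤ U)
    (ht : t ≤ 4) (hkb : k < b) (hN : N < b) (rt : s.reg rTag = t) (rtop : s.reg rTop = N)
    (hone : Represents s.out 1 (1 : RatField k)) :
    Wp U monomials s (monomialsTime k N) fun s' => Env k b s' ∧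
      IsTable k b t (schurMatrixField k) s' N Nat.succ (fun a _ => a ≤ N) ∧
      ∀ x, (∀ a p, a ≤ N → p ≤ k → x ≠ address b t N a p) → s'.mem x = s.mem x := by
  have hbU : 5 * b ≤ U := le_trans (Nat.mul_le_mul_left 5 (Nat.le_self_pow (by decide) b)) hU
  let y : ℕ → RatField k := fun p =>
    algebraMap (MvPolynomial (Fin k) ℚ) (RatField k) (∏ l ∈ Finset.range p, xvar k l)
  have hx1 : ∀ l, eval (fun _ => (1 : ℚ)) (xvar k l) = 1 := fun l => by
    unfold xvar; split_ifs <;> simp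
  have hy : ∀ p, y p ≠ 0 := fun p => algebraMap_ne_zero_of_eval_pos (by simp [map_prod, hx1])
  let I : ℕ → State → Prop := fun j s' => Env k b s' ∧ s'.reg rP = j ∧ 1 ≤ j ∧
    (∀ x ∈ [rTag, rTop], s'.reg x = s.reg x) ∧ s.out <+: s'.out ∧
    Represents s'.out (s'.reg rX) (y (j - 1)) ∧
    IsTable k b t (schurMatrixField k) s' N Nat.succ (fun a p => a ≤ N ∧ p < j) ∧
    ∀ x, (∀ a p, a ≤ N → p ≤ k → x ≠ address b t N a p) → s'.mem x = s.mem x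
  unfold monomialsTime
  rw [show k * (12 * N + 16) + 3 =
    1 + (1 + ((k + 1 - 1) * ((1 + (3 + ((12 * N + 10) + 1))) + 1) + 1)) by
      rw [Nat.add_sub_cancel]; ring]
  refine Wp.seq (Wp.set (by omega) (Wp.seq (Wp.set (by omega)
    (Wp.whileLt_up I (k + 1) ?_ ?_ ?_ 1 (by omega) ?_))))
  · rintro j s' ⟨he, h1, _⟩
    exact ⟨h1, he.regKSucc⟩
  · rintro j s' hj ⟨he, h1, hj1, h2, ho, h3, h4, h5⟩
    refine Wp.seq (Wp.sub ?_)
    rw [h1, he.regOne]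
    have he := he.setReg (r := rPPred) (by decide) (j - 1)
    have hvar : OperandValue (values k s'.out)
        (Operand.read (s'.setReg rPPred (j - 1)).reg (.var rPPred))
        (algebraMap (MvPolynomial (Fin k) ℚ) (RatField k) (xvar k (j - 1))) := by
      have hlt : j - 1 < k := by omega
      have := OperandValue.var (vals := values k s'.out) ⟨j - 1, hlt⟩
      simpa [Operand.read, xvar, hlt] using this
    refine Wp.seq ((emitTo_wp he (r := rX) (x := .gate rX) (y := .var rPPred) (by decide)
      (.mul (h3.operandValue (h3.pos (hy _))) hvar)).mono le_rfl fun s₁ h₁ => ?_)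
    have hyj : y (j - 1) * algebraMap (MvPolynomial (Fin k) ℚ) (RatField k) (xvar k (j - 1)) =
        y j := by
      obtain ⟨i, rfl⟩ : ∃ i, j = i + 1 := ⟨j - 1, by omega⟩
      simp only [y, Nat.add_sub_cancel, Finset.prod_range_succ, map_mul]
    have r₁ : ∀ x ∈ [rTag, rTop, rP], s₁.reg x = s'.reg x := fun x hx => by
      rw [h₁.reg x (by rintro rfl; revert hx; decide) (by rintro rfl; revert hx; decide),
        State.setReg_reg, if_neg (by rintro rfl; revert hx; decide)]
    have hX₁ := h₁.represents
    rw [hyj] at hX₁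
    have hcol := monomialColumn_wp (t := t) (N := N) (p := j) h₁.env hU ht hkb hN (by omega)
      ((r₁ _ (by decide)).trans ((h2 _ (by decide)).trans rt)) ((r₁ _ (by decide)).trans h1)
      ((r₁ _ (by decide)).trans ((h2 _ (by decide)).trans rtop)) hX₁ (hy j)
      (hone.mono (ho.trans h₁.out))
    refine Wp.seq (hcol.frame.mono le_rfl ?_)
    rintro s₂ ⟨⟨he₂, hv, hm⟩, hf, ho₂⟩
    have hj₂ : s₂.reg rP = j := (hf _ (by decide)).trans ((r₁ _ (by decide)).trans h1)
    refine Wp.add (by rw [hj₂, he₂.regOne]; omega) ?_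
    rw [hj₂, he₂.regOne]
    refine ⟨he₂.setReg (by decide) _, by simp, by omega, ?_, (ho.trans h₁.out).trans ho₂, ?_, ?_,
      ?_⟩
    · intro x hx
      rw [State.setReg_reg, if_neg (by rintro rfl; revert hx; decide), hf x (by revert x; decide),
        r₁ x (by revert x; decide), h2 x hx]
    · rw [State.setReg_reg, if_neg (by decide), hf _ (by decide), Nat.add_sub_cancel]
      exact hX₁.mono ho₂
    · rintro a p ⟨ha, hp⟩ hp1 hpk
      rw [State.setReg_mem, State.setReg_out]
      rcases Nat.lt_succ_iff_lt_or_eq.1 hp with hp | rfl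
      · rw [hm, h₁.mem]
        · exact (h4 a p ⟨ha, hp⟩ hp1 hpk).mono (h₁.out.trans ho₂)
        · intro a' ha' h
          have := (address_inj hN (by omega) (by omega) hN (by omega) (by omega) h).2.2.2
          omega
      · unfold schurMatrixField
        rw [← map_rowMinor, rowMinor_schurMatrix_interval, map_pow]
        exact hv a ha
    · intro x hx
      rw [State.setReg_mem, hm x fun a ha => hx a j ha (by omega), h₁.mem]
      exact h5 x hx
  · rintro s' ⟨he, h1, _, h2, ho, h3, h4, h5⟩
    exact ⟨he, h4.congr List.prefix_rfl fun a' p' h _ h' => ⟨⟨h, by omega⟩, rfl⟩, h5⟩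
  · refine ⟨(hs.setReg (by decide) _).setReg (by decide) _, by simp, le_rfl, ?_, List.prefix_rfl, ?_,
      ?_, fun _ _ => rfl⟩
    · intro x hx
      simp only [List.mem_cons, List.not_mem_nil, or_false] at hx
      rcases hx with rfl | rfl <;> simp
    · simpa [y] using hone
    · rintro a' p' ⟨_, h⟩ h1 h2
      omega

/-! ### The list of rows -/

/-- Store the numbers that `P` computes in `rY`, for `rC = 1, …, k`, after a `0`. -/
def fill (P : Program) : Program :=
  put rTagW rZero rZero rZero rZero ;; .instr (.set rC 1) ;; .whileLt rC rKSucc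
    (P ;; put rTagW rZero rZero rC rY ;; .instr (.add rC rC rOne))

/-- `P` may use only `rX` and `rY`, so the counter and the constants survive. The entry `0` at
position `0` is the sentinel that `deletion` reads when no row is left to keep. -/
theorem fill_wp {P : Program} {t τ : ℕ} {W : ℕ → ℕ} (hs : Env k b s) (hU : 5 * b ^ 3 ≤ U)
    (ht : t ≤ 4) (hkb : k < b) (rt : s.reg rTagW = t) (hW : W 0 = 0)
    (hP : ∀ x ∈ P.writes, x = rX ∨ x = rY)
    (hbody : ∀ c s', 1 ≤ c → c ≤ k → Env k b s' → s'.reg rC = c →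
      (∀ x ∉ [rX, rY, rS, rC], s'.reg x = s.reg x) →
      (∀ x, (∀ c ≤ k, x ≠ address b t 0 0 c) → s'.mem x = s.mem x) →
      Wp U P s' τ fun s'' => Env k b s'' ∧ s''.reg rY = W c ∧ s''.mem = s'.mem) :
    Wp U (fill P) s (k * (τ + 9) + 9) fun s' => Env k b s' ∧
      (∀ c ≤ k, s'.mem (address b t 0 0 c) = W c) ∧
      ∀ x, (∀ c ≤ k, x ≠ address b t 0 0 c) → s'.mem x = s.mem x := by
  have hbU : 5 * b ≤ U := le_trans (Nat.mul_le_mul_left 5 (Nat.le_self_pow (by decide) b)) hU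
  have hb0 : 0 < b := by omega
  have hA : ∀ {c}, c ≤ k → address b t 0 0 c ≤ U :=
    fun h => (address_lt ht hb0 hb0 (by omega)).le.trans hU
  let I : ℕ → State → Prop := fun j s' => Env k b s' ∧ s'.reg rC = j ∧ 1 ≤ j ∧
    (∀ x ∉ [rX, rY, rS, rC], s'.reg x = s.reg x) ∧
    (∀ c < j, s'.mem (address b t 0 0 c) = W c) ∧
    ∀ x, (∀ c ≤ k, x ≠ address b t 0 0 c) → s'.mem x = s.mem x
  rw [show k * (τ + 9) + 9 = 7 + (1 + ((k + 1 - 1) * ((τ + (7 + 1)) + 1) + 1)) by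
    rw [Nat.add_sub_cancel]; ring]
  refine Wp.seq (put_wp hs.regBase rt hs.regZero hs.regZero hs.regZero hs.regZero (by decide)
    (by decide) (hA (Nat.zero_le _)) (Wp.seq (Wp.set (by omega)
      (Wp.whileLt_up I (k + 1) ?_ ?_ ?_ 1 (by omega) ?_))))
  · rintro j s' ⟨he, h1, _⟩
    exact ⟨h1, he.regKSucc⟩
  · rintro j s' hj ⟨he, h1, hj1, h2, h3, h4⟩
    refine Wp.seq ((hbody j s' hj1 (by omega) he h1 h2 h4).frame.mono le_rfl ?_)
    rintro s₁ ⟨⟨he₁, hY, hm⟩, hf, ho⟩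
    have hC : s₁.reg rC = j := (hf _ fun h => by
      rcases hP _ h with h | h <;> exact absurd h (by decide)).trans h1
    have hf' : ∀ x ∉ [rX, rY, rS, rC], s₁.reg x = s.reg x := by
      intro x hx
      rw [hf x, h2 x hx]
      intro h
      rcases hP x h with rfl | rfl <;> exact hx (by decide)
    refine Wp.seq (τ := 7) (τ' := 1) (put_wp he₁.regBase ((hf' _ (by decide)).trans rt) he₁.regZero he₁.regZero
      hC hY (by decide) (by decide) (hA (by omega)) ?_)
    have he₂ := (he₁.setReg (r := rS) (by decide) (address b t 0 0 j)).setMem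
      (address b t 0 0 j) (W j)
    have hC₂ : ((s₁.setReg rS (address b t 0 0 j)).setMem (address b t 0 0 j) (W j)).reg rC = j := by
      simpa using hC
    refine Wp.add ?_ ?_
    · rw [hC₂, he₂.regOne]; omega
    rw [hC₂, he₂.regOne]
    refine ⟨he₂.setReg (by decide) _, by simp, by omega, ?_, ?_, ?_⟩
    · intro x hx
      rw [State.setReg_reg, if_neg (by rintro rfl; revert hx; decide), State.setMem_reg,
        State.setReg_reg, if_neg (by rintro rfl; revert hx; decide), hf' x hx]
    · intro c hc
      rw [State.setReg_mem, State.setMem_mem]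
      split_ifs with h
      · rw [(address_inj hb0 hb0 (by omega) hb0 hb0 (by omega) h).2.2.2]
      · rw [State.setReg_mem, hm]
        exact h3 c (lt_of_le_of_ne (Nat.lt_succ_iff.1 hc) (by rintro rfl; exact h rfl))
    · intro x hx
      rw [State.setReg_mem, State.setMem_mem, if_neg (hx _ (by omega)), State.setReg_mem, hm, h4 x hx]
  · rintro s' ⟨he, h1, _, h2, h3, h4⟩
    exact ⟨he, fun c hc => h3 c (by omega), h4⟩
  · refine ⟨((hs.setReg (by decide) _).setMem _ _).setReg (by decide) _, by simp, le_rfl, ?_, ?_, ?_⟩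
    · intro x hx
      rw [State.setReg_reg, if_neg (by rintro rfl; revert hx; decide), State.setMem_reg,
        State.setReg_reg, if_neg (by rintro rfl; revert hx; decide)]
    · intro c hc
      obtain rfl : c = 0 := by omega
      simp [hW]
    · intro x hx
      rw [State.setReg_mem, State.setMem_mem, if_neg (hx 0 (Nat.zero_le _)), State.setReg_mem]

/-! ### Row lists for the interval minors -/

/-- The rows `g c + c` for `1 ≤ c ≤ k`, followed by all rows above `N`. -/
def extendRows (k N : ℕ) (g : ℕ → ℕ) (c : ℕ) : ℕ :=
  if c = 0 then 0 else if c ≤ k then g c + c else N + (c - k)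

theorem extendRows_strictMono {k N : ℕ} {g : ℕ → ℕ} (hk : 0 < k) (hN : g k + k ≤ N)
    (hg : ∀ c, 1 ≤ c → c < k → g c ≤ g (c + 1)) : StrictMono (extendRows k N g) := by
  refine strictMono_nat_of_lt_succ fun c => ?_
  unfold extendRows
  rcases lt_trichotomy c k with h | rfl | h
  · rcases Nat.eq_zero_or_pos c with rfl | h0
    · rw [if_pos rfl, if_neg (by omega), if_pos (by omega)]; omega
    · have := hg c h0 h
      rw [if_neg (by omega), if_pos (by omega), if_neg (by omega), if_pos (by omega)]; omega
  · rw [if_neg (by omega), if_pos le_rfl, if_neg (by omega), if_neg (by omega)]; omega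
  · rw [if_neg (by omega), if_neg (by omega), if_neg (by omega), if_neg (by omega)]; omega

/-- A finite sequence of parts, extended by zeros. -/
def parts {k : ℕ} (nu : Fin k → ℕ) (j : ℕ) : ℕ := if h : j < k then nu ⟨j, h⟩ else 0

theorem parts_antitone {nu : Fin k → ℕ} (hnu : Antitone nu) {i j : ℕ} (h : i ≤ j) :
    parts nu j ≤ parts nu i := by
  unfold parts
  split_ifs with h1 h2
  · exact hnu h
  · omega
  · exact Nat.zero_le _
  · exact le_rfl

/-- The rows of an interval flag minor, as a Schur polynomial. -/
def intervalRows {k : ℕ} (nu : Fin k → ℕ) (N a p : ℕ) : ℕ → ℕ :=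
  extendRows k N fun c => if k < p + c then a - parts nu (c - 1) else 0

section IntervalRows

variable {nu : Fin k → ℕ} {N a p : ℕ}

theorem intervalRows_strictMono (hnu : Antitone nu) (hk : 0 < k) (hN : a + k ≤ N) :
    StrictMono (intervalRows nu N a p) := by
  refine extendRows_strictMono hk ?_ fun c h1 h2 => ?_
  · split_ifs <;> omega
  · have := parts_antitone hnu (show c - 1 ≤ c + 1 - 1 by omega)
    split_ifs <;> omega

theorem intervalRows_top (hN : a + k ≤ N) : intervalRows nu N a p k ≤ N := by
  simp only [intervalRows, extendRows]
  split_ifs <;> omega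

theorem intervalRows_above (j : ℕ) : intervalRows nu N a p (k + 1 + j) = N + 1 + j := by
  unfold intervalRows extendRows
  rw [if_neg (by omega), if_neg (by omega)]; omega

/-- Position `c` corresponds to the part with index `k - c`, counted from `0`. It is `a - ν_c` when
this index is below `p`, and padding by zero otherwise. -/
theorem rowMinor_intervalRows (hp : p ≤ k) :
    rowMinor (schurMatrix k) (fun r => intervalRows nu N a p (r + 1)) 0 k =
      schur k (fun j : Fin p => a - nu (Fin.castLE hp j).rev) := by
  rw [rowMinor_schurMatrix_eq_schur k p hp
    (fun j => if j < p then a - parts nu (k - 1 - j) else 0) (fun j hj => if_neg (by omega))]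
  · congr 1
    funext j
    rw [if_pos j.2, parts, dif_pos (by have := j.2; omega)]
    congr 2
    ext
    simp only [Fin.val_rev, Fin.val_castLE]
    have := j.2
    omega
  · intro r hr
    unfold intervalRows extendRows
    beta_reduce
    rw [if_neg (by omega), if_pos (by omega), show k - 1 - (k - 1 - r) = r by omega,
      Nat.add_sub_cancel]
    split_ifs <;> omega

theorem rowMinor_skewMatrix_interval (hp : p ≤ k)
    (h : ∀ j : Fin p, nu (Fin.castLE hp j).rev ≤ a) :
    rowMinor (skewMatrix nu) Nat.succ a p =
      rowMinor (schurMatrix k) (fun r => intervalRows nu N a p (r + 1)) 0 k := by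
  rw [rowMinor_intervalRows hp, ← hMinor_interval_eq_schur nu a p hp h,
    rowMinor_skewMatrix nu _ a p hp]

theorem hMinor_interval_eq_zero (hnu : Antitone nu) (hp : p ≤ k) (j : Fin p)
    (h : a < nu (Fin.castLE hp j).rev) :
    hMinor k k (fun r : Fin p => a + r + 1) (fun c => column nu (Fin.castLE hp c)) = 0 := by
  refine hMinor_eq_zero (fun i j h => ?_) (fun i j h => ?_) j ?_
  · have := Fin.le_def.1 h
    show a + i + 1 ≤ a + j + 1
    omega
  · exact (column_strictMono hnu).monotone h
  · unfold column
    simp only [Fin.val_castLE]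
    omega

/-- `ν_{k-p+1}` is the largest of the parts concerned, so the machine decides vanishing by a single
comparison. -/
theorem part_le_iff (hnu : Antitone nu) (hp : p ≤ k) (hp1 : 1 ≤ p) :
    parts nu (k - p) ≤ a ↔ ∀ j : Fin p, nu (Fin.castLE hp j).rev ≤ a := by
  unfold parts
  rw [dif_pos (by omega)]
  constructor
  · intro h j
    refine (hnu ?_).trans h
    rw [Fin.le_def, Fin.val_rev, Fin.val_castLE]
    have := j.2
    show k - p ≤ _
    omega
  · intro h
    convert h ⟨p - 1, by omega⟩ using 2
    ext
    rw [Fin.val_rev, Fin.val_castLE]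
    show k - p = k - (p - 1 + 1)
    omega

end IntervalRows

end Schur

section Main

variable {k U : ℕ} {s : State}

/-- The flag matrix `H_ν`, over the rational functions. -/
noncomputable def skewMatrixField {k : ℕ} (nu : Fin k → ℕ) (i c : ℕ) : RatField k :=
  algebraMap (MvPolynomial (Fin k) ℚ) (RatField k) (skewMatrix nu i c)

theorem isExchangeable_skewMatrixField {nu : Fin k → ℕ} (hnu : Antitone nu) :
    IsExchangeable k (skewMatrixField nu) := by
  intro ρ hρ h0 a p e hp h
  unfold skewMatrixField at h ⊢
  rw [← map_rowMinor, map_eq_zero_iff _ (algebraMap_injective k)] at h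
  rw [← map_rowMinor, rowMinor_skewMatrix_skip_eq_zero hnu hρ hp h, map_zero]

/-- No table has tag `0`, so the input, which lies below `b`, is never overwritten. -/
theorem mul_add_lt_address {b t d a p : ℕ} (ht : 0 < t) (hb : 0 < b) : b ≤ address b t d a p := by
  unfold address
  have h1 : 1 ≤ t * b + d := (Nat.mul_pos ht hb).trans_le (Nat.le_add_right _ _)
  have h2 : 1 ≤ (t * b + d) * b + a := (Nat.mul_pos h1 hb).trans_le (Nat.le_add_right _ _)
  exact (Nat.le_mul_of_pos_left b h2).trans (Nat.le_add_right _ _)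

/-- A gate with the value `1`. -/
def unitGate : Gate := ⟨.mul, .scalar 1, .scalar 1⟩

theorem gateValue_unitGate (vals : List (RatField k)) : GateValue vals unitGate 1 := by
  have h : OperandValue vals (.scalar 1) ((1 : ℕ) : RatField k) := .scalar 1 one_pos
  have := GateValue.mul h h
  unfold unitGate
  simpa using this

/-- The first gate only uses up the number `0`; the second, with number `1`, represents the constant
`1`. -/
theorem isLegal_unitGates : IsLegal k [unitGate, unitGate] := by
  have h0 : IsLegal k [] := CircuitValues.nil
  exact (h0.snoc (gateValue_unitGate _)).snoc (gateValue_unitGate _)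

theorem represents_unitGates : Represents [unitGate, unitGate] 1 (1 : RatField k) :=
  represents_snoc (c := [unitGate]) one_pos (gateValue_unitGate _)

/-- Issue the value of a table entry as the last gate. -/
def finish : Program := .instr (.emit .mul (.gate rV) (.scalar rOne))

/-- The output has to be the last gate, so the result is multiplied by `1`. It must be nonzero in
order to have a gate. -/
theorem finish_wp {b : ℕ} {f : MvPolynomial (Fin k) ℚ} (hs : Env k b s) (hf : f ≠ 0)
    (h : Represents s.out (s.reg rV) (algebraMap (MvPolynomial (Fin k) ℚ) (RatField k) f)) :
    Wp U finish s 1 fun s' => Computes s'.out f := by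
  refine Wp.emit (hs.legal.computes ?_)
  have h0 : algebraMap (MvPolynomial (Fin k) ℚ) (RatField k) f ≠ 0 := by
    rwa [Ne, map_eq_zero_iff _ (algebraMap_injective k)]
  have h1 : OperandValue (values k s.out) (Operand.read s.reg (.scalar rOne))
      ((1 : ℕ) : RatField k) := by
    simp only [Operand.read, hs.regOne]
    exact .scalar 1 one_pos
  have := GateValue.mul (h.operandValue (h.pos h0)) h1
  rwa [Nat.cast_one, mul_one] at this

/-! ### A single Schur polynomial -/

/-- Compute a Schur polynomial whose rows are listed in the memory. -/
def schurProgram : Program :=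
  monomials ;; deletion ;; fetch rV rTag rZero rZero rK ;; finish

/-- The number of steps of `schurProgram`. -/
def schurTime (k N : ℕ) : ℕ := monomialsTime k N + (deletionTime k N + 8)

/-- Only the size of the circuit counts here, so the run may start with all constants and the row
list already in place. -/
theorem exists_schur_circuit (hk : 0 < k) {N : ℕ} {W : ℕ → ℕ} (hW : StrictMono W) (hW0 : W 0 = 0)
    (hkN : k ≤ N) (hWk : W k ≤ N) (hWN : ∀ j, W (k + 1 + j) = N + 1 + j) :
    ∃ c : Circuit, c.length ≤ schurTime k N + 2 ∧
      Computes c (rowMinor (schurMatrix k) (fun r => W (r + 1)) 0 k) := by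
  classical
  set b := N + 1 with hb
  have hb0 : 0 < b := by omega
  let s : State :=
    { reg := fun x => if x = rK then k else if x = rOne then 1 else if x = rBase then b else
        if x = rGate then 2 else if x = rKSucc then k + 1 else if x = rTag then 1 else
        if x = rTagW then 3 else if x = rTop then N else 0
      -- The position in the list is the last digit of the address.
      mem := fun x => if x % b ≤ k ∧ x = address b 3 0 0 (x % b) then W (x % b) else 0
      out := [unitGate, unitGate] }
  have hs : Env k b s := ⟨isLegal_unitGates, by simp [s], rfl, rfl, rfl, rfl, rfl, rfl⟩
  have hmem : ∀ c ≤ k, s.mem (address b 3 0 0 c) = W c := by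
    intro c hc
    have : address b 3 0 0 c % b = c := by
      unfold address
      rw [Nat.mul_comm _ b, Nat.mul_add_mod, Nat.mod_eq_of_lt (by omega)]
    simp only [s, this]
    rw [if_pos ⟨hc, trivial⟩]
  set U := 5 * b ^ 3 + 2 + schurTime k N with hU
  have hU3 : 5 * b ^ 3 ≤ U := by omega
  have hbU : 5 * b ≤ U := le_trans (Nat.mul_le_mul_left 5 (Nat.le_self_pow (by decide) b)) hU3
  have hbound : s.Bounded U := by
    refine ⟨fun x => ?_, fun x => ?_⟩
    · simp only [s]
      split_ifs <;> omega
    · simp only [s]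
      split_ifs with h
      · have := hW.monotone h.1
        omega
      · omega
  have hwp : Wp U schurProgram s (schurTime k N) fun s' =>
      Computes s'.out (rowMinor (schurMatrix k) (fun r => W (r + 1)) 0 k) := by
    unfold schurTime
    rw [show deletionTime k N + 8 = deletionTime k N + (7 + 1) from rfl]
    refine Wp.seq ((monomials_wp (t := 1) (N := N) hs hU3 (by omega) (by omega) (by omega) rfl rfl
      represents_unitGates).frame.mono le_rfl ?_)
    rintro s₁ ⟨⟨he₁, ht₁, hm₁⟩, hf₁, -⟩
    refine Wp.seq ((deletion_wp (t := 1) (N := N) (isExchangeable_schurMatrixField k) he₁ hU3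
      (by omega) hk (by omega) (by omega) hW hW0 hWk hWN (hf₁ _ (by decide)) (hf₁ _ (by decide))
      (hf₁ _ (by decide)) (fun c hc => ?_) ht₁).frame.mono le_rfl ?_)
    · rw [hm₁, hmem c hc]
      intro a p ha hp h
      have := (address_inj hb0 hb0 (by omega) (by omega) (by omega) (by omega) h).1
      omega
    rintro s₂ ⟨⟨he₂, hr₂, -⟩, hf₂, -⟩
    refine Wp.seq (fetch_wp (T := 1) he₂.regBase ((hf₂ rTag (by decide)).trans (hf₁ _ (by decide)))
      he₂.regZero he₂.regZero he₂.regK (by decide)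
      ((address_lt (by decide) hb0 hb0 (by omega)).le.trans hU3) ?_)
    refine finish_wp (he₂.setReg (by decide) _) (rowMinor_schurMatrix_ne_zero k
      (hW.comp fun i j h => Nat.succ_lt_succ h) ?_ 0 k) ?_
    · exact (Nat.zero_le _).trans_lt (hW (show 0 < 0 + 1 by omega))
    · rw [map_rowMinor, State.setReg_reg, if_pos rfl]
      exact hr₂
  obtain ⟨s', t, -, -, -, hl, hc⟩ := hwp hbound (by simp only [s, List.length_cons, List.length_nil]; omega)
  refine ⟨s'.out, hl.trans ?_, hc⟩
  simp only [s, List.length_cons, List.length_nil]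
  omega

/-! ### The table of the interval flag minors of `H_ν` -/

/-- Compute the constants, and issue two unit gates. -/
def setup : Program :=
  .instr (.set rOne 1) ;; .instr (.add rKSucc rK rOne) ;; .instr (.load rN rZero) ;;
    .instr (.add rN rN rK) ;; .instr (.add rNSucc rN rOne) ;; .instr (.add rNK rN rK) ;;
    .instr (.add rBase rNK rOne) ;; .instr (.emit .mul (.scalar rOne) (.scalar rOne)) ;;
    .instr (.emit .mul (.scalar rOne) (.scalar rOne)) ;; .instr (.set rGate 2) ;;
    .instr (.set rTag 1) ;; .instr (.set rTagW 3) ;; .instr (.add rTop rNK rZero)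

/-- The part of the state that is fixed while the table of the interval flag minors is filled. -/
structure Prepared (k N : ℕ) (m : ℕ → ℕ) (s : State) : Prop where
  env : Env k (N + k + 1) s
  regTag : s.reg rTag = 1
  regTagW : s.reg rTagW = 3
  regTop : s.reg rTop = N + k
  regN : s.reg rN = N
  regNSucc : s.reg rNSucc = N + 1
  input : ∀ x < 2 * k, s.mem x = m x

theorem setup_wp {N : ℕ} (hk : 0 < k) (hkN : k ≤ N) (hU : 5 * (N + k + 1) ^ 3 ≤ U)
    (hreg : s.reg = fun x => if x = 0 then k else 0) (hN : s.mem 0 + k = N) (hout : s.out = []) :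
    Wp U setup s 13 fun s' => Prepared k N s.mem s' ∧ s'.out = [unitGate, unitGate] := by
  have hbU : 5 * (N + k + 1) ≤ U :=
    le_trans (Nat.mul_le_mul_left 5 (Nat.le_self_pow (by decide) _)) hU
  refine Wp.seq (τ := 1) (τ' := 12) (Wp.set (by omega) ?_)
  refine Wp.seq (τ := 1) (τ' := 11) (Wp.add (by simp [hreg]; omega) ?_)
  -- `rZero` has been `0` from the start, so this reads the first input cell, `λ_1`.
  refine Wp.seq (τ := 1) (τ' := 10) (Wp.load ?_)
  refine Wp.seq (τ := 1) (τ' := 9) (Wp.add (by simp [hreg]; omega) ?_)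
  refine Wp.seq (τ := 1) (τ' := 8) (Wp.add (by simp [hreg, hN]; omega) ?_)
  refine Wp.seq (τ := 1) (τ' := 7) (Wp.add (by simp [hreg, hN]; omega) ?_)
  refine Wp.seq (τ := 1) (τ' := 6) (Wp.add (by simp [hreg, hN]; omega) ?_)
  refine Wp.seq (τ := 1) (τ' := 5) (Wp.emit ?_)
  refine Wp.seq (τ := 1) (τ' := 4) (Wp.emit ?_)
  refine Wp.seq (τ := 1) (τ' := 3) (Wp.set (by omega) ?_)
  refine Wp.seq (τ := 1) (τ' := 2) (Wp.set (by omega) ?_)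
  refine Wp.seq (τ := 1) (τ' := 1) (Wp.set (by omega) ?_)
  refine Wp.add (by simp [hreg, hN]; omega) ?_
  have ho : ∀ l : List Gate, l = [unitGate, unitGate] → IsLegal k l ∧ l.length = 2 := by
    rintro _ rfl
    exact ⟨isLegal_unitGates, rfl⟩
  refine ⟨⟨⟨(ho _ ?_).1, ?_, ?_, ?_, ?_, ?_, ?_, ?_⟩, ?_, ?_, ?_, ?_, ?_, fun x _ => rfl⟩, ?_⟩
  all_goals simp [hreg, hN, hout, unitGate, Operand.read]

/-- Compute the part number `k + 1 - c` of the Schur polynomial, plus `c`. -/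
def intervalBody : Program :=
  .instr (.add rX rOuterP rC) ;;
    .ifLt rK rX
      (.instr (.sub rY rC rOne) ;; .instr (.add rY rY rK) ;; .instr (.load rY rY) ;;
        .instr (.sub rY rOuterA rY) ;; .instr (.add rY rY rC))
      (.instr (.add rY rC rZero))

/-- Compute the interval flag minor in a given table entry. -/
def intervalEntry : Program :=
  .instr (.sub rX rK rOuterP) ;; .instr (.add rX rX rK) ;; .instr (.load rX rX) ;;
    .ifLt rOuterA rX (.instr (.set rV 0))
      (fill intervalBody ;; deletion ;; fetch rV rTag rZero rZero rK) ;;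
    .instr (.set rX 2) ;; put rX rN rOuterA rOuterP rV

/-- The number of steps of `intervalEntry`. -/
def intervalEntryTime (k N : ℕ) : ℕ := 16 * k + 28 + deletionTime k (N + k)

theorem intervalBody_wp {b a p c N : ℕ} {nu : Fin k → ℕ} (hs : Env k b s) (hU : 5 * b ≤ U)
    (hkb : 2 * k < b) (hab : a < b) (hp : p ≤ k) (hc1 : 1 ≤ c) (hc : c ≤ k)
    (rc : s.reg rC = c) (ra : s.reg rOuterA = a) (rp : s.reg rOuterP = p)
    (hin : ∀ j < k, s.mem (k + j) = parts nu j) :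
    Wp U intervalBody s 7 fun s' => Env k b s' ∧ s'.reg rY = intervalRows nu N a p c ∧
      s'.mem = s.mem := by
  have hrow : intervalRows nu N a p c = (if k < p + c then a - parts nu (c - 1) else 0) + c := by
    simp only [intervalRows, extendRows]
    rw [if_neg (by omega), if_pos hc]
  rw [hrow]
  refine Wp.seq (τ := 1) (τ' := 6) (Wp.add (by rw [rp, rc]; omega) ?_)
  rw [rp, rc]
  have hs := hs.setReg (r := rX) (by decide) (p + c)
  refine Wp.ifLt (τ := 5) (fun h => ?_) fun h => ?_
  · rw [hs.regK] at h
    simp only [State.setReg_reg, if_true] at h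
    rw [if_pos h]
    refine Wp.seq (τ := 1) (τ' := 4) (Wp.sub ?_)
    have e1 : (s.setReg rX (p + c)).reg rC - (s.setReg rX (p + c)).reg rOne = c - 1 := by
      rw [hs.regOne]; simp [rc]
    rw [e1]
    have hs := hs.setReg (r := rY) (by decide) (c - 1)
    refine Wp.seq (τ := 1) (τ' := 3) (Wp.add ?_ ?_)
    · rw [hs.regK]; simp only [State.setReg_reg, if_true]; omega
    rw [hs.regK]
    have e2 : ((s.setReg rX (p + c)).setReg rY (c - 1)).reg rY + k = k + (c - 1) := by
      simp [add_comm]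
    rw [e2, State.setReg_setReg]
    refine Wp.seq (τ := 1) (τ' := 2) (Wp.load ?_)
    rw [State.setReg_setReg]
    have e3 : ((s.setReg rX (p + c)).setReg rY (k + (c - 1))).mem
        (((s.setReg rX (p + c)).setReg rY (k + (c - 1))).reg rY) = parts nu (c - 1) := by
      simpa using hin (c - 1) (by omega)
    rw [e3]
    refine Wp.seq (τ := 1) (τ' := 1) (Wp.sub ?_)
    refine Wp.add ?_ ?_
    · simp [ra, rc]; omega
    · refine ⟨?_, by simp [ra, rc], rfl⟩
      exact ((((‹Env k b s›.setReg (by decide) _).setReg (by decide) _).setReg (by decide)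
        _).setReg (by decide) _)
  · rw [hs.regK] at h
    simp only [State.setReg_reg, if_true] at h
    rw [if_neg h]
    refine (Wp.add ?_ ?_).mono (show 1 ≤ 5 by omega) fun _ h => h
    · rw [hs.regZero]; simp [rc]; omega
    · rw [hs.regZero]
      exact ⟨hs.setReg (by decide) _, by simp [rc], rfl⟩

/-- The row lists reach up to `a + k ≤ N + k`, hence the top layer `N + k` of the table of Schur
minors. That layer is not overwritten, so the monomials are computed once for all entries. -/
theorem intervalEntry_wp {N a p : ℕ} {nu : Fin k → ℕ} {m : ℕ → ℕ} (hnu : Antitone nu)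
    (hm : ∀ j < k, m (k + j) = parts nu j) (hk : 0 < k) (hkN : k ≤ N)
    (hU : 5 * (N + k + 1) ^ 3 ≤ U) (hs : Prepared k N m s) (ha : a ≤ N) (hp1 : 1 ≤ p) (hp : p ≤ k)
    (ra : s.reg rOuterA = a) (rp : s.reg rOuterP = p)
    (htab : IsTable k (N + k + 1) 1 (schurMatrixField k) s (N + k) Nat.succ
      fun a _ => a ≤ N + k) :
    Wp U intervalEntry s (intervalEntryTime k N) fun s' => Prepared k N m s' ∧
      IsTable k (N + k + 1) 1 (schurMatrixField k) s' (N + k) Nat.succ (fun a _ => a ≤ N + k) ∧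
      Represents s'.out (s'.mem (address (N + k + 1) 2 N a p))
        (rowMinor (skewMatrixField nu) Nat.succ a p) ∧
      ∀ a' p', a' ≤ N → p' ≤ k → (a', p') ≠ (a, p) →
        s'.mem (address (N + k + 1) 2 N a' p') = s.mem (address (N + k + 1) 2 N a' p') := by
  set b := N + k + 1 with hb
  have hb0 : 0 < b := by omega
  have hbU : 5 * b ≤ U := le_trans (Nat.mul_le_mul_left 5 (Nat.le_self_pow (by decide) b)) hU
  have hE := hs.env
  have hX : Wp U (.ifLt rOuterA rX (.instr (.set rV 0))
      (fill intervalBody ;; deletion ;; fetch rV rTag rZero rZero rK))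
      (s.setReg rX (parts nu (k - p))) (16 * k + 17 + deletionTime k (N + k)) fun s' => Env k b s' ∧
        Represents s'.out (s'.reg rV) (rowMinor (skewMatrixField nu) Nat.succ a p) ∧
        ∀ x, (∀ d a p, d < N + k → a < b → p ≤ k → x ≠ address b 1 d a p) →
          (∀ c ≤ k, x ≠ address b 3 0 0 c) → s'.mem x = s.mem x := by
    rw [show 16 * k + 17 + deletionTime k (N + k) =
      (k * (7 + 9) + 9) + (deletionTime k (N + k) + 7) + 1 by ring]
    unfold skewMatrixField
    rw [← map_rowMinor]
    have hs' := hE.setReg (r := rX) (by decide) (parts nu (k - p))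
    refine Wp.ifLt (fun h => ?_) fun h => ?_
    · simp only [State.setReg_reg, if_true] at h
      rw [if_neg (by decide), ra, ← not_le, part_le_iff hnu hp hp1] at h
      push Not at h
      obtain ⟨j, hj⟩ := h
      refine (Wp.set (Nat.zero_le _) ?_).mono (show 1 ≤ _ by omega) fun _ h => h
      refine ⟨hs'.setReg (by decide) _, ?_, fun _ _ _ => rfl⟩
      rw [rowMinor_skewMatrix nu _ a p hp]
      have := hMinor_interval_eq_zero hnu hp j hj
      simp only [Nat.succ_eq_add_one]
      rw [this, map_zero]
      simpa using represents_zero (k := k) _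
    · simp only [State.setReg_reg, if_true] at h
      rw [if_neg (by decide), ra, not_lt, part_le_iff hnu hp hp1] at h
      rw [rowMinor_skewMatrix_interval (N := N + k) hp h]
      refine Wp.seq ((fill_wp (t := 3) (W := intervalRows nu (N + k) a p) (τ := 7) hs' hU (by omega)
        (by omega) (by simpa using hs.regTagW) (by simp [intervalRows, extendRows]) (by decide)
        ?_).frame.mono le_rfl ?_)
      · intro c s' hc1 hc he hrc hr hmem
        refine intervalBody_wp he hbU (by omega) (by omega) hp hc1 hc hrc
          ((hr _ (by decide)).trans (by simpa using ra)) ((hr _ (by decide)).trans (by simpa using rp))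
          fun j hj => ?_
        rw [hmem, State.setReg_mem, hs.input _ (by omega), hm j hj]
        intro c' _ h
        have := mul_add_lt_address (b := N + k + 1) (d := 0) (a := 0) (p := c')
          (show 0 < 3 by omega) hb0
        omega
      rintro s₁ ⟨⟨he₁, hW₁, hm₁⟩, hf₁, ho₁⟩
      have r₁ : ∀ x ∈ [rTag, rTagW, rTop], s₁.reg x = s.reg x := fun x hx => by
        rw [hf₁ x (by revert x; decide), State.setReg_reg, if_neg (by rintro rfl; revert hx; decide)]
      refine Wp.seq ((deletion_wp (t := 1) (N := N + k) (isExchangeable_schurMatrixField k) he₁ hU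
        (by omega) hk (by omega) (by omega) (intervalRows_strictMono hnu hk (by omega))
        (by simp [intervalRows, extendRows]) (intervalRows_top (by omega)) intervalRows_above
        ((r₁ _ (by decide)).trans hs.regTag) ((r₁ _ (by decide)).trans hs.regTagW)
        ((r₁ _ (by decide)).trans hs.regTop) hW₁ ?_).frame.mono le_rfl ?_)
      · refine htab.congr ho₁ fun a' p' ha' _ hp' => ⟨ha', ?_⟩
        rw [hm₁, State.setReg_mem]
        intro c hc h
        have := (address_inj (by omega) (by omega) (by omega) hb0 hb0 (by omega) h).1
        omega
      rintro s₂ ⟨⟨he₂, hr₂, hm₂⟩, hf₂, -⟩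
      refine fetch_wp he₂.regBase
        ((hf₂ rTag (by decide)).trans ((r₁ _ (by decide)).trans hs.regTag))
        he₂.regZero he₂.regZero he₂.regK (by decide)
        ((address_lt (by decide) hb0 hb0 (by omega)).le.trans hU) ?_
      refine ⟨he₂.setReg (by decide) _, ?_, fun x h1 h3 => ?_⟩
      · rw [map_rowMinor, State.setReg_reg, if_pos rfl]
        exact hr₂
      · rw [State.setReg_mem, hm₂ x h1, hm₁ x h3, State.setReg_mem]
  unfold intervalEntryTime
  rw [show 16 * k + 28 + deletionTime k (N + k) =
    1 + (1 + (1 + ((16 * k + 17 + deletionTime k (N + k)) + (1 + 7)))) by ring]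
  refine Wp.seq (Wp.sub (Wp.seq (Wp.add ?_ (Wp.seq (Wp.load ?_)))))
  · have := (hE.setReg (r := rX) (by decide) (s.reg rK - s.reg rOuterP)).regK
    rw [this, State.setReg_reg, if_pos rfl, hE.regK]; omega
  have hk' := (hE.setReg (r := rX) (by decide) (s.reg rK - s.reg rOuterP)).regK
  rw [hk']
  simp only [State.setReg_setReg, State.setReg_reg, if_true, State.setReg_mem]
  rw [hE.regK, rp, hs.input _ (by omega), show k - p + k = k + (k - p) by omega,
    hm _ (by omega)]
  refine Wp.seq (hX.frame.mono le_rfl ?_)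
  rintro s₁ ⟨⟨he₁, hv₁, hm₁⟩, hf₁, ho₁⟩
  have r₁ : ∀ x ∈ [rTag, rTagW, rTop, rN, rNSucc, rOuterA, rOuterP], s₁.reg x = s.reg x :=
    fun x hx => by
      rw [hf₁ x (by revert x; decide), State.setReg_reg, if_neg (by rintro rfl; revert hx; decide)]
  refine Wp.seq (Wp.set (by omega) ?_)
  have he₂ := he₁.setReg (r := rX) (by decide) 2
  refine put_wp (T := 2) (D := N) (A := a) (P := p) (V := s₁.reg rV) he₂.regBase (by simp)
    ((r₁ rN (by decide)).trans hs.regN) ((r₁ rOuterA (by decide)).trans ra)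
    ((r₁ rOuterP (by decide)).trans rp) (by simp) (by decide) (by decide)
    ((address_lt (by decide) (by omega) (by omega) (by omega)).le.trans hU) ?_
  have hreg : ∀ x ∈ [rTag, rTagW, rTop, rN, rNSucc, rOuterA, rOuterP],
      (((s₁.setReg rX 2).setReg rS (address b 2 N a p)).setMem (address b 2 N a p)
        (s₁.reg rV)).reg x = s.reg x := fun x hx => by
    rw [State.setMem_reg, State.setReg_reg, if_neg (by rintro rfl; revert hx; decide),
      State.setReg_reg, if_neg (by rintro rfl; revert hx; decide), r₁ x hx]
  have hsame : ∀ x, x ≠ address b 2 N a p →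
      (∀ d a p, d < N + k → a < b → p ≤ k → x ≠ address b 1 d a p) →
      (∀ c ≤ k, x ≠ address b 3 0 0 c) → (((s₁.setReg rX 2).setReg rS (address b 2 N a p)).setMem
        (address b 2 N a p) (s₁.reg rV)).mem x = s.mem x := fun x h2 h1 h3 => by
    rw [State.setMem_mem, if_neg h2, State.setReg_mem, State.setReg_mem, hm₁ x h1 h3]
  refine ⟨⟨(he₂.setReg (by decide) _).setMem _ _, (hreg _ (by decide)).trans hs.regTag,
    (hreg _ (by decide)).trans hs.regTagW, (hreg _ (by decide)).trans hs.regTop,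
    (hreg _ (by decide)).trans hs.regN, (hreg _ (by decide)).trans hs.regNSucc, fun x hx => ?_⟩,
    ?_, ?_, ?_⟩
  · have hlow : ∀ t d a p, 0 < t → x ≠ address b t d a p := fun t d a p ht h => by
      have := mul_add_lt_address (d := d) (a := a) (p := p) ht hb0
      omega
    rw [hsame x (hlow _ _ _ _ (by omega)) (fun _ _ _ _ _ _ => hlow _ _ _ _ (by omega))
      (fun _ _ => hlow _ _ _ _ (by omega)), hs.input x hx]
  · refine htab.congr ho₁ fun a' p' ha' _ hp' => ⟨ha', hsame _ ?_ ?_ ?_⟩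
    · intro h
      have := (address_inj (by omega) (by omega) (by omega) (by omega) (by omega) (by omega) h).1
      omega
    · intro d a'' p'' hd ha'' hp'' h
      have := (address_inj (by omega) (by omega) (by omega) (by omega) ha'' (by omega) h).2.1
      omega
    · intro c hc h
      have := (address_inj (by omega) (by omega) (by omega) (by omega) (by omega) (by omega) h).1
      omega
  · rw [State.setMem_mem, if_pos rfl]
    exact hv₁
  · intro a' p' ha' hp' hne
    refine hsame _ ?_ ?_ ?_
    · intro h
      obtain ⟨-, -, rfl, rfl⟩ :=
        address_inj (by omega) (by omega) (by omega) (by omega) (by omega) (by omega) h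
      exact hne rfl
    · intro d a'' p'' hd ha'' hp'' h
      have := (address_inj (by omega) (by omega) (by omega) (by omega) ha'' (by omega) h).1
      omega
    · intro c hc h
      have := (address_inj (by omega) (by omega) (by omega) (by omega) (by omega) (by omega) h).1
      omega

/-- Compute all interval flag minors with at most `k` rows. -/
def intervals : Program :=
  .instr (.set rOuterA 0) ;; .whileLt rOuterA rNSucc
    (.instr (.set rOuterP 1) ;;
      .whileLt rOuterP rKSucc (intervalEntry ;; .instr (.add rOuterP rOuterP rOne)) ;;
      .instr (.add rOuterA rOuterA rOne))

/-- The number of steps of `intervals`. -/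
def intervalsTime (k N : ℕ) : ℕ := (N + 1) * (k * (intervalEntryTime k N + 2) + 4) + 2

theorem Prepared.setReg {N : ℕ} {m : ℕ → ℕ} (hs : Prepared k N m s) {x : ℕ}
    (hx : x ∉ permanent ++ [rTag, rTagW, rTop, rN, rNSucc]) (v : ℕ) :
    Prepared k N m (s.setReg x v) := by
  simp only [List.mem_append, not_or] at hx
  obtain ⟨h1, h2⟩ := hx
  simp only [List.mem_cons, List.not_mem_nil, or_false, not_or] at h2
  refine ⟨hs.env.setReg h1 v, ?_, ?_, ?_, ?_, ?_, hs.input⟩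
  · rw [State.setReg_reg, if_neg (Ne.symm h2.1), hs.regTag]
  · rw [State.setReg_reg, if_neg (Ne.symm h2.2.1), hs.regTagW]
  · rw [State.setReg_reg, if_neg (Ne.symm h2.2.2.1), hs.regTop]
  · rw [State.setReg_reg, if_neg (Ne.symm h2.2.2.2.1), hs.regN]
  · rw [State.setReg_reg, if_neg (Ne.symm h2.2.2.2.2), hs.regNSucc]

theorem intervals_wp {N : ℕ} {nu : Fin k → ℕ} {m : ℕ → ℕ} (hnu : Antitone nu)
    (hm : ∀ j < k, m (k + j) = parts nu j) (hk : 0 < k) (hkN : k ≤ N)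
    (hU : 5 * (N + k + 1) ^ 3 ≤ U) (hs : Prepared k N m s)
    (htab : IsTable k (N + k + 1) 1 (schurMatrixField k) s (N + k) Nat.succ
      fun a _ => a ≤ N + k) :
    Wp U intervals s (intervalsTime k N) fun s' => Prepared k N m s' ∧
      IsTable k (N + k + 1) 2 (skewMatrixField nu) s' N Nat.succ (fun a _ => a ≤ N) := by
  have hbU : 5 * (N + k + 1) ≤ U :=
    le_trans (Nat.mul_le_mul_left 5 (Nat.le_self_pow (by decide) _)) hU
  let J : (ℕ → ℕ → Prop) → State → Prop := fun dom s' => Prepared k N m s' ∧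
    IsTable k (N + k + 1) 1 (schurMatrixField k) s' (N + k) Nat.succ (fun a _ => a ≤ N + k) ∧
    IsTable k (N + k + 1) 2 (skewMatrixField nu) s' N Nat.succ (fun a p => a ≤ N ∧ dom a p)
  unfold intervalsTime
  rw [show (N + 1) * (k * (intervalEntryTime k N + 2) + 4) + 2 =
    1 + ((N + 1 - 0) * ((1 + (((k + 1 - 1) * ((intervalEntryTime k N + 1) + 1) + 1) + 1)) + 1) + 1) by
      rw [Nat.add_sub_cancel, Nat.sub_zero]; ring]
  refine Wp.seq (Wp.set (Nat.zero_le _) (Wp.whileLt_up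
    (fun j s' => J (fun a _ => a < j) s' ∧ s'.reg rOuterA = j) (N + 1) ?_ ?_ ?_ 0 (Nat.zero_le _) ?_))
  · rintro j s' ⟨⟨hp, _⟩, h⟩
    exact ⟨h, hp.regNSucc⟩
  · rintro j s' hj ⟨⟨hs', ht1, ht2⟩, hA⟩
    refine Wp.seq (Wp.set (by omega) (Wp.seq (Wp.whileLt_up (fun i s' =>
      J (fun a p => a < j ∨ a = j ∧ p < i) s' ∧ s'.reg rOuterP = i ∧ s'.reg rOuterA = j ∧ 1 ≤ i)
      (k + 1) ?_ ?_ ?_ 1 (by omega) ?_)))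
    · rintro i s' ⟨⟨hp, _⟩, h, _⟩
      exact ⟨h, hp.env.regKSucc⟩
    · rintro i s₁ hi ⟨⟨hs₁, ht1, ht2⟩, hP, hA, hi1⟩
      refine Wp.seq ((intervalEntry_wp hnu hm hk hkN hU hs₁ (by omega) hi1 (by omega) hA hP
        ht1).frame.mono le_rfl ?_)
      rintro s₂ ⟨⟨hs₂, ht1', hr, hm₂⟩, hf, ho⟩
      have hP₂ : s₂.reg rOuterP = i := (hf _ (by decide)).trans hP
      refine Wp.add (by rw [hP₂, hs₂.env.regOne]; omega) ?_
      rw [hP₂, hs₂.env.regOne]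
      refine ⟨⟨hs₂.setReg (by decide) _, ht1', ?_⟩, by simp, ?_, by omega⟩
      · rintro a p ⟨ha, hap⟩ hp1 hp
        rw [State.setReg_mem, State.setReg_out]
        by_cases h : (a, p) = (j, i)
        · obtain ⟨rfl, rfl⟩ := Prod.mk.inj h
          exact hr
        · rw [hm₂ a p ha hp h]
          refine (ht2 a p ⟨ha, ?_⟩ hp1 hp).mono ho
          rcases hap with hlt | ⟨rfl, hlt⟩
          · exact .inl hlt
          · refine .inr ⟨rfl, lt_of_le_of_ne (Nat.lt_succ_iff.1 hlt) ?_⟩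
            rintro rfl
            exact h rfl
      · rw [State.setReg_reg, if_neg (by decide), hf _ (by decide), hA]
    · rintro s₁ ⟨⟨hs₁, ht1, ht2⟩, hP, hA, hi1⟩
      refine Wp.add (by rw [hA, hs₁.env.regOne]; omega) ?_
      rw [hA, hs₁.env.regOne]
      refine ⟨⟨hs₁.setReg (by decide) _, ht1, ?_⟩, by simp⟩
      exact ht2.congr List.prefix_rfl fun a p h _ hp => ⟨⟨h.1, by omega⟩, rfl⟩
    · refine ⟨⟨hs'.setReg (by decide) _, ht1, ?_⟩, by simp, by simpa using hA, le_rfl⟩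
      exact ht2.congr List.prefix_rfl fun a p h _ hp => ⟨⟨h.1, by omega⟩, rfl⟩
  · rintro s' ⟨⟨hs', _, ht2⟩, _⟩
    exact ⟨hs', ht2.congr List.prefix_rfl fun a p h _ _ => ⟨⟨h, by omega⟩, rfl⟩⟩
  · refine ⟨⟨hs.setReg (by decide) _, htab, ?_⟩, by simp⟩
    rintro a p ⟨_, h⟩
    omega

/-! ### The skew Schur polynomial -/

/-- Compute the part number `k + 1 - c` of `λ`, plus `c`. -/
def targetBody : Program :=
  .instr (.sub rY rK rC) ;; .instr (.load rY rY) ;; .instr (.add rY rY rC)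

/-- The algorithm: it produces a circuit for a skew Schur polynomial. -/
def skewProgram : Program :=
  setup ;; monomials ;; intervals ;; .instr (.set rTag 2) ;; .instr (.set rTagW 4) ;;
    .instr (.add rTop rN rZero) ;; fill targetBody ;; deletion ;;
    fetch rV rTag rZero rZero rK ;; finish

/-- The number of steps of `skewProgram`. -/
def skewTime (k N : ℕ) : ℕ :=
  monomialsTime k (N + k) + intervalsTime k N + deletionTime k N + 12 * k + 33

/-- The rows `λ_k + 1 < ⋯ < λ_1 + k`, followed by all rows above `N`. -/
def targetRows {k : ℕ} (lam : Fin k → ℕ) (N : ℕ) : ℕ → ℕ :=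
  extendRows k N fun c => parts lam (k - c)

theorem rowMinor_targetRows (lam nu : Fin k → ℕ) (N : ℕ) :
    rowMinor (skewMatrix nu) (fun r => targetRows lam N (r + 1)) 0 k = skewSchur k lam nu := by
  rw [rowMinor_skewMatrix nu _ 0 k le_rfl, skewSchur_eq_hMinor]
  congr 1
  funext r
  simp only [targetRows, extendRows]
  have := r.2
  rw [if_neg (by omega), if_pos (by omega), parts, dif_pos (by omega)]
  simp only [zero_add]
  rfl

/-- The second deletion works in table `2`, with the row list under tag `4`. The hypothesis `ν ⊂ λ`
ensures that the result is nonzero and therefore has a gate. -/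
theorem skewProgram_wp {lam nu : Fin k → ℕ} (hlam : Antitone lam) (hnu : Antitone nu) (hk : 0 < k)
    (hle : ∀ i, nu i ≤ lam i) {N : ℕ} (hN : N = k + lam ⟨0, hk⟩) (hU : 5 * (N + k + 1) ^ 3 ≤ U) :
    Wp U skewProgram (inputState lam nu) (skewTime k N) fun s' =>
      Computes s'.out (skewSchur k lam nu) := by
  set b := N + k + 1 with hb
  have hb0 : 0 < b := by omega
  have hkN : k ≤ N := by omega
  have hbU : 5 * b ≤ U := le_trans (Nat.mul_le_mul_left 5 (Nat.le_self_pow (by decide) b)) hU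
  have hml : ∀ j < k, (inputState lam nu).mem j = parts lam j := fun j hj => by
    simp [inputState, parts, hj]
  have hmn : ∀ j < k, (inputState lam nu).mem (k + j) = parts nu j := fun j hj => by
    simp [inputState, parts, hj]
  unfold skewTime
  rw [show monomialsTime k (N + k) + intervalsTime k N + deletionTime k N + 12 * k + 33 =
    13 + (monomialsTime k (N + k) + (intervalsTime k N + (1 + (1 + (1 + ((k * (3 + 9) + 9) +
      (deletionTime k N + (7 + 1)))))))) by ring]
  refine Wp.seq ((setup_wp (N := N) hk hkN hU rfl ?_ rfl).mono le_rfl ?_)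
  · rw [hml 0 hk, parts, dif_pos hk, hN, add_comm]
  rintro s₁ ⟨hs₁, ho₁⟩
  refine Wp.seq ((monomials_wp (t := 1) (N := N + k) hs₁.env hU (by omega) (by omega) (by omega)
    hs₁.regTag hs₁.regTop (by rw [ho₁]; exact represents_unitGates)).frame.mono le_rfl ?_)
  rintro s₂ ⟨⟨he₂, ht₂, hm₂⟩, hf₂, -⟩
  have hs₂ : Prepared k N (inputState lam nu).mem s₂ := by
    refine ⟨he₂, (hf₂ _ (by decide)).trans hs₁.regTag, (hf₂ _ (by decide)).trans hs₁.regTagW,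
      (hf₂ _ (by decide)).trans hs₁.regTop, (hf₂ _ (by decide)).trans hs₁.regN,
      (hf₂ _ (by decide)).trans hs₁.regNSucc, fun x hx => ?_⟩
    rw [hm₂, hs₁.input x hx]
    intro a p _ _ h
    have := mul_add_lt_address (b := N + k + 1) (d := N + k) (a := a) (p := p) one_pos hb0
    omega
  refine Wp.seq ((intervals_wp hnu hmn hk hkN hU hs₂ ht₂).mono le_rfl ?_)
  rintro s₃ ⟨hs₃, ht₃⟩
  refine Wp.seq (Wp.set (by omega) (Wp.seq (Wp.set (by omega) (Wp.seq (Wp.add ?_ ?_)))))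
  · simp only [State.setReg_reg]
    rw [if_neg (by decide), if_neg (by decide), if_neg (by decide), if_neg (by decide), hs₃.regN,
      hs₃.env.regZero]
    omega
  have he₄ := ((hs₃.env.setReg (r := rTag) (by decide) 2).setReg (r := rTagW) (by decide)
    4).setReg (r := rTop) (by decide) N
  have e : ((s₃.setReg rTag 2).setReg rTagW 4).reg rN + ((s₃.setReg rTag 2).setReg rTagW 4).reg rZero
      = N := by
    simp only [State.setReg_reg]
    rw [if_neg (by decide), if_neg (by decide), if_neg (by decide), if_neg (by decide), hs₃.regN,
      hs₃.env.regZero, add_zero]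
  rw [e]
  set s₄ := ((s₃.setReg rTag 2).setReg rTagW 4).setReg rTop N with hs₄
  have hrow : ∀ c, 1 ≤ c → c ≤ k → targetRows lam N c = parts lam (k - c) + c := fun c h1 h2 => by
    simp only [targetRows, extendRows]
    rw [if_neg (by omega), if_pos h2]
  have htop : targetRows lam N k = N := by
    rw [hrow k hk le_rfl, Nat.sub_self, parts, dif_pos hk, hN, add_comm]
  refine Wp.seq ((fill_wp (t := 4) (W := targetRows lam N) (τ := 3) he₄ hU le_rfl (by omega)
    (by simp [hs₄]) (by simp [targetRows, extendRows]) (by decide) ?_).frame.mono le_rfl ?_)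
  · intro c s' hc1 hc he hrc _ hmem
    refine Wp.seq (τ := 1) (τ' := 2) (Wp.sub ?_)
    rw [he.regK, hrc]
    have hin : s'.mem (k - c) = parts lam (k - c) := by
      rw [hmem, ← hml _ (by omega), hs₄]
      · exact hs₃.input _ (by omega)
      · intro c' _ h
        have := mul_add_lt_address (b := N + k + 1) (d := 0) (a := 0) (p := c')
          (show 0 < 4 by omega) hb0
        omega
    have hpart : parts lam (k - c) + k ≤ N := by
      refine (Nat.add_le_add_right (parts_antitone hlam (Nat.zero_le _)) k).trans ?_
      rw [parts, dif_pos hk]; omega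
    refine Wp.seq (τ := 1) (τ' := 1) (Wp.load (Wp.add ?_ ?_))
    · simp [hin, hrc]; omega
    · refine ⟨((he.setReg (by decide) _).setReg (by decide) _).setReg (by decide) _, ?_, rfl⟩
      simp [hin, hrc, hrow c hc1 hc]
  rintro s₅ ⟨⟨he₅, hW₅, hm₅⟩, hf₅, ho₅⟩
  have hstrict : StrictMono (targetRows lam N) := by
    refine extendRows_strictMono hk ?_ fun c _ _ => parts_antitone hlam (by omega)
    rw [Nat.sub_self, parts, dif_pos hk]; omega
  refine Wp.seq ((deletion_wp (t := 2) (N := N) (isExchangeable_skewMatrixField hnu) he₅ hU le_rfl hk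
    (by omega) (by omega) hstrict (by simp [targetRows, extendRows]) htop.le
    (fun j => by simp only [targetRows, extendRows]; rw [if_neg (by omega), if_neg (by omega)]; omega)
    ((hf₅ _ (by decide)).trans (by simp [hs₄])) ((hf₅ _ (by decide)).trans (by simp [hs₄]))
    ((hf₅ _ (by decide)).trans (by simp [hs₄])) hW₅ ?_).frame.mono le_rfl ?_)
  · refine ht₃.congr ho₅ fun a p ha _ hp => ⟨ha, ?_⟩
    rw [hm₅]
    · rfl
    · intro c hc h
      have := (address_inj (by omega) (by omega) (by omega) hb0 hb0 (by omega) h).1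
      omega
  rintro s₆ ⟨⟨he₆, hr₆, -⟩, hf₆, -⟩
  refine Wp.seq (fetch_wp (T := 2) he₆.regBase
    ((hf₆ rTag (by decide)).trans ((hf₅ rTag (by decide)).trans (by simp [hs₄])))
    he₆.regZero he₆.regZero he₆.regK (by decide)
    ((address_lt (by decide) hb0 hb0 (by omega)).le.trans hU) ?_)
  refine finish_wp (he₆.setReg (by decide) _) ((skewSchur_ne_zero_iff k lam nu hlam hnu).2 hle) ?_
  rw [← rowMinor_targetRows lam nu N, map_rowMinor, State.setReg_reg, if_pos rfl]
  exact hr₆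

end Main

/-! ### Bounds -/

theorem deletionTime_le {k N : ℕ} (hk : k ≤ N) (hN : 1 ≤ N) : deletionTime k N ≤ 91 * N ^ 3 := by
  have h2 : 1 ≤ N ^ 2 := Nat.one_le_pow _ _ hN
  have h3 : 1 ≤ N ^ 3 := Nat.one_le_pow _ _ hN
  have h : k * (69 * N + 5) ≤ N * (74 * N) := Nat.mul_le_mul hk (by omega)
  calc deletionTime k N ≤ N * (N * (74 * N) + 14 * N ^ 2) + 3 * N ^ 3 := by
        unfold deletionTime
        exact Nat.add_le_add (Nat.mul_le_mul_left _ (by omega)) (by omega)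
    _ = 91 * N ^ 3 := by ring

theorem monomialsTime_le {k N : ℕ} (hk : k ≤ N) (hN : 1 ≤ N) : monomialsTime k N ≤ 31 * N ^ 2 := by
  have h2 : 1 ≤ N ^ 2 := Nat.one_le_pow _ _ hN
  calc monomialsTime k N ≤ N * (28 * N) + 3 * N ^ 2 := by
        unfold monomialsTime
        exact Nat.add_le_add (Nat.mul_le_mul hk (by omega)) (by omega)
    _ = 31 * N ^ 2 := by ring

theorem schurTime_le {k N : ℕ} (hk : k ≤ N) (hN : 1 ≤ N) : schurTime k N + 2 ≤ 132 * N ^ 3 := by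
  have h1 := deletionTime_le hk hN
  have h2 := monomialsTime_le hk hN
  have h3 : N ^ 2 ≤ N ^ 3 := Nat.pow_le_pow_right hN (by omega)
  have h4 : 1 ≤ N ^ 3 := Nat.one_le_pow _ _ hN
  unfold schurTime
  omega

theorem intervalsTime_le {k N : ℕ} (hk : k ≤ N) (hN : 1 ≤ N) :
    intervalsTime k N ≤ 1558 * N ^ 5 := by
  have h1 : deletionTime k (N + k) ≤ 91 * (2 * N) ^ 3 :=
    (deletionTime_le (by omega) (by omega)).trans
      (Nat.mul_le_mul_left _ (Nat.pow_le_pow_left (by omega) 3))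
  have h3 : N ≤ N ^ 3 := Nat.le_self_pow (by omega) N
  have h4 : 1 ≤ N ^ 4 := Nat.one_le_pow _ _ hN
  have h5 : 1 ≤ N ^ 5 := Nat.one_le_pow _ _ hN
  have e : (2 * N) ^ 3 = 8 * N ^ 3 := by ring
  -- `774 = 91 · 8 + 16 + 30`: the deletion with `N + k ≤ 2 N`, the row list, and the constants.
  have h6 : intervalEntryTime k N + 2 ≤ 774 * N ^ 3 := by unfold intervalEntryTime; omega
  have h7 : k * (intervalEntryTime k N + 2) ≤ N * (774 * N ^ 3) := Nat.mul_le_mul hk h6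
  calc intervalsTime k N ≤ (2 * N) * (N * (774 * N ^ 3) + 4 * N ^ 4) + 2 * N ^ 5 := by
        unfold intervalsTime
        exact Nat.add_le_add (Nat.mul_le_mul (by omega) (by omega)) (by omega)
    _ = 1558 * N ^ 5 := by ring

theorem skewTime_le {k N : ℕ} (hk : k ≤ N) (hN : 1 ≤ N) : skewTime k N ≤ 2000 * N ^ 5 := by
  have h1 := intervalsTime_le hk hN
  have h2 := deletionTime_le hk hN
  have h3 : monomialsTime k (N + k) ≤ 31 * (2 * N) ^ 2 :=
    (monomialsTime_le (by omega) (by omega)).trans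
      (Nat.mul_le_mul_left _ (Nat.pow_le_pow_left (by omega) 2))
  have e : (2 * N) ^ 2 = 4 * N ^ 2 := by ring
  have h4 : N ^ 2 ≤ N ^ 5 := Nat.pow_le_pow_right hN (by omega)
  have h5 : N ^ 3 ≤ N ^ 5 := Nat.pow_le_pow_right hN (by omega)
  have h6 : 1 ≤ N ^ 5 := Nat.one_le_pow _ _ hN
  have h7 : N ≤ N ^ 5 := Nat.le_self_pow (by omega) N
  unfold skewTime
  omega

theorem size_mul_pow_five_le (n : ℕ) : (2135 * n ^ 5).size ≤ 12 + 5 * n.size := by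
  rw [Nat.size_le, pow_add, pow_mul']
  have h : n ^ 5 ≤ (2 ^ n.size) ^ 5 := Nat.pow_le_pow_left (Nat.lt_size_self n).le 5
  have h0 : 0 < (2 ^ n.size) ^ 5 := by positivity
  calc 2135 * n ^ 5 ≤ 2135 * (2 ^ n.size) ^ 5 := Nat.mul_le_mul_left _ h
    _ < 2 ^ 12 * (2 ^ n.size) ^ 5 := Nat.mul_lt_mul_of_pos_right (by norm_num) h0

/-- With `n.size = l + 1` and `l ≥ 1` one has `l + 1 ≤ 2 l`, while `l log 2 ≤ log n` and `log 2 > 2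
/ 3`. -/
theorem size_le_log {n : ℕ} (hn : 2 ≤ n) : (n.size : ℝ) ≤ 3 * Real.log n := by
  have h2 : 2 ≤ n.size := by
    by_contra h
    have := (Nat.size_le (m := n) (n := 1)).1 (by omega)
    omega
  obtain ⟨l, hl⟩ : ∃ l, n.size = l + 1 := ⟨n.size - 1, by omega⟩
  have hpow : 2 ^ l ≤ n := by
    by_contra h
    have := Nat.size_le.2 (not_le.1 h)
    omega
  have hlog : (l : ℝ) * Real.log 2 ≤ Real.log n := by
    rw [← Real.log_pow]
    exact Real.log_le_log (by positivity) (by exact_mod_cast hpow)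
  have hl1 : (1 : ℝ) ≤ l := by exact_mod_cast (show 1 ≤ l by omega)
  have := Real.log_two_gt_d9
  rw [hl]
  push_cast
  nlinarith

/-! ### Final complexity bounds -/

/-- The algorithm meets its size bound and its bit complexity bound. -/
theorem skewProgram_correct {k : ℕ} (hk : 0 < k) {lam nu : Fin k → ℕ} (hlam : Antitone lam)
    (hnu : Antitone nu) (hle : ∀ i, nu i ≤ lam i) {n : ℕ} (hn : n = k + lam ⟨0, hk⟩) :
    ∃ (s : State) (t : ℕ), Exec skewProgram (inputState lam nu) s t ∧
      Computes s.out (skewSchur k lam nu) ∧ s.out.length ≤ 2000 * n ^ 5 ∧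
      bitComplexity t s.out n.size ≤ 650000 * n ^ 5 * n.size ^ 2 := by
  have hkn : k ≤ n := by omega
  have hn1 : 1 ≤ n := by omega
  have hlam0 : ∀ i, lam i ≤ lam ⟨0, hk⟩ := fun i => hlam (Nat.zero_le _)
  have h5 : n ^ 3 ≤ n ^ 5 := Nat.pow_le_pow_right hn1 (by omega)
  have hn5 : n ≤ n ^ 5 := Nat.le_self_pow (by omega) n
  -- The bound on all numbers: addresses need `5 · 27 n ^ 3`, gate numbers `2000 n ^ 5`.
  have hU : 5 * (n + k + 1) ^ 3 ≤ 2135 * n ^ 5 := by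
    have h : (n + k + 1) ^ 3 ≤ (3 * n) ^ 3 := Nat.pow_le_pow_left (by omega) 3
    have e : (3 * n) ^ 3 = 27 * n ^ 3 := by ring
    omega
  have hτ := skewTime_le hkn hn1
  have hb : (inputState lam nu).Bounded (2135 * n ^ 5) := by
    refine ⟨fun x => ?_, fun x => ?_⟩
    · simp only [inputState]
      split_ifs <;> omega
    · simp only [inputState]
      split_ifs with h1 h2
      · have := hlam0 ⟨x, h1⟩
        omega
      · have := hlam0 ⟨x - k, h2⟩
        have := hle ⟨x - k, h2⟩
        omega
      · omega
  obtain ⟨s, t, he, ht, -, hl, hc⟩ := skewProgram_wp hlam hnu hk hle hn hU hb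
    (by simp only [inputState, List.length_nil]; omega)
  have hl' : s.out.length ≤ 2000 * n ^ 5 := by
    simp only [inputState, List.length_nil] at hl
    omega
  refine ⟨s, t, he, hc, hl', ?_⟩
  have hs1 : 1 ≤ n.size := Nat.size_pos.2 (by omega)
  -- `1 + 12 + 5 w ≤ 18 w` for `w ≥ 1`. With the arithmetic itself this gives `2000 · (18 ^ 2 + 1) =
  -- 650000`.
  have hκ : (1 + (2135 * n ^ 5).size) ^ 2 ≤ (18 * n.size) ^ 2 :=
    Nat.pow_le_pow_left (by have := size_mul_pow_five_le n; omega) 2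
  calc bitComplexity t s.out n.size ≤ 2000 * n ^ 5 * (18 * n.size) ^ 2 +
        2000 * n ^ 5 * n.size ^ 2 :=
        Nat.add_le_add (ht.trans (Nat.mul_le_mul hτ hκ)) (Nat.mul_le_mul_right _ hl')
    _ = 650000 * n ^ 5 * n.size ^ 2 := by ring

/-- The Schur circuit with `N = n + k ≤ 2 n`, whence `132 · 8 = 1056`. -/
theorem exists_interval_circuit {k n : ℕ} (hkn : k ≤ n) {nu : Fin k → ℕ} (hnu : Antitone nu)
    {a p : ℕ} (hp0 : 0 < p) (hap : a + p ≤ n) (hp : p ≤ k) :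
    ∃ c : Circuit, c.length ≤ 1056 * n ^ 3 ∧
      Computes c (schur k (fun j : Fin p => a - nu (Fin.castLE hp j).rev)) := by
  have hk : 0 < k := by omega
  obtain ⟨c, hl, hc⟩ := exists_schur_circuit (N := n + k) hk
    (intervalRows_strictMono (N := n + k) (a := a) (p := p) hnu hk (by omega))
    (by simp [intervalRows, extendRows]) (by omega) (intervalRows_top (by omega))
    intervalRows_above
  rw [rowMinor_intervalRows hp] at hc
  refine ⟨c, hl.trans ((schurTime_le (by omega) (by omega)).trans ?_), hc⟩
  calc 132 * (n + k) ^ 3 ≤ 132 * (2 * n) ^ 3 :=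
        Nat.mul_le_mul_left _ (Nat.pow_le_pow_left (by omega) 3)
    _ = 1056 * n ^ 3 := by ring

end SkewSchur

theorem theorem2p4 :
    -- one algorithm produces subtraction-free circuits of size `O(n ^ 5)` for all skew Schur
    -- polynomials, with bit complexity `O(n ^ 5 * log ^ 2 n)`, where `n = k + λ_1`
    (∃ (P : SkewSchur.Program) (C : ℕ),
      ∀ (k : ℕ) (hk : 0 < k) (lam nu : Fin k → ℕ), Antitone lam → Antitone nu →
        (∀ i, nu i ≤ lam i) →
        ∀ n : ℕ, n = k + lam ⟨0, hk⟩ →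
        ∃ (s : SkewSchur.State) (t : ℕ),
          SkewSchur.Exec P (SkewSchur.inputState lam nu) s t ∧
          SkewSchur.Computes s.out (SkewSchur.skewSchur k lam nu) ∧
          s.out.length ≤ C * n ^ 5 ∧
          (2 ≤ n →
            (SkewSchur.bitComplexity t s.out n.size : ℝ) ≤ C * (n : ℝ) ^ 5 * Real.log n ^ 2)) ∧
    -- the vanishing criterion
    (∀ (k : ℕ) (lam nu : Fin k → ℕ), Antitone lam → Antitone nu →
      (SkewSchur.skewSchur k lam nu ≠ 0 ↔ ∀ i, nu i ≤ lam i)) ∧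
    -- the interval flag minors of `H_ν`, with rows `a + 1, …, a + p`
    (∃ C : ℕ, ∀ (k n : ℕ), k ≤ n → ∀ nu : Fin k → ℕ, Antitone nu →
      ∀ (a p : ℕ), 0 < p → a + p ≤ n →
      ∀ (hp : p ≤ k) (hI : (Finset.Icc (a + 1) (a + p)).card ≤ k),
        ((∃ j : Fin p, a < nu (Fin.castLE hp j).rev) →
          SkewSchur.flagMinor nu (Finset.Icc (a + 1) (a + p)) hI = 0) ∧
        ((∀ j : Fin p, nu (Fin.castLE hp j).rev ≤ a) →
          SkewSchur.flagMinor nu (Finset.Icc (a + 1) (a + p)) hI =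
            SkewSchur.schur k (fun j : Fin p => a - nu (Fin.castLE hp j).rev) ∧
          ∃ c : SkewSchur.Circuit, c.length ≤ C * n ^ 3 ∧
            SkewSchur.Computes c
              (SkewSchur.flagMinor nu (Finset.Icc (a + 1) (a + p)) hI))) ∧
    -- at an exchange of `e = s_{J ∪ {q}}` for `f = s_{J ∪ {p, r}}`, `e = 0` implies `f = 0`
    (∀ (k : ℕ) (nu : Fin k → ℕ), Antitone nu →
      ∀ (J : Finset ℕ) (p q r : ℕ), p < q → q < r → p ∉ J → q ∉ J → r ∉ J → 0 < p →
      (∀ i ∈ J, 0 < i) →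
      ∀ (he : (insert q J).card ≤ k) (hf : (insert p (insert r J)).card ≤ k),
        SkewSchur.flagMinor nu (insert q J) he = 0 →
          SkewSchur.flagMinor nu (insert p (insert r J)) hf = 0) := by
  -- `5850000 = 650000 · 3 ^ 2`, from the passage from the bit length to `3 log n`.
  refine ⟨⟨SkewSchur.skewProgram, 5850000, ?_⟩, SkewSchur.skewSchur_ne_zero_iff, ⟨1056, ?_⟩, ?_⟩
  · intro k hk lam nu hlam hnu hle n hn
    obtain ⟨s, t, he, hc, hl, hb⟩ := SkewSchur.skewProgram_correct hk hlam hnu hle hn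
    refine ⟨s, t, he, hc, by omega, fun hn2 => ?_⟩
    have hs := SkewSchur.size_le_log hn2
    have hs2 : (n.size : ℝ) ^ 2 ≤ (3 * Real.log n) ^ 2 := pow_le_pow_left₀ (by positivity) hs 2
    calc (SkewSchur.bitComplexity t s.out n.size : ℝ) ≤ 650000 * (n : ℝ) ^ 5 * (n.size : ℝ) ^ 2 := by
          exact_mod_cast hb
      _ ≤ 650000 * (n : ℝ) ^ 5 * (3 * Real.log n) ^ 2 :=
          mul_le_mul_of_nonneg_left hs2 (by positivity)
      _ = (5850000 : ℕ) * (n : ℝ) ^ 5 * Real.log n ^ 2 := by push_cast; ring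
  · intro k n hkn nu hnu a p hp0 hap hp hI
    rw [SkewSchur.flagMinor_interval nu a p hp hI]
    refine ⟨fun ⟨j, hj⟩ => SkewSchur.hMinor_interval_eq_zero hnu hp j hj, fun h => ?_⟩
    rw [SkewSchur.hMinor_interval_eq_schur nu a p hp h]
    exact ⟨rfl, SkewSchur.exists_interval_circuit hkn hnu hp0 hap hp⟩
  · intro k nu hnu J p q r hpq hqr hp hq hr _ _ he hf h
    exact SkewSchur.flagMinor_exchange_eq_zero hnu J p q r hpq hp hq hr hqr he hf h
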